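/- Let $\alpha\in[0,1)$, let $\sigma,k:[0,\infty)\to\mathbb R$ be continuous with $\sigma_t>0$ and $k_t\ge 0$ for all $t\ge 0$ and $k_t>0$ for $t>0$, and let $\eta,\varphi$ be real functions, continuous on $(0,\infty)$, with $\varphi_t\,t\to 0$ as $t\downarrow 0$. An additive process is a real process $\{X_t\}_{t\ge 0}$ with $X_0=0$ a.s., independent increments, continuity in probability and càdlàg paths a.s. An ATS with these parameters is an additive process $\{f_t\}$ with $$\mathbb E\left[e^{iuf_t}\right]=\mathcal L_t\left(iu\left(\tfrac12+\eta_t\right)\sigma_t^2+\tfrac{u^2\sigma_t^2}{2};\,k_t,\alpha\right)e^{iu\varphi_t t}\qquad (t>0,\ u\in\mathbb R),$$ where $$\ln\mathcal L_t(z;k,\alpha)=\begin{cases}\dfrac tk\,\dfrac{1-\alpha}{\alpha}\left\{1-\left(1+\dfrac{zk}{1-\alpha}\right)^{\alpha}\right\},&0<\alpha<1,\\[2mm] -\dfrac tk\ln(1+zk),&\alpha=0,\end{cases}$$ with principal branches. Suppose that the parameters are admissible, that is, that an ATS with these parameters exists on some probability space. Then the following are equivalent. (i) An ATS with these parameters can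 be constructed by independent additive subordination of a Brownian motion: on some probability space there are a standard Brownian motion $W$, an additive subordinator $Z$ (an additive process which is nonnegative and has a.s. nondecreasing paths) independent of $W$, constants $a>0$ and $b\in\mathbb R$, and a deterministic function $c_t$, such that $\{W(aZ_t)+bZ_t+c_t\}_{t\ge 0}$ is an additive process with the characteristic function above. (ii) $\eta_t$ is constant on $(0,\infty)$. -/

import Mathlib

open MeasureTheory ProbabilityTheory Filter Topology
open scoped NNReal

universe u v

/-- An additive process on `ℝ` with time set `[0, ∞)`: a stochastic process which vanishes at time
zero a.s., has independent increments, is continuous in probability and has càdlàg paths a.s.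
(At `t = 0` the left-limit requirement is void.) -/
structure IsAdditiveProcess {Ω : Type*} [MeasurableSpace Ω] (P : Measure Ω)
    (X : ℝ≥0 → Ω → ℝ) : Prop where
  measurable : ∀ t, Measurable (X t)
  zero_ae : ∀ᵐ ω ∂P, X 0 ω = 0
  indep : HasIndepIncrements X P
  continuous_in_prob : ∀ t, TendstoInMeasure P X (𝓝 t) (X t)
  cadlag : ∀ᵐ ω ∂P, ∀ t, ContinuousWithinAt (fun s => X s ω) (Set.Ici t) t ∧
    ∃ l : ℝ, Tendsto (fun s => X s ω) (𝓝[<] t) (𝓝 l)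

/-- An additive subordinator: a nonnegative process which is an additive process and has
nondecreasing paths a.s. -/
structure IsAdditiveSubordinator {Ω : Type*} [MeasurableSpace Ω] (P : Measure Ω)
    (Z : ℝ≥0 → Ω → ℝ≥0) : Prop where
  additive : IsAdditiveProcess P (fun t ω => (Z t ω : ℝ))
  monotone : ∀ᵐ ω ∂P, Monotone (fun t => Z t ω)

/-- `X` is obtained by independent additive subordination of a Brownian motion:
`X t = W (a * Z t) + b * Z t + c t`, with `a > 0` and `b` real constants, `c` a deterministic
function, `W` a standard Brownian motion and `Z` an additive subordinator, the processes `W`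
and `Z` being independent. -/
def IsAdditivelySubordinatedBM {Ω : Type*} [MeasurableSpace Ω] (P : Measure Ω)
    (X : ℝ≥0 → Ω → ℝ) : Prop :=
  ∃ (W : ℝ≥0 → Ω → ℝ) (Z : ℝ≥0 → Ω → ℝ≥0) (a : ℝ≥0) (b : ℝ) (c : ℝ≥0 → ℝ),
    IsBrownianReal W P ∧ (∀ t, Measurable (W t)) ∧ IsAdditiveSubordinator P Z ∧
    IndepFun (fun ω t => W t ω) (fun ω t => Z t ω) P ∧ 0 < a ∧
    ∀ t ω, X t ω = W (a * Z t ω) ω + b * (Z t ω : ℝ) + c t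

/-- The function `ln 𝓛_t (z; k, α)`, with the principal branches of the power and the logarithm
(in the characteristic function below, their arguments have real part at least `1`). -/
noncomputable def logLaplaceTS (t : ℝ) (z : ℂ) (k α : ℝ) : ℂ :=
  if α = 0 then -(t / k : ℂ) * Complex.log (1 + z * k)
  else (t / k : ℂ) * ((1 - α) / α : ℂ) * (1 - (1 + z * k / (1 - α)) ^ (α : ℂ))

/-- The characteristic function at time `t` and argument `x` of the additive normal tempered
stable process (ATS) with parameters `α, σ, k, η, φ`. -/
noncomputable def atsCharFun (α : ℝ) (σ k η φ : ℝ≥0 → ℝ) (t : ℝ≥0) (x : ℝ) : ℂ :=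
  Complex.exp (logLaplaceTS t
      (Complex.I * x * (1 / 2 + η t) * (σ t) ^ 2 + x ^ 2 * (σ t) ^ 2 / 2) (k t) α)
    * Complex.exp (Complex.I * x * (φ t * (t : ℝ) : ℝ))

/-- The standing assumptions on the parameters of an ATS. -/
structure IsATSParameters (α : ℝ) (σ k η φ : ℝ≥0 → ℝ) : Prop where
  alpha_nonneg : 0 ≤ α
  alpha_lt_one : α < 1
  sigma_continuous : Continuous σ
  sigma_pos : ∀ t, 0 < σ t
  k_continuous : Continuous k
  k_nonneg : ∀ t, 0 ≤ k t
  k_pos : ∀ t, 0 < t → 0 < k t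
  eta_continuousOn : ContinuousOn η (Set.Ioi 0)
  phi_continuousOn : ContinuousOn φ (Set.Ioi 0)
  phi_tendsto : Tendsto (fun t : ℝ≥0 => φ t * (t : ℝ)) (𝓝[>] 0) (𝓝 0)

/-- An ATS: an additive process with the ATS characteristic function. -/
structure IsATS {Ω : Type*} [MeasurableSpace Ω] (P : Measure Ω) (α : ℝ) (σ k η φ : ℝ≥0 → ℝ)
    (X : ℝ≥0 → Ω → ℝ) : Prop where
  additive : IsAdditiveProcess P X
  charFun_eq : ∀ t, 0 < t → ∀ x : ℝ, charFun (P.map (X t)) x = atsCharFun α σ k η φ t x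

/-! Conditioning a Brownian motion with drift β on an independent time τ turns its characteristic
function at u into the Laplace transform of τ at u²/2 - iuβ (`integral_cexp_brownian_randomTime`).
By `logLaplaceTS_eq` the exponent of an ATS is, up to the linear term in φ, equal to -γ_t
Ψ_{l_t}(u²/2 + iuθ_t), where θ_t = 1/2 + η_t and Ψ_l(w) = ∫ (1 - e^{-wz}) z^{-1-α} e^{-lz} dz is the
exponent of a tempered stable subordinator. So at each fixed time an ATS is a normal mixture with
drift -θ_t; the question is whether drifts and mixing laws fit together in time.

(i) ⇒ (ii). In the clock τ = aZ_t the drift is β = b/a, whatever t is, so it suffices that a single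
marginal determines its drift: β = -θ_t (`drift_eq_of_charFun_eq`). Continue the identity of
characteristic functions analytically and put u = v + iβ. The Laplace transform is then taken at (v²
+ β²)/2, so it is real for real v. The other side is an exponential exp(E(v)), so E' and E'' are
real there, and E'' no longer sees the deterministic shift. Up to a real factor, E'' is
ρ^{α-2}((α-1)(v+iB)² + ρ) with B = β + θ_t, ρ = ((v+iB)² + R)/2 and R > 0. For large v this is not
real unless B = 0 (`eq_zero_of_im_eq_zero`).

(ii) ⇒ (i). The subordinator must have Lévy density γ_t z^{-1-α} e^{-l_t z} at time t, and it exists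
once this density increases with t; for this γ should be nondecreasing and l nonincreasing. Both
follow from admissibility. The moment E e^{y f_t} is infinite as soon as y²/2 - θy > l_t and finite
when 0 ≤ y²/2 - θy < l_t, and an independent increment cannot make an infinite moment finite; with
the same θ at all times this forces l to decrease (`IsATS.antitoneOn_tempering`). The modulus of the
characteristic function decreases in time, and exponents with different temperings differ by a
bounded amount, so comparing the growth at infinity gives γ_s ≤ γ_t (`IsATS.monotoneOn_activity`).

Given the monotonicity, take Poisson points (z, r) of intensity z^{-1-α} dz dr and let Z_t add the
sizes z of the points with r ≤ γ_t e^{-l_t z}. Paths increase by construction, and successive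
increments use disjoint regions of the plane, hence are independent by Campbell's formula
(`IsJumpLevel.isAdditiveSubordinator_jumpSum`). A Brownian motion built from a Schauder series lives
on a second factor, and W(Z_t) - θZ_t + φ_t t is the required process (`isATS_subordinated`). -/

/-- A criterion for independence in terms of characteristic functions. -/
lemma iIndepFun_of_integral_cexp {Ω : Type*} [MeasurableSpace Ω] {P : Measure Ω}
    [IsProbabilityMeasure P] {n : ℕ} {Y : Fin n → Ω → ℝ} (hY : ∀ j, Measurable (Y j))
    (h : ∀ u : Fin n → ℝ, ∫ ω, Complex.exp (∑ j, ((u j * Y j ω : ℝ) : ℂ) * Complex.I) ∂P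
      = ∏ j, ∫ ω, Complex.exp (((u j * Y j ω : ℝ) : ℂ) * Complex.I) ∂P) :
    iIndepFun Y P := by
  rw [iIndepFun_iff_charFun_pi fun j => (hY j).aemeasurable]
  intro u
  rw [charFun_apply, integral_map (Measurable.aemeasurable (by fun_prop)) (by fun_prop)]
  convert h u using 2
  · ext ω
    simp only [PiLp.inner_apply, Complex.ofReal_sum, Finset.sum_mul]
    rfl
  · rw [charFun_apply_real, integral_map (hY _).aemeasurable (by fun_prop)]
    simp

/-! ### Poisson point processes and Campbell's formula -/

section PoissonPoints

open Measure

variable {E : Type*} [MeasurableSpace E]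

/-- Expand ∏ (1 + (e^{x_i} - 1)) and drop the nonnegative cross terms. This bounds an exponential
moment of a point sum by a mean, to which Campbell's formula applies. -/
lemma one_add_sum_exp_sub_one_le {ι : Type*} (s : Finset ι) (x : ι → ℝ) (hx : ∀ i, 0 ≤ x i) :
    1 + ∑ i ∈ s, (Real.exp (x i) - 1) ≤ Real.exp (∑ i ∈ s, x i) := by
  classical
  induction s using Finset.induction_on with
  | empty => simp
  | insert i s hi ih =>
    rw [Finset.sum_insert hi, Finset.sum_insert hi, Real.exp_add]
    have h1 : 1 ≤ Real.exp (x i) := Real.one_le_exp (hx i)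
    have h2 : 1 ≤ Real.exp (∑ i ∈ s, x i) := Real.one_le_exp (Finset.sum_nonneg fun i _ => hx i)
    nlinarith

/-- The integral of a product of functions of finitely many coordinates. -/
lemma integral_prod_infinitePi {ι : Type*} {X : ι → Type*} {mX : ∀ i, MeasurableSpace (X i)}
    (μ : (i : ι) → Measure (X i)) [∀ i, IsProbabilityMeasure (μ i)] (s : Finset ι)
    {f : (i : ι) → X i → ℂ} (hf : ∀ i, Measurable (f i)) :
    ∫ x, ∏ i ∈ s, f i (x i) ∂(infinitePi μ) = ∏ i ∈ s, ∫ x, f i x ∂(μ i) := by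
  have h := integral_restrict_infinitePi μ (s := s) (f := fun x => ∏ i : s, f i (x i))
    (Measurable.aestronglyMeasurable (by fun_prop))
  rw [integral_fintype_prod_eq_prod (fun i : s => f i)] at h
  rw [← Finset.prod_coe_sort s (fun i => ∫ x, f i x ∂(μ i)), ← h]
  refine integral_congr_ae (ae_of_all _ fun x => ?_)
  simp only [Finset.restrict]
  exact (Finset.prod_coe_sort s (fun i => f i (x i))).symm

/-- The law of a cluster: a Poisson number of points, and an independent sequence of independent
points of law `q`. Only the points with index less than the number are counted. -/
noncomputable def clusterLaw (c : ℝ≥0) (q : Measure E) [IsProbabilityMeasure q] :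
    Measure (ℕ × (ℕ → E)) :=
  (poissonMeasure c).prod (infinitePi fun _ : ℕ => q)

instance (c : ℝ≥0) (q : Measure E) [IsProbabilityMeasure q] :
    IsProbabilityMeasure (clusterLaw c q) := by
  unfold clusterLaw; infer_instance

/-- The sum of a function over the points of a cluster. -/
def clusterSum {F : Type*} [AddCommMonoid F] (f : E → F) (p : ℕ × (ℕ → E)) : F :=
  ∑ i ∈ Finset.range p.1, f (p.2 i)

lemma measurable_clusterSum {F : Type*} [AddCommMonoid F] [MeasurableSpace F] [MeasurableAdd₂ F]
    {f : E → F} (hf : Measurable f) : Measurable (clusterSum f) := by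
  refine measurable_from_prod_countable_right fun n => ?_
  simp only [clusterSum]
  fun_prop

lemma lintegral_poissonMeasure_natCast (c : ℝ≥0) :
    ∫⁻ n : ℕ, (n : ENNReal) ∂(poissonMeasure c) = c := by
  rw [lintegral_countable']
  simp_rw [poissonMeasure_singleton]
  rw [tsum_eq_zero_add' ENNReal.summable]
  simp only [Nat.cast_zero, zero_mul, zero_add]
  -- Size biasing: weighting the Poisson mass at n + 1 by n + 1 gives c times the mass at n.
  have h : ∀ n : ℕ, ((n + 1 : ℕ) : ENNReal) *
      ENNReal.ofReal (Real.exp (-c) * c ^ (n + 1) / (n + 1).factorial)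
      = c * poissonMeasure c {n} := by
    intro n
    rw [poissonMeasure_singleton, ← ENNReal.ofReal_natCast, ← ENNReal.ofReal_mul (by positivity),
      ← ENNReal.ofReal_coe_nnreal, ← ENNReal.ofReal_mul (by positivity)]
    congr 1
    rw [Nat.factorial_succ]
    push_cast
    field_simp
    ring
  simp_rw [h]
  rw [ENNReal.tsum_mul_left]
  have : ∑' n : ℕ, poissonMeasure c {n} = 1 := by
    have := lintegral_countable' (μ := poissonMeasure c) (fun _ => 1)
    simpa using this.symm
  rw [this, mul_one]

lemma lintegral_clusterSum (c : ℝ≥0) (q : Measure E) [IsProbabilityMeasure q] {f : E → ENNReal}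
    (hf : Measurable f) :
    ∫⁻ p, clusterSum f p ∂(clusterLaw c q) = c * ∫⁻ x, f x ∂q := by
  rw [clusterLaw, lintegral_prod _ (measurable_clusterSum hf).aemeasurable]
  have h : ∀ n : ℕ, ∫⁻ y, clusterSum f (n, y) ∂(infinitePi fun _ : ℕ => q)
      = n * ∫⁻ x, f x ∂q := by
    intro n
    simp only [clusterSum]
    rw [lintegral_finsetSum _ (fun i _ => by fun_prop)]
    have : ∀ i : ℕ, ∫⁻ y, f (y i) ∂(infinitePi fun _ : ℕ => q) = ∫⁻ x, f x ∂q := fun i =>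
      (measurePreserving_eval_infinitePi (fun _ : ℕ => q) i).lintegral_comp hf
    simp [this]
  simp_rw [h]
  rw [lintegral_mul_const _ (by fun_prop), lintegral_poissonMeasure_natCast]

/-- Given the number n of points the transform is the n-th power of the one-point transform z, and
the Poisson generating function sums these to e^{-c(1 - z)}. -/
lemma integral_exp_neg_clusterSum (c : ℝ≥0) (q : Measure E) [IsProbabilityMeasure q] {f : E → ℂ}
    (hf : Measurable f) (hre : ∀ x, 0 ≤ (f x).re) :
    ∫ p, Complex.exp (-clusterSum f p) ∂(clusterLaw c q)
      = Complex.exp (-∫ x, (1 - Complex.exp (-f x)) ∂((c : ENNReal) • q)) := by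
  have hb : ∀ x, ‖Complex.exp (-f x)‖ ≤ 1 := fun x => by
    rw [Complex.norm_exp]; simpa using hre x
  have hI : Integrable (fun x => Complex.exp (-f x)) q :=
    Integrable.of_bound (by fun_prop) 1 (ae_of_all _ hb)
  have hb' : ∀ p, ‖Complex.exp (-clusterSum f p)‖ ≤ 1 := fun p => by
    rw [Complex.norm_exp]
    simp only [clusterSum, Complex.neg_re, Complex.re_sum, Real.exp_le_one_iff, neg_nonpos]
    exact Finset.sum_nonneg fun i _ => hre _
  have hm := measurable_clusterSum hf
  rw [clusterLaw, integral_prod]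
  swap
  · exact Integrable.of_bound (by fun_prop) 1 (ae_of_all _ hb')
  have h : ∀ n : ℕ, ∫ y, Complex.exp (-clusterSum f (n, y)) ∂(infinitePi fun _ : ℕ => q)
      = (∫ x, Complex.exp (-f x) ∂q) ^ n := by
    intro n
    simp only [clusterSum, ← Finset.sum_neg_distrib, Complex.exp_sum]
    rw [integral_prod_infinitePi (fun _ : ℕ => q) (Finset.range n)
      (f := fun _ x => Complex.exp (-f x)) (fun _ => by fun_prop)]
    simp
  simp_rw [h]
  rw [integral_poissonMeasure, integral_smul_measure, integral_sub (integrable_const _) hI]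
  set z := ∫ x, Complex.exp (-f x) ∂q
  simp only [integral_const, probReal_univ, one_smul, ENNReal.coe_toReal]
  have h2 := (NormedSpace.expSeries_div_hasSum_exp ((c : ℂ) * z)).mul_left (Complex.exp (-c))
  have h3 : ∀ n : ℕ, (Real.exp (-c) * c ^ n / n.factorial : ℝ) • z ^ n
      = Complex.exp (-c) * ((c * z) ^ n / n.factorial) := by
    intro n
    rw [Complex.real_smul]
    push_cast
    rw [mul_pow]
    ring
  simp_rw [h3]
  rw [h2.tsum_eq, ← Complex.exp_eq_exp_ℂ, ← Complex.exp_add]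
  congr 1
  rw [Complex.real_smul]
  ring

/-- The intensity of a Poisson point process. -/
noncomputable def pointIntensity (c : ℕ → ℝ≥0) (q : ℕ → Measure E) : Measure E :=
  Measure.sum fun n => (c n : ENNReal) • q n

/-- Every s-finite measure is the intensity of a Poisson point process. -/
lemma exists_pointIntensity_eq [Nonempty E] (μ : Measure E) [SFinite μ] :
    ∃ (c : ℕ → ℝ≥0) (q : ℕ → Measure E) (_ : ∀ n, IsProbabilityMeasure (q n)),
      pointIntensity c q = μ := by
  classical
  have h : ∀ n, ∃ (r : ℝ≥0) (p : Measure E), IsProbabilityMeasure p ∧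
      (r : ENNReal) • p = sfiniteSeq μ n := by
    intro n
    by_cases h0 : sfiniteSeq μ n = 0
    -- A null piece cannot be normalised; it gets weight 0 and an arbitrary law.
    · exact ⟨0, dirac (Classical.arbitrary E), inferInstance, by simp [h0]⟩
    · have : NeZero (sfiniteSeq μ n) := ⟨h0⟩
      refine ⟨(sfiniteSeq μ n Set.univ).toNNReal,
        (sfiniteSeq μ n Set.univ)⁻¹ • sfiniteSeq μ n, inferInstance, ?_⟩
      rw [ENNReal.coe_toNNReal (measure_ne_top _ _), smul_smul,
        ENNReal.mul_inv_cancel (by simpa using h0) (measure_ne_top _ _), one_smul]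
  choose r p hp hrp using h
  refine ⟨r, p, hp, ?_⟩
  unfold pointIntensity
  simp_rw [hrp]
  exact sum_sfiniteSeq μ

variable (c : ℕ → ℝ≥0) (q : ℕ → Measure E) [∀ n, IsProbabilityMeasure (q n)]

/-- The law of a Poisson point process of intensity `∑ n, c n • q n`, as a sequence of independent
clusters. -/
noncomputable def pointLaw : Measure (ℕ → ℕ × (ℕ → E)) :=
  infinitePi fun n => clusterLaw (c n) (q n)

instance : IsProbabilityMeasure (pointLaw c q) := by
  unfold pointLaw; infer_instance

/-- The sum of a function over the points of a point configuration. -/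
noncomputable def pointSum {F : Type*} [AddCommMonoid F] [TopologicalSpace F] (f : E → F)
    (ω : ℕ → ℕ × (ℕ → E)) : F :=
  ∑' n, clusterSum f (ω n)

lemma measurable_pointSum {f : E → ENNReal} (hf : Measurable f) : Measurable (pointSum f) := by
  have := measurable_clusterSum hf
  unfold pointSum
  fun_prop

/-- Campbell's formula for the mean of a sum over a Poisson point process. -/
lemma lintegral_pointSum {f : E → ENNReal} (hf : Measurable f) :
    ∫⁻ ω, pointSum f ω ∂(pointLaw c q) = ∫⁻ x, f x ∂(pointIntensity c q) := by
  have hm := measurable_clusterSum hf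
  unfold pointSum
  rw [lintegral_tsum fun n => Measurable.aemeasurable (by fun_prop), pointIntensity,
    lintegral_sum_measure]
  congr with n
  rw [lintegral_smul_measure, smul_eq_mul, ← lintegral_clusterSum _ _ hf]
  exact (measurePreserving_eval_infinitePi (fun n => clusterLaw (c n) (q n)) n).lintegral_comp hm

/-- The sum of |f| over all points has finite mean by Campbell's formula, so it is a.s. finite. -/
lemma ae_summable_clusterSum {f : E → ℂ} (hf : Measurable f)
    (hi : Integrable f (pointIntensity c q)) :
    ∀ᵐ ω ∂(pointLaw c q), Summable fun n => clusterSum f (ω n) := by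
  have h := lintegral_pointSum c q hf.enorm
  have h2 := ae_lt_top (measurable_pointSum hf.enorm) (h.trans_lt hi.2).ne
  filter_upwards [h2] with ω hω
  refine Summable.of_enorm (ne_top_of_le_ne_top hω.ne ?_)
  exact ENNReal.tsum_le_tsum fun n => enorm_sum_le _ _

/-- **Campbell's formula** for the Laplace transform of a sum over a Poisson point process. -/
theorem integral_exp_neg_pointSum {f : E → ℂ} (hf : Measurable f) (hre : ∀ x, 0 ≤ (f x).re)
    (hi : Integrable f (pointIntensity c q)) :
    ∫ ω, Complex.exp (-pointSum f ω) ∂(pointLaw c q)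
      = Complex.exp (-∫ x, (1 - Complex.exp (-f x)) ∂(pointIntensity c q)) := by
  have hm := measurable_clusterSum hf
  have hi' : Integrable (fun x => 1 - Complex.exp (-f x)) (pointIntensity c q) := by
    refine Integrable.mono' (g := fun x => 2 * ‖f x‖) (hi.norm.const_mul 2) (by fun_prop)
      (ae_of_all _ fun x => ?_)
    rcases le_or_gt ‖f x‖ 1 with h | h
    · rw [norm_sub_rev]
      have := Complex.norm_exp_sub_one_le (x := -f x) (by simpa using h)
      simpa using this
    · have : ‖Complex.exp (-f x)‖ ≤ 1 := by
        rw [Complex.norm_exp]; simpa using hre x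
      calc ‖1 - Complex.exp (-f x)‖ ≤ ‖(1 : ℂ)‖ + ‖Complex.exp (-f x)‖ := norm_sub_le _ _
        _ ≤ 2 * ‖f x‖ := by simp only [norm_one]; linarith
  have hpart : ∀ m : ℕ, ∫ ω, Complex.exp (-∑ n ∈ Finset.range m, clusterSum f (ω n))
      ∂(pointLaw c q) = Complex.exp (-∑ n ∈ Finset.range m,
        ∫ x, (1 - Complex.exp (-f x)) ∂((c n : ENNReal) • q n)) := by
    intro m
    simp only [← Finset.sum_neg_distrib, Complex.exp_sum]
    rw [pointLaw, integral_prod_infinitePi _ (Finset.range m)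
      (f := fun _ p => Complex.exp (-clusterSum f p)) (fun _ => by fun_prop)]
    exact Finset.prod_congr rfl fun n _ => integral_exp_neg_clusterSum _ _ hf hre
  have hlim1 : Tendsto (fun m => ∫ ω, Complex.exp (-∑ n ∈ Finset.range m, clusterSum f (ω n))
      ∂(pointLaw c q)) atTop (𝓝 (∫ ω, Complex.exp (-pointSum f ω) ∂(pointLaw c q))) := by
    refine tendsto_integral_of_dominated_convergence (fun _ => 1)
      (fun m => Measurable.aestronglyMeasurable (by fun_prop))
      (integrable_const _) (fun m => ae_of_all _ fun ω => ?_) ?_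
    · rw [Complex.norm_exp]
      simp only [clusterSum, Complex.neg_re, Complex.re_sum, Real.exp_le_one_iff, neg_nonpos]
      exact Finset.sum_nonneg fun n _ => Finset.sum_nonneg fun i _ => hre _
    · filter_upwards [ae_summable_clusterSum c q hf hi] with ω hω
      exact (Complex.continuous_exp.tendsto _).comp hω.hasSum.tendsto_sum_nat.neg
  have hlim2 := (Complex.continuous_exp.tendsto _).comp
    (hasSum_integral_measure (f := fun x => 1 - Complex.exp (-f x)) hi').tendsto_sum_nat.neg
  simp_rw [hpart] at hlim1
  exact tendsto_nhds_unique hlim1 hlim2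

/-- A lower bound for exponential moments of a sum over a Poisson point process. -/
lemma lintegral_exp_sub_one_le {f : E → ℝ} (hf : Measurable f) (hpos : ∀ x, 0 ≤ f x)
    (hi : Integrable f (pointIntensity c q)) :
    ∫⁻ x, ENNReal.ofReal (Real.exp (f x) - 1) ∂(pointIntensity c q)
      ≤ ∫⁻ ω, ENNReal.ofReal (Real.exp (pointSum f ω)) ∂(pointLaw c q) := by
  rw [← lintegral_pointSum c q (by fun_prop)]
  have hs := ae_summable_clusterSum c q (f := fun x => (f x : ℂ)) (by fun_prop) hi.ofReal
  refine lintegral_mono_ae ?_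
  filter_upwards [hs] with ω hω
  have hω' : Summable fun n => clusterSum f (ω n) := by
    rw [← Complex.summable_ofReal]
    simpa [clusterSum] using hω
  refine ENNReal.tsum_le_of_sum_range_le fun m => ?_
  have h0 : ∀ n, clusterSum (fun x => ENNReal.ofReal (Real.exp (f x) - 1)) (ω n)
      = ENNReal.ofReal (clusterSum (fun x => Real.exp (f x) - 1) (ω n)) := fun n => by
    simp only [clusterSum]
    rw [ENNReal.ofReal_sum_of_nonneg]
    intro i _
    have := Real.one_le_exp (hpos ((ω n).2 i))
    linarith
  simp_rw [h0]
  rw [← ENNReal.ofReal_sum_of_nonneg]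
  swap
  · intro n _
    refine Finset.sum_nonneg fun i _ => ?_
    have := Real.one_le_exp (hpos ((ω n).2 i))
    linarith
  refine ENNReal.ofReal_le_ofReal ?_
  have h1 : ∑ n ∈ Finset.range m, clusterSum f (ω n) ≤ pointSum f ω :=
    hω'.sum_le_tsum _ fun n _ => Finset.sum_nonneg fun i _ => hpos _
  refine le_trans ?_ (Real.exp_le_exp.2 h1)
  simp only [clusterSum, Finset.sum_sigma']
  have := one_add_sum_exp_sub_one_le
    ((Finset.range m).sigma fun n => Finset.range (ω n).1) (fun p => f ((ω p.1).2 p.2))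
    (fun p => hpos _)
  linarith

end PoissonPoints

/-! ### Laplace exponent of the tempered stable subordinator -/

section LevyExponent

/-- The density of the Lévy measure of the tempered stable subordinator. -/
noncomputable def tsDensity (α l z : ℝ) : ℝ := z ^ (-1 - α) * Real.exp (-l * z)

/-- The Laplace exponent of the tempered stable subordinator with stability index `α` and
tempering `l`. -/
noncomputable def tsExponent (α l : ℝ) (w : ℂ) : ℂ :=
  ∫ z in Set.Ioi (0 : ℝ), (1 - Complex.exp (-(w * z))) * (tsDensity α l z : ℂ)

lemma tsDensity_nonneg (α l : ℝ) {z : ℝ} (hz : 0 < z) : 0 ≤ tsDensity α l z := by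
  unfold tsDensity; positivity

lemma mul_tsDensity (α l : ℝ) {z : ℝ} (hz : 0 < z) :
    z * tsDensity α l z = z ^ (-α) * Real.exp (-l * z) := by
  unfold tsDensity
  rw [← mul_assoc, mul_comm z, ← Real.rpow_add_one hz.ne']
  ring_nf

@[fun_prop]
lemma measurable_tsDensity (α l : ℝ) : Measurable (tsDensity α l) := by
  unfold tsDensity; fun_prop

lemma integrableOn_mul_tsDensity {α l : ℝ} (hα : α < 1) (hl : 0 < l) :
    IntegrableOn (fun z => z * tsDensity α l z) (Set.Ioi 0) := by
  have h := integrableOn_rpow_mul_exp_neg_mul_rpow (s := -α) (p := 1) (b := l)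
    (by linarith) one_pos hl
  refine h.congr_fun (fun z hz => ?_) measurableSet_Ioi
  simp only [Real.rpow_one]
  exact (mul_tsDensity α l hz).symm

lemma integral_mul_tsDensity {α l : ℝ} (hα : α < 1) (hl : 0 < l) :
    ∫ z in Set.Ioi (0 : ℝ), z * tsDensity α l z = l ^ (α - 1) * Real.Gamma (1 - α) := by
  have h := Real.integral_rpow_mul_exp_neg_mul_Ioi (a := 1 - α) (r := l) (by linarith) hl
  rw [one_div, Real.inv_rpow hl.le, ← Real.rpow_neg hl.le, neg_sub] at h
  rw [← h]
  refine setIntegral_congr_fun measurableSet_Ioi fun z hz => ?_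
  rw [mul_tsDensity α l hz]
  ring_nf

/-- The value of the constant is immaterial. A bound linear in w over the whole half-plane reduces
integrability in the Laplace exponent to the first moment of the Lévy density. -/
lemma norm_one_sub_exp_neg_le {w : ℂ} (hw : 0 ≤ w.re) : ‖1 - Complex.exp (-w)‖ ≤ 2 * ‖w‖ := by
  rcases le_or_gt ‖w‖ 1 with h | h
  · rw [norm_sub_rev]
    have := Complex.norm_exp_sub_one_le (x := -w) (by simpa using h)
    simpa using this
  · have : ‖Complex.exp (-w)‖ ≤ 1 := by
      rw [Complex.norm_exp]; simpa using hw
    calc ‖1 - Complex.exp (-w)‖ ≤ ‖(1 : ℂ)‖ + ‖Complex.exp (-w)‖ := norm_sub_le _ _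
      _ ≤ 2 * ‖w‖ := by simp only [norm_one]; linarith

lemma integrableOn_tsExponent {α l : ℝ} (hα : α < 1) (hl : 0 < l) {w : ℂ} (hw : 0 ≤ w.re) :
    IntegrableOn (fun z : ℝ => (1 - Complex.exp (-(w * z))) * (tsDensity α l z : ℂ))
      (Set.Ioi 0) := by
  refine Integrable.mono' ((integrableOn_mul_tsDensity hα hl).const_mul (2 * ‖w‖))
    (Measurable.aestronglyMeasurable (by fun_prop)) ?_
  refine (ae_restrict_mem measurableSet_Ioi).mono fun z (hz : 0 < z) => ?_
  have h := norm_one_sub_exp_neg_le (w := w * z) (by simpa using mul_nonneg hw hz.le)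
  rw [norm_mul, Complex.norm_real, Real.norm_of_nonneg (tsDensity_nonneg α l hz)]
  rw [norm_mul, Complex.norm_real, Real.norm_of_nonneg hz.le] at h
  have := mul_le_mul_of_nonneg_right h (tsDensity_nonneg α l hz)
  linarith

/-- The identity theorem for two functions which agree on a segment. -/
lemma eqOn_of_eventually_eq_segment {f g : ℂ → ℂ} {U : Set ℂ} (hf : AnalyticOnNhd ℂ f U)
    (hg : AnalyticOnNhd ℂ g U) (hU : IsPreconnected U) {z d : ℂ} (hz : z ∈ U) (hd : d ≠ 0)
    (h : ∀ᶠ x : ℝ in 𝓝[>] 0, f (z + x * d) = g (z + x * d)) : Set.EqOn f g U := by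
  refine hf.eqOn_of_preconnected_of_frequently_eq hg hU hz ?_
  have ht : Tendsto (fun x : ℝ => z + x * d) (𝓝[>] 0) (𝓝[≠] z) := by
    refine tendsto_nhdsWithin_iff.2 ⟨?_, ?_⟩
    · have : Continuous fun x : ℝ => z + x * d := by fun_prop
      simpa using (this.tendsto 0).mono_left nhdsWithin_le_nhds
    · filter_upwards [self_mem_nhdsWithin] with x hx
      have : (x : ℂ) ≠ 0 := by exact_mod_cast (ne_of_gt hx)
      simp [this, hd]
  exact ht.frequently h.frequently

/-- The Gamma integral behind the derivative of the Laplace exponent. -/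
lemma integral_cexp_mul_tsDensity {α l : ℝ} (hα : α < 1) {w : ℂ} (hw : 0 < l + w.re) :
    ∫ z in Set.Ioi (0 : ℝ), Complex.exp (-(w * z)) * ((z * tsDensity α l z : ℝ) : ℂ)
      = Real.Gamma (1 - α) * (l + w) ^ ((α : ℂ) - 1) := by
  set d : ℝ → ENNReal := fun z => ENNReal.ofReal (z * tsDensity α l z) with hd
  set ν := (volume.restrict (Set.Ioi (0 : ℝ))).withDensity d with hν
  have hdm : Measurable d := by fun_prop
  have hmgf : ∀ m : ℂ, complexMGF id ν m
      = ∫ z in Set.Ioi (0 : ℝ), Complex.exp (m * z) * ((z * tsDensity α l z : ℝ) : ℂ) := by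
    intro m
    rw [complexMGF, hν, integral_withDensity_eq_integral_toReal_smul hdm
      (ae_of_all _ fun z => ENNReal.ofReal_lt_top)]
    refine setIntegral_congr_fun measurableSet_Ioi fun z (hz : 0 < z) => ?_
    simp only [hd]
    rw [ENNReal.toReal_ofReal (mul_nonneg hz.le (tsDensity_nonneg α l hz)), Complex.real_smul,
      mul_comm]
    rfl
  have hexp : ∀ m z : ℝ, Real.exp (m * z) * (z * tsDensity α l z)
      = z * tsDensity α (l - m) z := by
    intro m z
    have : Real.exp (-(l - m) * z) = Real.exp (m * z) * Real.exp (-l * z) := by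
      rw [← Real.exp_add]; ring_nf
    rw [tsDensity, tsDensity, this]
    ring
  have hset : Set.Iio l ⊆ integrableExpSet id ν := by
    intro m (hm : m < l)
    rw [integrableExpSet, Set.mem_ofPred_eq, hν, integrable_withDensity_iff_integrable_smul₀'
      hdm.aemeasurable (ae_of_all _ fun z => ENNReal.ofReal_lt_top)]
    refine (integrableOn_mul_tsDensity hα (sub_pos.2 hm)).congr_fun (fun z (hz : 0 < z) => ?_)
      measurableSet_Ioi
    simp only [hd, id]
    rw [ENNReal.toReal_ofReal (mul_nonneg hz.le (tsDensity_nonneg α l hz)), smul_eq_mul, ← hexp,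
      mul_comm]
  set U : Set ℂ := {m | m.re < l} with hU
  have hA : AnalyticOnNhd ℂ (complexMGF id ν) U := by
    refine analyticOnNhd_complexMGF.mono fun m (hm : m.re < l) => ?_
    exact interior_maximal hset isOpen_Iio hm
  have hB : AnalyticOnNhd ℂ (fun m : ℂ => Real.Gamma (1 - α) * (l - m) ^ ((α : ℂ) - 1)) U := by
    refine DifferentiableOn.analyticOnNhd (fun m (hm : m.re < l) => ?_)
      (isOpen_lt Complex.continuous_re continuous_const)
    have : (l : ℂ) - m ∈ Complex.slitPlane := Or.inl (by simpa using hm)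
    refine DifferentiableAt.differentiableWithinAt ?_
    exact (((differentiableAt_const _).sub differentiableAt_id).cpow_const this).const_mul _
  -- At the real points l - 1 - x with x > 0 the integral is a real Gamma integral with tempering 1
  -- + x; analyticity carries the formula to the whole half-plane.
  have hEq := eqOn_of_eventually_eq_segment hA hB (convex_halfSpace_re_lt l).isPreconnected
    (z := (l - 1 : ℝ)) (d := -1) (by simp [hU]) (by simp) (by
      filter_upwards [self_mem_nhdsWithin] with x (hx : 0 < x)
      have : ((l - 1 : ℝ) : ℂ) + x * -1 = ((l - 1 - x : ℝ) : ℂ) := by push_cast; ring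
      rw [this, hmgf]
      have h1 : ∀ z : ℝ, Complex.exp ((l - 1 - x : ℝ) * z) * ((z * tsDensity α l z : ℝ) : ℂ)
          = ((z * tsDensity α (1 + x) z : ℝ) : ℂ) := by
        intro z
        have := hexp (l - 1 - x) z
        rw [show l - (l - 1 - x) = 1 + x by ring] at this
        rw [← this]
        push_cast
        rfl
      simp_rw [h1]
      rw [integral_complex_ofReal, integral_mul_tsDensity hα (by linarith), Complex.ofReal_mul,
        Complex.ofReal_cpow (by linarith), mul_comm]
      push_cast
      ring_nf)
  have h := hEq (show -w ∈ U by simp [hU]; linarith)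
  rw [hmgf] at h
  simpa using h

lemma hasDerivAt_tsExponent_ray {α l : ℝ} (hα : α < 1) (hl : 0 < l) {w : ℂ} (hw : 0 ≤ w.re)
    {x : ℝ} (hx : 0 ≤ x) :
    HasDerivAt (fun x : ℝ => tsExponent α l (x * w))
      (w * (Real.Gamma (1 - α) * (l + x * w) ^ ((α : ℂ) - 1))) x := by
  -- Giving up half of the tempering leaves an open set of parameters, with room on both sides even
  -- at x = 0; on it the density with tempering l/2 dominates.
  set s : Set ℝ := {x | l / 2 < l + x * w.re} with hs
  have hs_open : IsOpen s := isOpen_lt (by fun_prop) (by fun_prop)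
  have hxs : x ∈ s := by
    have := mul_nonneg hx hw
    simp only [hs, Set.mem_ofPred_eq]
    linarith
  have hI := integrableOn_mul_tsDensity (α := α) (l := l / 2) hα (by linarith)
  have hre : 0 ≤ (x * w).re := by simpa using mul_nonneg hx hw
  have key := hasDerivAt_integral_of_dominated_loc_of_deriv_le
    (μ := volume.restrict (Set.Ioi (0 : ℝ)))
    (F := fun (x : ℝ) (z : ℝ) => (1 - Complex.exp (-(x * w * z))) * (tsDensity α l z : ℂ))
    (F' := fun (x : ℝ) (z : ℝ) =>
      w * (Complex.exp (-(x * w * z)) * ((z * tsDensity α l z : ℝ) : ℂ)))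
    (x₀ := x) (s := s) (bound := fun z => ‖w‖ * (z * tsDensity α (l / 2) z))
    (hs_open.mem_nhds hxs)
    (Eventually.of_forall fun x => Measurable.aestronglyMeasurable (by fun_prop))
    (integrableOn_tsExponent hα hl hre)
    (Measurable.aestronglyMeasurable (by fun_prop)) ?_ (hI.const_mul _) ?_
  · have h2 := key.2
    rw [integral_const_mul, integral_cexp_mul_tsDensity hα (by linarith)] at h2
    exact h2
  · refine (ae_restrict_mem measurableSet_Ioi).mono fun z (hz : 0 < z) y hy => ?_
    rw [norm_mul, norm_mul, Complex.norm_exp, Complex.norm_real,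
      Real.norm_of_nonneg (mul_nonneg hz.le (tsDensity_nonneg α l hz))]
    refine mul_le_mul_of_nonneg_left ?_ (norm_nonneg _)
    rw [mul_tsDensity α l hz, mul_tsDensity α _ hz, mul_left_comm, ← Real.exp_add]
    refine mul_le_mul_of_nonneg_left (Real.exp_le_exp.2 ?_) (by positivity)
    simp only [hs, Set.mem_ofPred_eq] at hy
    simp
    nlinarith
  · refine ae_of_all _ fun z y _ => ?_
    have h1 : HasDerivAt (fun x : ℝ => -((x : ℂ) * w * z)) (-(1 * w * z)) y :=
      ((Complex.ofRealCLM.hasDerivAt.mul_const w).mul_const (z : ℂ)).neg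
    have h2 := ((h1.cexp.const_sub 1).mul_const (tsDensity α l z : ℂ))
    refine h2.congr_deriv ?_
    push_cast
    ring

lemma add_ray_mem_slitPlane {l : ℝ} (hl : 0 < l) {w : ℂ} (hw : 0 ≤ w.re) {x : ℝ} (hx : 0 ≤ x) :
    (l : ℂ) + x * w ∈ Complex.slitPlane := by
  left
  have := mul_nonneg hx hw
  simp
  linarith

/-- The Frullani integral. -/
theorem tsExponent_zero_eq {l : ℝ} (hl : 0 < l) {w : ℂ} (hw : 0 ≤ w.re) :
    tsExponent 0 l w = Complex.log (l + w) - Complex.log l := by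
  -- Both sides have the same derivative along the segment from 0 to w, and x = 0 fixes the
  -- constant.
  have hd : ∀ x ∈ Set.Icc (0 : ℝ) 1, HasDerivAt
      (fun x : ℝ => tsExponent 0 l (x * w) - Complex.log (l + x * w)) 0 x := by
    intro x hx
    have h1 := hasDerivAt_tsExponent_ray (α := 0) one_pos hl hw hx.1
    have h2 : HasDerivAt (fun x : ℝ => (l : ℂ) + x * w) (1 * w) x :=
      (Complex.ofRealCLM.hasDerivAt.mul_const w).const_add _
    have h3 := h1.sub (h2.clog_real (add_ray_mem_slitPlane hl hw hx.1))
    refine h3.congr_deriv ?_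
    simp [Complex.cpow_neg_one, div_eq_mul_inv]
  have h := constant_of_has_deriv_right_zero
    (fun x hx => (hd x hx).continuousAt.continuousWithinAt)
    (fun x hx => (hd x (Set.Ico_subset_Icc_self hx)).hasDerivWithinAt) 1 (by simp)
  have h0 : tsExponent 0 l 0 = 0 := by simp [tsExponent]
  simp only [Complex.ofReal_one, one_mul, Complex.ofReal_zero, zero_mul, add_zero, h0] at h
  linear_combination h

theorem tsExponent_eq {α l : ℝ} (hα0 : 0 < α) (hα : α < 1) (hl : 0 < l) {w : ℂ} (hw : 0 ≤ w.re) :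
    tsExponent α l w
      = Real.Gamma (1 - α) / α * ((l + w) ^ (α : ℂ) - (l : ℂ) ^ (α : ℂ)) := by
  have hα0' : (α : ℂ) ≠ 0 := by exact_mod_cast hα0.ne'
  have hd : ∀ x ∈ Set.Icc (0 : ℝ) 1, HasDerivAt
      (fun x : ℝ => tsExponent α l (x * w) -
        Real.Gamma (1 - α) / α * (l + x * w) ^ (α : ℂ)) 0 x := by
    intro x hx
    have h1 := hasDerivAt_tsExponent_ray hα hl hw hx.1
    have h2 : HasDerivAt (fun x : ℝ => (l : ℂ) + x * w) (1 * w) x :=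
      (Complex.ofRealCLM.hasDerivAt.mul_const w).const_add _
    have h4 := (Complex.hasStrictDerivAt_cpow_const (c := (α : ℂ))
      (add_ray_mem_slitPlane hl hw hx.1)).hasDerivAt.comp x h2
    have h3 := h1.sub (h4.const_mul ((Real.Gamma (1 - α) : ℂ) / α))
    refine h3.congr_deriv ?_
    field_simp
    ring
  have h := constant_of_has_deriv_right_zero
    (fun x hx => (hd x hx).continuousAt.continuousWithinAt)
    (fun x hx => (hd x (Set.Ico_subset_Icc_self hx)).hasDerivWithinAt) 1 (by simp)
  have h0 : tsExponent α l 0 = 0 := by simp [tsExponent]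
  simp only [Complex.ofReal_one, one_mul, Complex.ofReal_zero, zero_mul, add_zero, h0] at h
  linear_combination h

/-- The tempering parameter of the subordinator of an ATS. -/
noncomputable def atsTempering (α σ k : ℝ) : ℝ := (1 - α) / (k * σ ^ 2)

/-- The activity of the subordinator of an ATS. -/
noncomputable def atsActivity (α t σ k : ℝ) : ℝ :=
  t * σ ^ 2 * atsTempering α σ k ^ (1 - α) / Real.Gamma (1 - α)

lemma atsTempering_pos {α σ k : ℝ} (hα : α < 1) (hσ : 0 < σ) (hk : 0 < k) :
    0 < atsTempering α σ k := by
  have : 0 < 1 - α := by linarith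
  unfold atsTempering; positivity

lemma atsActivity_pos {α t σ k : ℝ} (hα : α < 1) (ht : 0 < t) (hσ : 0 < σ) (hk : 0 < k) :
    0 < atsActivity α t σ k := by
  have := atsTempering_pos hα hσ hk
  have : 0 < Real.Gamma (1 - α) := Real.Gamma_pos_of_pos (by linarith)
  unfold atsActivity; positivity

/-- The exponent of an ATS in terms of the Laplace exponent of the tempered stable subordinator. -/
theorem logLaplaceTS_eq {α t σ k : ℝ} (hα0 : 0 ≤ α) (hα : α < 1) (hσ : 0 < σ) (hk : 0 < k)
    {w : ℂ} (hw : 0 ≤ w.re) :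
    logLaplaceTS t (σ ^ 2 * w) k α
      = -(atsActivity α t σ k * tsExponent α (atsTempering α σ k) w) := by
  have hl := atsTempering_pos hα hσ hk
  have hG : Real.Gamma (1 - α) ≠ 0 := (Real.Gamma_pos_of_pos (by linarith)).ne'
  have hσ' : σ ≠ 0 := hσ.ne'
  have hk' : k ≠ 0 := hk.ne'
  have hα' : 1 - α ≠ 0 := by linarith
  unfold atsActivity
  set l := atsTempering α σ k with hldef
  have hl' : (l : ℂ) ≠ 0 := by exact_mod_cast hl.ne'
  have hkl : k = (1 - α) / (l * σ ^ 2) := by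
    rw [hldef, atsTempering]
    field_simp
  -- With k eliminated in favour of l, the base of the power is (l + w)/l. The positive factor 1/l
  -- comes out of the principal branches.
  have hz : (1 : ℂ) + σ ^ 2 * w * k / (1 - α) = ((l⁻¹ : ℝ) : ℂ) * (l + w) := by
    have h1 : ((1 : ℂ) - α) ≠ 0 := by exact_mod_cast hα'
    have h2 : (σ : ℂ) ≠ 0 := by exact_mod_cast hσ'
    rw [hkl]
    push_cast
    field_simp
  have hlw : (l : ℂ) + w ≠ 0 := by
    intro h
    have := congrArg Complex.re h
    simp at this
    linarith
  rcases hα0.eq_or_lt with rfl | hα0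
  · rw [logLaplaceTS, if_pos rfl, tsExponent_zero_eq hl hw]
    have : (1 : ℂ) + σ ^ 2 * w * k = ((l⁻¹ : ℝ) : ℂ) * (l + w) := by
      rw [← hz]; simp
    rw [this, Complex.log_ofReal_mul (inv_pos.2 hl) hlw, Real.log_inv, ← Complex.ofReal_log hl.le]
    rw [hkl]
    have h2 : (σ : ℂ) ≠ 0 := by exact_mod_cast hσ'
    simp
    field_simp
    ring
  · rw [logLaplaceTS, if_neg hα0.ne', tsExponent_eq hα0 hα hl hw, hz,
      Complex.cpow_def_of_ne_zero (mul_ne_zero (by exact_mod_cast (inv_pos.2 hl).ne') hlw),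
      Complex.log_ofReal_mul (inv_pos.2 hl) hlw, add_mul, Complex.exp_add,
      ← Complex.cpow_def_of_ne_zero hlw, Real.log_inv]
    have h1 : Complex.exp ((-Real.log l : ℝ) * (α : ℂ)) = (((l ^ α)⁻¹ : ℝ) : ℂ) := by
      rw [← Complex.ofReal_mul, ← Complex.ofReal_exp, ← Real.rpow_neg hl.le,
        Real.rpow_def_of_pos hl]
      ring_nf
    have h2 : l ^ (1 - α) = l * (l ^ α)⁻¹ := by
      rw [Real.rpow_sub hl, Real.rpow_one, div_eq_mul_inv]
    have h3 : (l : ℂ) ^ (α : ℂ) = ((l ^ α : ℝ) : ℂ) := (Complex.ofReal_cpow hl.le α).symm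
    have h4 : ((l ^ α : ℝ) : ℂ) ≠ 0 := by exact_mod_cast (Real.rpow_pos_of_pos hl α).ne'
    have h5 : (σ : ℂ) ≠ 0 := by exact_mod_cast hσ'
    have h6 : (α : ℂ) ≠ 0 := by exact_mod_cast hα0.ne'
    have h7 : ((1 : ℂ) - α) ≠ 0 := by exact_mod_cast hα'
    have h8 : ((Real.Gamma (1 - α) : ℝ) : ℂ) ≠ 0 := by exact_mod_cast hG
    rw [h1, h2, h3, hkl]
    push_cast
    field_simp
    ring

end LevyExponent

/-! ### Additive subordinators from a marked Poisson process -/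

section Subordinator

/-- The intensity of the point process of pairs of a jump size, of density `d`, and a level. -/
noncomputable def jumpIntensity (d : ℝ → ℝ) : Measure (ℝ × ℝ) :=
  ((volume.restrict (Set.Ioi 0)).withDensity fun z => ENNReal.ofReal (d z)).prod
    (volume.restrict (Set.Ioi 0))

instance (d : ℝ → ℝ) : SFinite (jumpIntensity d) := by
  unfold jumpIntensity; infer_instance

/-- The positive jumps whose level lies between the graphs of two functions. -/
def jumpRegion (g₁ g₂ : ℝ → ℝ) : Set (ℝ × ℝ) := {p | 0 < p.1 ∧ g₁ p.1 < p.2 ∧ p.2 ≤ g₂ p.1}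

/-- The jump size, for the jumps whose level lies between the graphs of two functions. -/
noncomputable def jumpPart (g₁ g₂ : ℝ → ℝ) : ℝ × ℝ → ℝ := (jumpRegion g₁ g₂).indicator Prod.fst

lemma measurableSet_jumpRegion {g₁ g₂ : ℝ → ℝ} (h₁ : Measurable g₁) (h₂ : Measurable g₂) :
    MeasurableSet (jumpRegion g₁ g₂) := by
  have a : MeasurableSet {p : ℝ × ℝ | 0 < p.1} := measurableSet_lt (by fun_prop) (by fun_prop)
  have b : MeasurableSet {p : ℝ × ℝ | g₁ p.1 < p.2} := measurableSet_lt (by fun_prop) (by fun_prop)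
  have c : MeasurableSet {p : ℝ × ℝ | p.2 ≤ g₂ p.1} := measurableSet_le (by fun_prop) (by fun_prop)
  exact a.inter (b.inter c)

lemma measurable_jumpPart {g₁ g₂ : ℝ → ℝ} (h₁ : Measurable g₁) (h₂ : Measurable g₂) :
    Measurable (jumpPart g₁ g₂) :=
  measurable_fst.indicator (measurableSet_jumpRegion h₁ h₂)

lemma jumpPart_nonneg (g₁ g₂ : ℝ → ℝ) (p : ℝ × ℝ) : 0 ≤ jumpPart g₁ g₂ p :=
  Set.indicator_nonneg (fun _ hp => hp.1.le) p

lemma jumpPart_sub {g₁ g₂ : ℝ → ℝ} (h : ∀ z, 0 < z → 0 ≤ g₁ z) (h' : ∀ z, 0 < z → g₁ z ≤ g₂ z)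
    (p : ℝ × ℝ) : jumpPart 0 g₂ p - jumpPart 0 g₁ p = jumpPart g₁ g₂ p := by
  simp only [jumpPart, jumpRegion, Set.indicator_apply, Set.mem_ofPred_eq, Pi.zero_apply]
  by_cases hz : 0 < p.1
  · have h1 := h p.1 hz
    have h2 := h' p.1 hz
    split_ifs <;> grind
  · simp [hz]

/-- The jump sizes between two levels have the expected intensity. -/
lemma map_restrict_jumpRegion {d g₁ g₂ : ℝ → ℝ} (hd : Measurable d) (h₁ : Measurable g₁)
    (h₂ : Measurable g₂) (h : ∀ z, 0 < z → 0 ≤ g₁ z) (hd0 : ∀ z, 0 < z → 0 ≤ d z) :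
    ((jumpIntensity d).restrict (jumpRegion g₁ g₂)).map Prod.fst
      = (volume.restrict (Set.Ioi 0)).withDensity
        fun z => ENNReal.ofReal (d z * (g₂ z - g₁ z)) := by
  ext A hA
  rw [Measure.map_apply measurable_fst hA, Measure.restrict_apply (measurable_fst hA),
    jumpIntensity, Measure.prod_apply
      ((measurable_fst hA).inter (measurableSet_jumpRegion h₁ h₂)),
    lintegral_withDensity_eq_lintegral_mul _ (by fun_prop), withDensity_apply _ hA,
    ← lintegral_indicator hA]
  swap
  · exact measurable_measure_prodMk_left
      ((measurable_fst hA).inter (measurableSet_jumpRegion h₁ h₂))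
  refine setLIntegral_congr_fun measurableSet_Ioi fun z (hz : 0 < z) => ?_
  simp only [Pi.mul_apply]
  by_cases hzA : z ∈ A
  · have : Prod.mk z ⁻¹' (Prod.fst ⁻¹' A ∩ jumpRegion g₁ g₂) = Set.Ioc (g₁ z) (g₂ z) := by
      ext r; simp [hzA, jumpRegion, hz]
    rw [this, Set.indicator_of_mem hzA, Measure.restrict_eq_self, Real.volume_Ioc,
      ENNReal.ofReal_mul (hd0 z hz)]
    exact fun r hr => lt_of_le_of_lt (h z hz) hr.1
  · have : Prod.mk z ⁻¹' (Prod.fst ⁻¹' A ∩ jumpRegion g₁ g₂) = ∅ := by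
      ext r; simp [hzA]
    rw [this, Set.indicator_of_notMem hzA]
    simp

variable {d g₁ g₂ : ℝ → ℝ}

/-- `F 0 = 0` matters: off the region `jumpPart` is 0, and that set may have infinite intensity. -/
lemma lintegral_jumpPart_comp (hd : Measurable d) (h₁ : Measurable g₁)
    (h₂ : Measurable g₂) (h : ∀ z, 0 < z → 0 ≤ g₁ z) (hd0 : ∀ z, 0 < z → 0 ≤ d z)
    {F : ℝ → ENNReal} (hF : Measurable F) (hF0 : F 0 = 0) :
    ∫⁻ p, F (jumpPart g₁ g₂ p) ∂(jumpIntensity d)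
      = ∫⁻ z in Set.Ioi 0, ENNReal.ofReal (d z * (g₂ z - g₁ z)) * F z := by
  have hR := measurableSet_jumpRegion h₁ h₂
  have e : (fun p => F (jumpPart g₁ g₂ p)) = (jumpRegion g₁ g₂).indicator (fun p => F p.1) := by
    ext p
    by_cases hp : p ∈ jumpRegion g₁ g₂ <;> simp [jumpPart, hp, hF0]
  rw [e, lintegral_indicator hR, ← lintegral_map hF measurable_fst,
    map_restrict_jumpRegion hd h₁ h₂ h hd0,
    lintegral_withDensity_eq_lintegral_mul _ (by fun_prop) hF]
  rfl

lemma integral_jumpPart_comp (hd : Measurable d) (h₁ : Measurable g₁)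
    (h₂ : Measurable g₂) (h : ∀ z, 0 < z → 0 ≤ g₁ z) (h' : ∀ z, 0 < z → g₁ z ≤ g₂ z)
    (hd0 : ∀ z, 0 < z → 0 ≤ d z)
    {F : ℝ → ℂ} (hF : Measurable F) (hF0 : F 0 = 0) :
    ∫ p, F (jumpPart g₁ g₂ p) ∂(jumpIntensity d)
      = ∫ z in Set.Ioi 0, F z * ((d z * (g₂ z - g₁ z) : ℝ) : ℂ) := by
  have hR := measurableSet_jumpRegion h₁ h₂
  have e : (fun p => F (jumpPart g₁ g₂ p)) = (jumpRegion g₁ g₂).indicator (fun p => F p.1) := by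
    ext p
    by_cases hp : p ∈ jumpRegion g₁ g₂ <;> simp [jumpPart, hp, hF0]
  rw [e, integral_indicator hR, ← integral_map (φ := Prod.fst) (by fun_prop) (by fun_prop),
    map_restrict_jumpRegion hd h₁ h₂ h hd0, integral_withDensity_eq_integral_toReal_smul
      (by fun_prop) (ae_of_all _ fun z => ENNReal.ofReal_lt_top)]
  refine setIntegral_congr_fun measurableSet_Ioi fun z (hz : 0 < z) => ?_
  rw [ENNReal.toReal_ofReal (mul_nonneg (hd0 z hz) (sub_nonneg.2 (h' z hz))), Complex.real_smul,
    mul_comm]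

/-- The conditions on a family of levels under which the jumps below the level at time `t` make up
a subordinator. -/
structure IsJumpLevel (d : ℝ → ℝ) (g : ℝ≥0 → ℝ → ℝ) : Prop where
  measurable_density : Measurable d
  density_nonneg : ∀ z, 0 < z → 0 ≤ d z
  measurable : ∀ t, Measurable (g t)
  zero : ∀ z, 0 < z → g 0 z = 0
  mono : ∀ z, 0 < z → Monotone fun t => g t z
  cont : ∀ z, 0 < z → Continuous fun t => g t z
  integrable : ∀ t, IntegrableOn (fun z => z * (d z * g t z)) (Set.Ioi 0)
  cont_mean : Continuous fun t => ∫ z in Set.Ioi 0, z * (d z * g t z)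

namespace IsJumpLevel

variable {d : ℝ → ℝ} {g : ℝ≥0 → ℝ → ℝ}

lemma nonneg (hg : IsJumpLevel d g) (t : ℝ≥0) {z : ℝ} (hz : 0 < z) : 0 ≤ g t z := by
  rw [← hg.zero z hz]; exact hg.mono z hz bot_le

lemma jumpPart_mono (hg : IsJumpLevel d g) {s t : ℝ≥0} (hst : s ≤ t) (p : ℝ × ℝ) :
    jumpPart 0 (g s) p ≤ jumpPart 0 (g t) p := by
  rw [← sub_nonneg, jumpPart_sub (fun z hz => hg.nonneg s hz) (fun z hz => hg.mono z hz hst)]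
  exact jumpPart_nonneg _ _ _

lemma lintegral_jumpPart (hg : IsJumpLevel d g) (t : ℝ≥0) :
    ∫⁻ p, ENNReal.ofReal (jumpPart 0 (g t) p) ∂(jumpIntensity d)
      = ENNReal.ofReal (∫ z in Set.Ioi 0, z * (d z * g t z)) := by
  rw [lintegral_jumpPart_comp hg.measurable_density (g₁ := 0) measurable_const (hg.measurable t)
    (fun z hz => by simp) hg.density_nonneg (F := ENNReal.ofReal) (by fun_prop) (by simp),
    ofReal_integral_eq_lintegral_ofReal (hg.integrable t)]
  · refine setLIntegral_congr_fun measurableSet_Ioi fun z (hz : 0 < z) => ?_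
    simp only [Pi.zero_apply, sub_zero]
    rw [← ENNReal.ofReal_mul (mul_nonneg (hg.density_nonneg z hz) (hg.nonneg t hz)), mul_comm]
  · refine (ae_restrict_mem measurableSet_Ioi).mono fun z (hz : 0 < z) => ?_
    exact mul_nonneg hz.le (mul_nonneg (hg.density_nonneg z hz) (hg.nonneg t hz))

lemma integrable_jumpPart (hg : IsJumpLevel d g) (t : ℝ≥0) :
    Integrable (jumpPart 0 (g t)) (jumpIntensity d) := by
  refine ⟨(measurable_jumpPart measurable_const (hg.measurable t)).aestronglyMeasurable, ?_⟩
  rw [hasFiniteIntegral_iff_ofReal (ae_of_all _ (jumpPart_nonneg _ _)), hg.lintegral_jumpPart]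
  exact ENNReal.ofReal_lt_top

/-- A counted jump stays counted because levels increase. An uncounted one lies strictly above the
graph, hence stays uncounted nearby. The non-strict inequality in `jumpRegion` is what makes paths
right-continuous. -/
lemma jumpPart_continuousWithinAt (hg : IsJumpLevel d g) (t : ℝ≥0) (p : ℝ × ℝ) :
    ContinuousWithinAt (fun s => jumpPart 0 (g s) p) (Set.Ici t) t := by
  by_cases hz : 0 < p.1
  swap
  · have : (fun s => jumpPart 0 (g s) p) = fun _ => 0 := by
      ext s; simp [jumpPart, jumpRegion, hz]
    rw [this]; exact continuousWithinAt_const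
  by_cases hr : p.2 ≤ g t p.1
  · refine ContinuousWithinAt.congr (f := fun _ => jumpPart 0 (g t) p)
      continuousWithinAt_const (fun s (hs : t ≤ s) => ?_) rfl
    have := hr.trans (hg.mono _ hz hs)
    simp only [jumpPart, jumpRegion, Set.indicator_apply, Set.mem_ofPred_eq]
    simp [hr, this]
  · refine ContinuousAt.continuousWithinAt ?_
    have h := (hg.cont _ hz).continuousAt.eventually_lt (continuousAt_const (x := t)) (not_le.1 hr)
    refine ContinuousAt.congr (f := fun _ => 0) continuousAt_const ?_
    filter_upwards [h] with s hs
    simp [jumpPart, jumpRegion, not_le.2 hs]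

end IsJumpLevel

/-- The sum of the jumps below the level at time `t`. -/
noncomputable def jumpSum (g : ℝ≥0 → ℝ → ℝ) (t : ℝ≥0) (ω : ℕ → ℕ × (ℕ → ℝ × ℝ)) : ℝ≥0 :=
  (pointSum (fun p => ENNReal.ofReal (jumpPart 0 (g t) p)) ω).toNNReal

lemma hasSum_jumpSum {g : ℝ≥0 → ℝ → ℝ} {t : ℝ≥0} {ω : ℕ → ℕ × (ℕ → ℝ × ℝ)}
    (h : pointSum (fun p => ENNReal.ofReal (jumpPart 0 (g t) p)) ω ≠ ⊤) :
    HasSum (fun n => clusterSum (jumpPart 0 (g t)) (ω n)) (jumpSum g t ω) := by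
  have h0 : ∀ n, clusterSum (fun p => ENNReal.ofReal (jumpPart 0 (g t) p)) (ω n)
      = ENNReal.ofReal (clusterSum (jumpPart 0 (g t)) (ω n)) := fun n =>
    (ENNReal.ofReal_sum_of_nonneg fun i _ => jumpPart_nonneg _ _ _).symm
  have h1 : ∀ n, 0 ≤ clusterSum (jumpPart 0 (g t)) (ω n) := fun n =>
    Finset.sum_nonneg fun i _ => jumpPart_nonneg _ _ _
  simp only [jumpSum, pointSum, h0] at h ⊢
  have h2 := ENNReal.hasSum_toReal h
  rw [← ENNReal.tsum_toReal_eq fun n => ENNReal.ofReal_ne_top] at h2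
  simp only [ENNReal.toReal_ofReal (h1 _)] at h2
  exact h2

namespace IsJumpLevel

variable {d : ℝ → ℝ} {g : ℝ≥0 → ℝ → ℝ} {c : ℕ → ℝ≥0} {q : ℕ → Measure (ℝ × ℝ)}
  [∀ n, IsProbabilityMeasure (q n)]

lemma measurable_ofReal_jumpPart (hg : IsJumpLevel d g) (t : ℝ≥0) :
    Measurable fun p => ENNReal.ofReal (jumpPart 0 (g t) p) :=
  (measurable_jumpPart measurable_const (hg.measurable t)).ennreal_ofReal

lemma measurable_jumpSum (hg : IsJumpLevel d g) (t : ℝ≥0) : Measurable (jumpSum g t) :=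
  (measurable_pointSum (hg.measurable_ofReal_jumpPart t)).ennreal_toNNReal

lemma lintegral_pointSum_jumpPart (hg : IsJumpLevel d g)
    (hcq : pointIntensity c q = jumpIntensity d)
    (t : ℝ≥0) :
    ∫⁻ ω, pointSum (fun p => ENNReal.ofReal (jumpPart 0 (g t) p)) ω ∂(pointLaw c q)
      = ENNReal.ofReal (∫ z in Set.Ioi 0, z * (d z * g t z)) := by
  rw [lintegral_pointSum c q (hg.measurable_ofReal_jumpPart t), hcq, hg.lintegral_jumpPart]

/-- Monotonicity in time reduces the uncountably many times to the integers, so that a single null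
set suffices. -/
lemma ae_pointSum_ne_top (hg : IsJumpLevel d g) (hcq : pointIntensity c q = jumpIntensity d) :
    ∀ᵐ ω ∂(pointLaw c q), ∀ t,
      pointSum (fun p => ENNReal.ofReal (jumpPart 0 (g t) p)) ω ≠ ⊤ := by
  have h : ∀ᵐ ω ∂(pointLaw c q), ∀ n : ℕ,
      pointSum (fun p => ENNReal.ofReal (jumpPart 0 (g n) p)) ω < ⊤ := by
    refine ae_all_iff.2 fun n =>
      ae_lt_top (measurable_pointSum (hg.measurable_ofReal_jumpPart n)) ?_
    rw [hg.lintegral_pointSum_jumpPart hcq]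
    exact ENNReal.ofReal_ne_top
  filter_upwards [h] with ω hω t
  obtain ⟨n, hn⟩ := exists_nat_ge t
  refine ne_top_of_le_ne_top (hω n).ne
    (ENNReal.tsum_le_tsum fun m => Finset.sum_le_sum fun i _ => ?_)
  exact ENNReal.ofReal_le_ofReal (hg.jumpPart_mono hn _)

lemma ae_hasSum (hg : IsJumpLevel d g) (hcq : pointIntensity c q = jumpIntensity d) :
    ∀ᵐ ω ∂(pointLaw c q), ∀ t,
      HasSum (fun n => clusterSum (jumpPart 0 (g t)) (ω n)) (jumpSum g t ω) :=
  (hg.ae_pointSum_ne_top hcq).mono fun _ hω t => hasSum_jumpSum (hω t)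

lemma ae_monotone (hg : IsJumpLevel d g) (hcq : pointIntensity c q = jumpIntensity d) :
    ∀ᵐ ω ∂(pointLaw c q), Monotone fun t => jumpSum g t ω := by
  filter_upwards [hg.ae_hasSum hcq] with ω hω s t hst
  refine NNReal.coe_le_coe.1 (hasSum_le (fun n => ?_) (hω s) (hω t))
  exact Finset.sum_le_sum fun i _ => hg.jumpPart_mono hst _

/-- Dominated convergence for series: near t, to the right, every term is at most the corresponding
term at time t + 1. -/
lemma ae_rightContinuous (hg : IsJumpLevel d g) (hcq : pointIntensity c q = jumpIntensity d) :
    ∀ᵐ ω ∂(pointLaw c q), ∀ t,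
      ContinuousWithinAt (fun s => (jumpSum g s ω : ℝ)) (Set.Ici t) t := by
  filter_upwards [hg.ae_hasSum hcq] with ω hω t
  have e : (fun s => (jumpSum g s ω : ℝ)) = fun s => ∑' n, clusterSum (jumpPart 0 (g s)) (ω n) :=
    funext fun s => (hω s).tsum_eq.symm
  rw [e]
  refine tendsto_tsum_of_dominated_convergence
    (bound := fun n => clusterSum (jumpPart 0 (g (t + 1))) (ω n)) (hω (t + 1)).summable
    (fun n => ?_) ?_
  · exact tendsto_finsetSum _ fun i _ => hg.jumpPart_continuousWithinAt t _
  · have : ∀ᶠ s in 𝓝[Set.Ici t] t, s < t + 1 :=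
      (eventually_lt_nhds (by simp)).filter_mono nhdsWithin_le_nhds
    filter_upwards [this] with s hs n
    have h0 : 0 ≤ clusterSum (jumpPart 0 (g s)) (ω n) :=
      Finset.sum_nonneg fun i _ => jumpPart_nonneg _ _ _
    rw [Real.norm_of_nonneg h0]
    exact Finset.sum_le_sum fun i _ => hg.jumpPart_mono hs.le _

lemma integrable_jumpSum (hg : IsJumpLevel d g) (hcq : pointIntensity c q = jumpIntensity d)
    (t : ℝ≥0) : Integrable (fun ω => (jumpSum g t ω : ℝ)) (pointLaw c q) := by
  refine integrable_toReal_of_lintegral_ne_top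
    (measurable_pointSum (hg.measurable_ofReal_jumpPart t)).aemeasurable ?_
  rw [hg.lintegral_pointSum_jumpPart hcq]
  exact ENNReal.ofReal_ne_top

lemma mean_nonneg (hg : IsJumpLevel d g) (t : ℝ≥0) :
    0 ≤ ∫ z in Set.Ioi 0, z * (d z * g t z) :=
  setIntegral_nonneg measurableSet_Ioi fun z (hz : 0 < z) =>
    mul_nonneg hz.le (mul_nonneg (hg.density_nonneg z hz) (hg.nonneg t hz))

lemma integral_jumpSum (hg : IsJumpLevel d g) (hcq : pointIntensity c q = jumpIntensity d)
    (t : ℝ≥0) : ∫ ω, (jumpSum g t ω : ℝ) ∂(pointLaw c q) = ∫ z in Set.Ioi 0, z * (d z * g t z) := by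
  have h := hg.lintegral_pointSum_jumpPart hcq t
  have h2 := integral_toReal (μ := pointLaw c q)
    (measurable_pointSum (hg.measurable_ofReal_jumpPart t)).aemeasurable
    ((hg.ae_pointSum_ne_top hcq).mono fun ω hω => lt_top_iff_ne_top.2 (hω t))
  rw [h, ENNReal.toReal_ofReal (hg.mean_nonneg t)] at h2
  exact h2

lemma integral_abs_jumpSum_sub (hg : IsJumpLevel d g)
    (hcq : pointIntensity c q = jumpIntensity d) (s t : ℝ≥0) :
    ∫ ω, |(jumpSum g s ω : ℝ) - jumpSum g t ω| ∂(pointLaw c q)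
      = |(∫ z in Set.Ioi 0, z * (d z * g s z)) - ∫ z in Set.Ioi 0, z * (d z * g t z)| := by
  wlog hst : t ≤ s generalizing s t
  · rw [abs_sub_comm, ← this t s (le_of_not_ge hst)]
    simp_rw [abs_sub_comm]
  have h1 : ∫ ω, |(jumpSum g s ω : ℝ) - jumpSum g t ω| ∂(pointLaw c q)
      = ∫ ω, ((jumpSum g s ω : ℝ) - jumpSum g t ω) ∂(pointLaw c q) := by
    refine integral_congr_ae ?_
    filter_upwards [hg.ae_monotone hcq] with ω hω
    exact abs_of_nonneg (sub_nonneg.2 (NNReal.coe_le_coe.2 (hω hst)))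
  have h2 : 0 ≤ ∫ ω, |(jumpSum g s ω : ℝ) - jumpSum g t ω| ∂(pointLaw c q) :=
    integral_nonneg fun ω => abs_nonneg _
  rw [h1, integral_sub (hg.integrable_jumpSum hcq s) (hg.integrable_jumpSum hcq t),
    hg.integral_jumpSum hcq, hg.integral_jumpSum hcq] at h2
  rw [h1, integral_sub (hg.integrable_jumpSum hcq s) (hg.integrable_jumpSum hcq t),
    hg.integral_jumpSum hcq, hg.integral_jumpSum hcq, abs_of_nonneg h2]

/-- Paths increase, so the L¹ distance between two times is the difference of the means, and the
means are continuous by `cont_mean`. -/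
lemma tendstoInMeasure_jumpSum (hg : IsJumpLevel d g)
    (hcq : pointIntensity c q = jumpIntensity d) (t : ℝ≥0) :
    TendstoInMeasure (pointLaw c q) (fun s ω => (jumpSum g s ω : ℝ)) (𝓝 t)
      (fun ω => (jumpSum g t ω : ℝ)) := by
  refine tendstoInMeasure_of_tendsto_eLpNorm one_ne_zero
    (fun s => (hg.measurable_jumpSum s).coe_nnreal_real.aestronglyMeasurable)
    (hg.measurable_jumpSum t).coe_nnreal_real.aestronglyMeasurable ?_
  have h : ∀ s, eLpNorm ((fun ω => (jumpSum g s ω : ℝ)) - fun ω => (jumpSum g t ω : ℝ)) 1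
      (pointLaw c q) = ENNReal.ofReal
        |(∫ z in Set.Ioi 0, z * (d z * g s z)) - ∫ z in Set.Ioi 0, z * (d z * g t z)| := by
    intro s
    rw [eLpNorm_one_eq_lintegral_enorm, ← hg.integral_abs_jumpSum_sub hcq,
      ofReal_integral_eq_lintegral_ofReal]
    · simp [Real.enorm_eq_ofReal_abs]
    · exact ((hg.integrable_jumpSum hcq s).sub (hg.integrable_jumpSum hcq t)).abs
    · exact ae_of_all _ fun ω => abs_nonneg _
  simp_rw [h]
  rw [← ENNReal.ofReal_zero]
  refine ENNReal.tendsto_ofReal ?_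
  have := ((hg.cont_mean.tendsto t).sub_const (∫ z in Set.Ioi 0, z * (d z * g t z))).abs
  simpa using this

end IsJumpLevel

/-- At most one summand is nonzero. This additivity of the exponent is where independence of
increments comes from. -/
lemma one_sub_exp_neg_sum {ι : Type*} (s : Finset ι) (x : ι → ℂ)
    (h : ∀ i ∈ s, ∀ j ∈ s, i ≠ j → x i ≠ 0 → x j = 0) :
    1 - Complex.exp (-∑ i ∈ s, x i) = ∑ i ∈ s, (1 - Complex.exp (-x i)) := by
  by_cases h0 : ∃ i ∈ s, x i ≠ 0
  · obtain ⟨i, hi, hxi⟩ := h0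
    rw [Finset.sum_eq_single_of_mem i hi fun j hj hji => h i hi j hj hji.symm hxi,
      Finset.sum_eq_single_of_mem i hi fun j hj hji => by rw [h i hi j hj hji.symm hxi]; simp]
  · push Not at h0
    rw [Finset.sum_eq_zero h0, Finset.sum_eq_zero fun i hi => by rw [h0 i hi]; simp]
    simp

namespace IsJumpLevel

variable {d : ℝ → ℝ} {g : ℝ≥0 → ℝ → ℝ} {c : ℕ → ℝ≥0} {q : ℕ → Measure (ℝ × ℝ)}
  [∀ n, IsProbabilityMeasure (q n)]

/-- The joint Laplace transform of the increments of a sum of jumps. -/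
theorem integral_exp_neg_sum_increments (hg : IsJumpLevel d g)
    (hcq : pointIntensity c q = jumpIntensity d) {n : ℕ} {t : Fin (n + 1) → ℝ≥0} (ht : Monotone t)
    {w : Fin n → ℂ} (hw : ∀ j, 0 ≤ (w j).re) :
    ∫ ω, Complex.exp (-∑ j, w j * ((jumpSum g (t j.succ) ω : ℝ) - (jumpSum g (t j.castSucc) ω : ℝ)))
        ∂(pointLaw c q)
      = ∏ j, Complex.exp (-∫ z in Set.Ioi (0 : ℝ), (1 - Complex.exp (-(w j * z))) *
        ((d z * (g (t j.succ) z - g (t j.castSucc) z) : ℝ) : ℂ)) := by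
  have hjm : ∀ j : Fin n, t j.castSucc ≤ t j.succ := fun j => ht (Fin.castSucc_lt_succ (i := j)).le
  set h : Fin n → ℝ × ℝ → ℝ := fun j => jumpPart (g (t j.castSucc)) (g (t j.succ)) with hh
  have hsub : ∀ j p, h j p = jumpPart 0 (g (t j.succ)) p - jumpPart 0 (g (t j.castSucc)) p :=
    fun j p => (jumpPart_sub (fun z hz => hg.nonneg _ hz) (fun z hz => hg.mono z hz (hjm j)) p).symm
  have hmeas : ∀ j, Measurable (h j) := fun j =>
    measurable_jumpPart (hg.measurable _) (hg.measurable _)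
  set f : ℝ × ℝ → ℂ := fun p => ∑ j, w j * (h j p : ℂ) with hf
  have hfm : Measurable f := by fun_prop
  have hre : ∀ p, 0 ≤ (f p).re := by
    intro p
    simp only [hf, Complex.re_sum, Complex.re_mul_ofReal]
    exact Finset.sum_nonneg fun j _ => mul_nonneg (hw j) (jumpPart_nonneg _ _ _)
  have hInt : ∀ j, Integrable (h j) (jumpIntensity d) := fun j => by
    have := (hg.integrable_jumpPart (t j.succ)).sub (hg.integrable_jumpPart (t j.castSucc))
    exact this.congr (ae_of_all _ fun p => (hsub j p).symm)
  have hfi : Integrable f (jumpIntensity d) :=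
    integrable_finsetSum _ fun j _ => (hInt j).ofReal.const_mul _
  -- Levels increase, so consecutive time intervals correspond to disjoint regions between graphs: a
  -- point contributes to at most one increment.
  have hdisj : ∀ p, ∀ i ∈ Finset.univ, ∀ j ∈ Finset.univ, i ≠ j → w i * (h i p : ℂ) ≠ 0 →
      w j * (h j p : ℂ) = 0 := by
    intro p i _ j _ hij hi
    have hi' : p ∈ jumpRegion (g (t i.castSucc)) (g (t i.succ)) := by
      by_contra hp
      exact hi (by simp [hh, jumpPart, hp])
    have hj' : p ∉ jumpRegion (g (t j.castSucc)) (g (t j.succ)) := by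
      rintro ⟨hz, h1, h2⟩
      obtain ⟨-, h3, h4⟩ := hi'
      rcases lt_or_gt_of_ne hij with hlt | hlt
      · have := hg.mono _ hz (ht (show i.succ ≤ j.castSucc from hlt))
        simp only at this
        linarith
      · have := hg.mono _ hz (ht (show j.succ ≤ i.castSucc from hlt))
        simp only at this
        linarith
    simp [hh, jumpPart, hj']
  have hI1 : ∀ j, Integrable (fun p => 1 - Complex.exp (-(w j * (h j p : ℂ))))
      (jumpIntensity d) := by
    intro j
    refine Integrable.mono' (((hInt j).norm.const_mul ‖w j‖).const_mul 2)
      (Measurable.aestronglyMeasurable (by fun_prop)) (ae_of_all _ fun p => ?_)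
    have := norm_one_sub_exp_neg_le (w := w j * (h j p : ℂ)) (by
      rw [Complex.re_mul_ofReal]; exact mul_nonneg (hw j) (jumpPart_nonneg _ _ _))
    simpa using this
  have key := integral_exp_neg_pointSum c q hfm hre (hcq ▸ hfi)
  have e1 : ∫ ω, Complex.exp (-∑ j, w j *
      ((jumpSum g (t j.succ) ω : ℝ) - (jumpSum g (t j.castSucc) ω : ℝ))) ∂(pointLaw c q)
      = ∫ ω, Complex.exp (-pointSum f ω) ∂(pointLaw c q) := by
    refine integral_congr_ae ?_
    filter_upwards [hg.ae_hasSum hcq] with ω hω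
    have hs : HasSum (fun n => clusterSum f (ω n)) (∑ j, w j *
        ((jumpSum g (t j.succ) ω : ℝ) - (jumpSum g (t j.castSucc) ω : ℝ) : ℂ)) := by
      have : (fun n => clusterSum f (ω n)) = fun n => ∑ j, w j *
          (((clusterSum (jumpPart 0 (g (t j.succ))) (ω n) : ℝ) : ℂ)
            - ((clusterSum (jumpPart 0 (g (t j.castSucc))) (ω n) : ℝ) : ℂ)) := by
        ext n
        simp only [clusterSum, hf, hsub]
        rw [Finset.sum_comm]
        refine Finset.sum_congr rfl fun j _ => ?_
        push_cast
        rw [← Finset.sum_sub_distrib, Finset.mul_sum]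
      rw [this]
      refine hasSum_sum fun j _ => HasSum.mul_left _ ?_
      exact (Complex.hasSum_ofReal.2 (hω _)).sub (Complex.hasSum_ofReal.2 (hω _))
    simp only [pointSum]
    rw [hs.tsum_eq]
  rw [e1, key, hcq]
  have e2 : ∀ p, 1 - Complex.exp (-f p) = ∑ j, (1 - Complex.exp (-(w j * (h j p : ℂ)))) :=
    fun p => one_sub_exp_neg_sum _ _ (hdisj p)
  simp_rw [e2]
  rw [integral_finsetSum _ fun j _ => hI1 j, ← Finset.sum_neg_distrib, Complex.exp_sum]
  refine Finset.prod_congr rfl fun j _ => ?_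
  rw [integral_jumpPart_comp hg.measurable_density (hg.measurable _) (hg.measurable _)
    (fun z hz => hg.nonneg _ hz) (fun z hz => hg.mono z hz (hjm j)) hg.density_nonneg
    (F := fun z : ℝ => 1 - Complex.exp (-(w j * (z : ℂ)))) (by fun_prop) (by simp)]

/-- The Laplace transform of an increment of a sum of jumps. -/
theorem integral_exp_neg_increment (hg : IsJumpLevel d g)
    (hcq : pointIntensity c q = jumpIntensity d) {s t : ℝ≥0} (hst : s ≤ t) {w : ℂ}
    (hw : 0 ≤ w.re) :
    ∫ ω, Complex.exp (-(w * ((jumpSum g t ω : ℝ) - (jumpSum g s ω : ℝ)))) ∂(pointLaw c q)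
      = Complex.exp (-∫ z in Set.Ioi (0 : ℝ), (1 - Complex.exp (-(w * z))) *
        ((d z * (g t z - g s z) : ℝ) : ℂ)) := by
  have h := hg.integral_exp_neg_sum_increments hcq (n := 1) (t := ![s, t])
    (by intro i j hij; fin_cases i <;> fin_cases j <;> simp_all) (w := fun _ => w) (fun _ => hw)
  simpa using h

lemma integral_exp_neg_prod_increments (hg : IsJumpLevel d g)
    (hcq : pointIntensity c q = jumpIntensity d) {n : ℕ} {t : Fin (n + 1) → ℝ≥0} (ht : Monotone t)
    {w : Fin n → ℂ} (hw : ∀ j, 0 ≤ (w j).re) :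
    ∫ ω, Complex.exp (-∑ j, w j * ((jumpSum g (t j.succ) ω : ℝ) - (jumpSum g (t j.castSucc) ω : ℝ)))
        ∂(pointLaw c q)
      = ∏ j, ∫ ω, Complex.exp (-(w j * ((jumpSum g (t j.succ) ω : ℝ)
          - (jumpSum g (t j.castSucc) ω : ℝ)))) ∂(pointLaw c q) := by
  rw [hg.integral_exp_neg_sum_increments hcq ht hw]
  exact Finset.prod_congr rfl fun j _ =>
    (hg.integral_exp_neg_increment hcq (ht (Fin.castSucc_lt_succ (i := j)).le) (hw j)).symm

lemma ae_jumpSum_zero (hg : IsJumpLevel d g) (hcq : pointIntensity c q = jumpIntensity d) :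
    ∀ᵐ ω ∂(pointLaw c q), (jumpSum g 0 ω : ℝ) = 0 := by
  filter_upwards [hg.ae_hasSum hcq] with ω hω
  refine (hω 0).unique ?_
  have : ∀ p, jumpPart 0 (g 0) p = 0 := by
    intro p
    refine Set.indicator_of_notMem ?_ _
    rintro ⟨hz, h1, h2⟩
    rw [hg.zero _ hz] at h2
    exact absurd h1 (not_lt.2 h2)
  simp [clusterSum, this, hasSum_zero]

/-- The Laplace transform of a sum of jumps. -/
theorem integral_exp_neg_jumpSum (hg : IsJumpLevel d g)
    (hcq : pointIntensity c q = jumpIntensity d) (t : ℝ≥0) {w : ℂ} (hw : 0 ≤ w.re) :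
    ∫ ω, Complex.exp (-(w * (jumpSum g t ω : ℝ))) ∂(pointLaw c q)
      = Complex.exp (-∫ z in Set.Ioi (0 : ℝ), (1 - Complex.exp (-(w * z))) *
        ((d z * g t z : ℝ) : ℂ)) := by
  have h := hg.integral_exp_neg_increment hcq (s := 0) (t := t) bot_le hw
  have e1 : ∫ ω, Complex.exp (-(w * (jumpSum g t ω : ℝ))) ∂(pointLaw c q)
      = ∫ ω, Complex.exp (-(w * ((jumpSum g t ω : ℝ) - (jumpSum g 0 ω : ℝ)))) ∂(pointLaw c q) := by
    refine integral_congr_ae ?_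
    filter_upwards [hg.ae_jumpSum_zero hcq] with ω hω
    simp [hω]
  rw [e1, h]
  congr 2
  refine setIntegral_congr_fun measurableSet_Ioi fun z (hz : 0 < z) => ?_
  simp only [hg.zero z hz, sub_zero]

/-- An exponential moment dominates the same moment of the Lévy measure; this is how moments beyond
the tempering are shown to be infinite. -/
lemma lintegral_exp_sub_one_le_jumpSum (hg : IsJumpLevel d g)
    (hcq : pointIntensity c q = jumpIntensity d) (t : ℝ≥0) {κ : ℝ} (hκ : 0 ≤ κ) :
    ∫⁻ z in Set.Ioi 0, ENNReal.ofReal (d z * g t z) * ENNReal.ofReal (Real.exp (κ * z) - 1)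
      ≤ ∫⁻ ω, ENNReal.ofReal (Real.exp (κ * jumpSum g t ω)) ∂(pointLaw c q) := by
  have h := lintegral_exp_sub_one_le c q (f := fun p => κ * jumpPart 0 (g t) p)
    ((measurable_jumpPart measurable_const (hg.measurable t)).const_mul κ)
    (fun p => mul_nonneg hκ (jumpPart_nonneg _ _ _))
    (hcq ▸ (hg.integrable_jumpPart t).const_mul κ)
  rw [hcq, lintegral_jumpPart_comp hg.measurable_density (g₁ := 0) measurable_const
    (hg.measurable t) (fun z hz => by simp) hg.density_nonneg
    (F := fun z => ENNReal.ofReal (Real.exp (κ * z) - 1)) (by fun_prop) (by simp)] at h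
  simp only [Pi.zero_apply, sub_zero] at h
  refine h.trans (lintegral_mono_ae ?_)
  filter_upwards [hg.ae_hasSum hcq] with ω hω
  have : pointSum (fun p => κ * jumpPart 0 (g t) p) ω = κ * jumpSum g t ω := by
    rw [← (hω t).tsum_eq, ← tsum_mul_left]
    simp only [pointSum, clusterSum, Finset.mul_sum]
  rw [this]

lemma hasIndepIncrements_jumpSum (hg : IsJumpLevel d g)
    (hcq : pointIntensity c q = jumpIntensity d) :
    HasIndepIncrements (fun t ω => (jumpSum g t ω : ℝ)) (pointLaw c q) := by
  intro n t ht
  have hm : ∀ s, Measurable fun ω => (jumpSum g s ω : ℝ) := fun s =>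
    (hg.measurable_jumpSum s).coe_nnreal_real
  refine iIndepFun_of_integral_cexp (fun j => (hm _).sub (hm _)) fun u => ?_
  -- Purely imaginary w_j, on the boundary of the half-plane, turn Laplace transforms into
  -- characteristic functions.
  have h := hg.integral_exp_neg_prod_increments hcq ht
    (w := fun j => -(Complex.I * u j)) (by simp)
  have e : ∀ j ω, -(Complex.I * u j) *
      ((jumpSum g (t j.succ) ω : ℝ) - (jumpSum g (t j.castSucc) ω : ℝ) : ℂ)
      = -(((u j * ((jumpSum g (t j.succ) ω : ℝ) - (jumpSum g (t j.castSucc) ω : ℝ)) : ℝ) : ℂ)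
        * Complex.I) := by
    intro j ω
    push_cast
    ring
  simp only [e, Finset.sum_neg_distrib, neg_neg] at h
  exact h

/-- The sums of the jumps below an increasing family of levels form an additive subordinator. -/
theorem isAdditiveSubordinator_jumpSum (hg : IsJumpLevel d g)
    (hcq : pointIntensity c q = jumpIntensity d) :
    IsAdditiveSubordinator (pointLaw c q) (jumpSum g) where
  monotone := hg.ae_monotone hcq
  additive :=
    { measurable := fun t => (hg.measurable_jumpSum t).coe_nnreal_real
      zero_ae := hg.ae_jumpSum_zero hcq
      continuous_in_prob := hg.tendstoInMeasure_jumpSum hcq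
      cadlag := by
        filter_upwards [hg.ae_monotone hcq, hg.ae_rightContinuous hcq] with ω h1 h2 t
        have h3 : Monotone fun s => (jumpSum g s ω : ℝ) := fun s s' hs =>
          NNReal.coe_le_coe.2 (h1 hs)
        exact ⟨h2 t, _, h3.tendsto_nhdsLT t⟩
      indep := hg.hasIndepIncrements_jumpSum hcq }

end IsJumpLevel

end Subordinator

/-! ### Brownian motion from a Schauder series -/

section BrownianMotion

/-- The ramp function, from `0` at `0` to `1` at `1`. -/
def ramp (y : ℝ) : ℝ := max 0 (min y 1)

/-- The tent function on the unit interval. -/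
def tent (y : ℝ) : ℝ := max 0 (1 - |2 * y - 1|)

@[fun_prop]
lemma continuous_ramp : Continuous ramp := by unfold ramp; fun_prop

@[fun_prop]
lemma continuous_tent : Continuous tent := by unfold tent; fun_prop

lemma ramp_of_nonpos {y : ℝ} (hy : y ≤ 0) : ramp y = 0 := by
  unfold ramp; grind

lemma ramp_of_one_le {y : ℝ} (hy : 1 ≤ y) : ramp y = 1 := by
  unfold ramp; grind

lemma ramp_nonneg (y : ℝ) : 0 ≤ ramp y := le_max_left _ _

lemma ramp_le_one (y : ℝ) : ramp y ≤ 1 := by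
  unfold ramp; grind

lemma tent_of_nonpos {y : ℝ} (hy : y ≤ 0) : tent y = 0 := by
  unfold tent; grind

lemma tent_of_one_le {y : ℝ} (hy : 1 ≤ y) : tent y = 0 := by
  unfold tent; grind

lemma tent_nonneg (y : ℝ) : 0 ≤ tent y := le_max_left _ _

lemma tent_le_one (y : ℝ) : tent y ≤ 1 := by
  unfold tent; grind

/-- The covariance of the Brownian bridge. -/
def bridgeCov (x y : ℝ) : ℝ := min (ramp x) (ramp y) - ramp x * ramp y

lemma bridgeCov_nonneg (x y : ℝ) : 0 ≤ bridgeCov x y := by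
  have h1 := ramp_nonneg x
  have h2 := ramp_nonneg y
  have h3 := ramp_le_one x
  have h4 := ramp_le_one y
  unfold bridgeCov
  rcases le_total (ramp x) (ramp y) with h | h
  · rw [min_eq_left h]; nlinarith
  · rw [min_eq_right h]; nlinarith

lemma bridgeCov_le_one (x y : ℝ) : bridgeCov x y ≤ 1 := by
  have h1 := mul_nonneg (ramp_nonneg x) (ramp_nonneg y)
  have h2 := (min_le_left (ramp x) (ramp y)).trans (ramp_le_one x)
  unfold bridgeCov
  linarith

lemma bridgeCov_of_nonpos {x : ℝ} (hx : x ≤ 0) (y : ℝ) : bridgeCov x y = 0 := by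
  unfold bridgeCov
  rw [ramp_of_nonpos hx, min_eq_left (ramp_nonneg y)]
  ring

lemma bridgeCov_of_one_le {x : ℝ} (hx : 1 ≤ x) (y : ℝ) : bridgeCov x y = 0 := by
  unfold bridgeCov
  rw [ramp_of_one_le hx, min_eq_right (ramp_le_one y)]
  ring

lemma bridgeCov_comm (x y : ℝ) : bridgeCov x y = bridgeCov y x := by
  unfold bridgeCov; rw [min_comm, mul_comm]

/-- The midpoint decomposition of the Brownian bridge. -/
lemma bridgeCov_eq (x y : ℝ) :
    bridgeCov x y = 4⁻¹ * (tent x * tent y)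
      + 2⁻¹ * (bridgeCov (2 * x) (2 * y) + bridgeCov (2 * x - 1) (2 * y - 1)) := by
  rcases le_or_gt x 0 with hx | hx
  · rw [bridgeCov_of_nonpos hx, bridgeCov_of_nonpos (by linarith),
      bridgeCov_of_nonpos (by linarith),
      tent_of_nonpos hx]
    ring
  rcases le_or_gt 1 x with hx1 | hx1
  · rw [bridgeCov_of_one_le hx1, bridgeCov_of_one_le (by linarith),
      bridgeCov_of_one_le (by linarith), tent_of_one_le hx1]
    ring
  rcases le_or_gt y 0 with hy | hy
  · rw [bridgeCov_comm, bridgeCov_of_nonpos hy, bridgeCov_comm (2 * x),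
      bridgeCov_of_nonpos (by linarith), bridgeCov_comm (2 * x - 1),
      bridgeCov_of_nonpos (by linarith), tent_of_nonpos hy]
    ring
  rcases le_or_gt 1 y with hy1 | hy1
  · rw [bridgeCov_comm, bridgeCov_of_one_le hy1, bridgeCov_comm (2 * x),
      bridgeCov_of_one_le (by linarith), bridgeCov_comm (2 * x - 1),
      bridgeCov_of_one_le (by linarith), tent_of_one_le hy1]
    ring
  -- On each half of the unit interval only one of the two rescaled ramps varies, so every term is
  -- explicit and four cases remain.
  have key : ∀ z : ℝ, 0 < z → z < 1 →
      (ramp z = z ∧ ((ramp (2 * z) = 2 * z ∧ ramp (2 * z - 1) = 0 ∧ tent z = 2 * z ∧ z ≤ 1 / 2) ∨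
        (ramp (2 * z) = 1 ∧ ramp (2 * z - 1) = 2 * z - 1 ∧ tent z = 2 - 2 * z ∧ 1 / 2 ≤ z))) := by
    intro z hz0 hz1
    unfold ramp tent
    rcases le_total z (1 / 2) with h | h <;> grind
  wlog hxy : x ≤ y generalizing x y
  · have := this y x hy hy1 hx hx1 (le_of_not_ge hxy)
    rw [bridgeCov_comm x y, this, bridgeCov_comm (2 * x), bridgeCov_comm (2 * x - 1),
      mul_comm (tent x)]
  obtain ⟨hx0, hx2⟩ := key x hx hx1
  obtain ⟨hy0, hy2⟩ := key y hy hy1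
  unfold bridgeCov
  rw [hx0, hy0, min_eq_left hxy]
  rcases hx2 with ⟨a1, a2, a3, a4⟩ | ⟨a1, a2, a3, a4⟩ <;>
  rcases hy2 with ⟨b1, b2, b3, b4⟩ | ⟨b1, b2, b3, b4⟩ <;>
  rw [a1, a2, a3, b1, b2, b3]
  · rw [min_eq_left (by linarith), min_self]; ring
  · rw [min_eq_left (by linarith), min_eq_left (by linarith)]; ring
  · have h1 : x = 1 / 2 := by linarith
    have h2 : y = 1 / 2 := by linarith
    subst h1 h2
    norm_num
  · rw [min_self, min_eq_left (by linarith)]; ring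

lemma sum_range_two_mul (f : ℕ → ℝ) (N : ℕ) :
    ∑ k ∈ Finset.range (2 * N), f k = ∑ k ∈ Finset.range N, (f (2 * k) + f (2 * k + 1)) := by
  induction N with
  | zero => simp
  | succ N ih => rw [Nat.mul_succ, Finset.sum_range_succ, Finset.sum_range_succ, ih,
      Finset.sum_range_succ]; ring

lemma sum_range_min_ramp {s : ℝ} (hs : 0 ≤ s) {N : ℕ} (hN : s ≤ N) :
    ∑ k ∈ Finset.range N, ramp (s - k) = s := by
  induction N generalizing s with
  | zero => simp at hN; simp; linarith
  | succ N ih =>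
    rw [Finset.sum_range_succ]
    rcases le_total s N with h | h
    · rw [ih hs h, ramp_of_nonpos (by linarith), add_zero]
    · have h1 : ∀ k ∈ Finset.range N, ramp (s - k) = 1 := by
        intro k hk
        have : (k : ℝ) + 1 ≤ N := by exact_mod_cast Finset.mem_range.1 hk
        exact ramp_of_one_le (by linarith)
      rw [Finset.sum_congr rfl h1]
      push_cast at hN
      have : ramp (s - N) = s - N := by unfold ramp; grind
      rw [this]
      simp

lemma ramp_mono : Monotone ramp := fun x y h => by unfold ramp; grind

lemma min_ramp (x y : ℝ) : min (ramp x) (ramp y) = ramp (min x y) := (ramp_mono.map_min).symm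

/-- The remainder after `m` refinements. -/
lemma min_sub_schauder_sum {s t : ℝ} (hs : 0 ≤ s) (ht : 0 ≤ t) {N : ℕ} (hsN : s ≤ N)
    (m : ℕ) :
    min s t - ∑ k ∈ Finset.range N, ramp (s - k) * ramp (t - k)
      - ∑ n ∈ Finset.range m, 2⁻¹ ^ n * 4⁻¹ * ∑ k ∈ Finset.range (2 ^ n * N),
        tent (2 ^ n * s - k) * tent (2 ^ n * t - k)
      = 2⁻¹ ^ m * ∑ k ∈ Finset.range (2 ^ m * N), bridgeCov (2 ^ m * s - k) (2 ^ m * t - k) := by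
  induction m with
  | zero =>
    simp only [Finset.range_zero, Finset.sum_empty, sub_zero, pow_zero, one_mul]
    simp only [bridgeCov, Finset.sum_sub_distrib, min_ramp]
    have : ∀ k : ℕ, min (s - k) (t - k) = min s t - k := fun k => min_sub_sub_right s t k
    simp only [this]
    rw [sum_range_min_ramp (le_min hs ht) ((min_le_left s t).trans hsN)]
  | succ m ih =>
    rw [Finset.sum_range_succ, ← sub_sub, ih, pow_succ 2 m, mul_comm (2 ^ m) 2, mul_assoc 2,
      sum_range_two_mul]
    have : ∀ k : ℕ, bridgeCov (2 ^ m * s - k) (2 ^ m * t - k)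
        = 4⁻¹ * (tent (2 ^ m * s - k) * tent (2 ^ m * t - k))
        + 2⁻¹ * (bridgeCov (2 * 2 ^ m * s - (2 * k : ℕ)) (2 * 2 ^ m * t - (2 * k : ℕ))
          + bridgeCov (2 * 2 ^ m * s - (2 * k + 1 : ℕ)) (2 * 2 ^ m * t - (2 * k + 1 : ℕ))) := by
      intro k
      rw [bridgeCov_eq (2 ^ m * s - k)]
      push_cast
      ring_nf
    simp_rw [this]
    rw [Finset.sum_add_distrib, ← Finset.mul_sum, ← Finset.mul_sum, pow_succ]
    generalize ∑ k ∈ Finset.range (2 ^ m * N), tent (2 ^ m * s - k) * tent (2 ^ m * t - k) = A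
    rw [mul_add, ← mul_assoc _ (4⁻¹ : ℝ), add_sub_cancel_left, ← mul_assoc,
      show (2 : ℝ) ^ (m + 1) = 2 * 2 ^ m by ring]

lemma sum_le_one_of_unique {ι : Type*} (s : Finset ι) (f : ι → ℝ) (h1 : ∀ i, f i ≤ 1)
    (h : ∀ i ∈ s, ∀ j ∈ s, f i ≠ 0 → f j ≠ 0 → i = j) : ∑ i ∈ s, f i ≤ 1 := by
  by_cases h0 : ∃ i ∈ s, f i ≠ 0
  · obtain ⟨i, hi, hfi⟩ := h0
    rw [Finset.sum_eq_single_of_mem i hi fun j hj hji => by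
      by_contra hfj; exact hji (h j hj i hi hfj hfi)]
    exact h1 i
  · push Not at h0
    rw [Finset.sum_eq_zero h0]
    exact zero_le_one

lemma eq_of_mem_unit_interval {y : ℝ} {j k : ℕ} (hj : 0 < y - j ∧ y - j < 1)
    (hk : 0 < y - k ∧ y - k < 1) : j = k := by
  have h1 : (j : ℝ) < k + 1 := by linarith
  have h2 : (k : ℝ) < j + 1 := by linarith
  norm_cast at h1 h2
  omega

lemma unit_interval_of_tent_ne_zero {y : ℝ} (h : tent y ≠ 0) : 0 < y ∧ y < 1 :=
  ⟨not_le.1 fun h0 => h (tent_of_nonpos h0), not_le.1 fun h0 => h (tent_of_one_le h0)⟩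

lemma unit_interval_of_bridgeCov_ne_zero {x y : ℝ} (h : bridgeCov x y ≠ 0) : 0 < x ∧ x < 1 :=
  ⟨not_le.1 fun h0 => h (bridgeCov_of_nonpos h0 y), not_le.1 fun h0 => h (bridgeCov_of_one_le h0 y)⟩

/-- The covariance of Brownian motion as a series in the Schauder functions. -/
lemma tendsto_schauder_sum {s t : ℝ} (hs : 0 ≤ s) (ht : 0 ≤ t) {N : ℕ} (hsN : s ≤ N) :
    Tendsto (fun m : ℕ => ∑ k ∈ Finset.range N, ramp (s - k) * ramp (t - k)
      + ∑ n ∈ Finset.range m, 2⁻¹ ^ n * 4⁻¹ * ∑ k ∈ Finset.range (2 ^ n * N),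
        tent (2 ^ n * s - k) * tent (2 ^ n * t - k)) atTop (𝓝 (min s t)) := by
  have h0 : Tendsto (fun m : ℕ => (2⁻¹ : ℝ) ^ m * ∑ k ∈ Finset.range (2 ^ m * N),
      bridgeCov (2 ^ m * s - k) (2 ^ m * t - k)) atTop (𝓝 0) := by
    refine squeeze_zero (fun m => mul_nonneg (by positivity)
      (Finset.sum_nonneg fun k _ => bridgeCov_nonneg _ _)) (fun m => ?_)
      (tendsto_pow_atTop_nhds_zero_of_lt_one (r := (2⁻¹ : ℝ)) (by norm_num) (by norm_num))
    -- Bridges on distinct dyadic cells have disjoint supports, so at most one term survives and the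
    -- remainder is at most 2^{-m}.
    refine mul_le_of_le_one_right (by positivity) (sum_le_one_of_unique _ _
      (fun k => bridgeCov_le_one _ _) fun j _ k _ hj hk => ?_)
    exact eq_of_mem_unit_interval (unit_interval_of_bridgeCov_ne_zero hj)
      (unit_interval_of_bridgeCov_ne_zero hk)
  have h1 := h0.const_sub (min s t)
  rw [sub_zero] at h1
  refine h1.congr fun m => ?_
  rw [← min_sub_schauder_sum hs ht hsN m]
  ring

/-- The Schauder functions on the half-line. -/
noncomputable def schauder : ℕ × ℕ → ℝ → ℝ
  | (0, k), t => ramp (t - k)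
  | (n + 1, k), t => (√2)⁻¹ ^ n * 2⁻¹ * tent (2 ^ n * t - k)

lemma schauder_eq_zero {n k : ℕ} {t : ℝ} (ht : 0 ≤ t) (h : 2 ^ n * t ≤ k) :
    schauder (n, k) t = 0 := by
  cases n with
  | zero => exact ramp_of_nonpos (by simpa using h)
  | succ n =>
    have : 2 ^ n * t ≤ k := by
      rw [pow_succ] at h
      have : 0 ≤ 2 ^ n * t := by positivity
      linarith
    simp only [schauder]
    rw [tent_of_nonpos (by linarith), mul_zero]

@[fun_prop]
lemma continuous_schauder (p : ℕ × ℕ) : Continuous (schauder p) := by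
  obtain ⟨n, k⟩ := p
  cases n with
  | zero =>
    change Continuous fun t => ramp (t - k)
    fun_prop
  | succ n =>
    change Continuous fun t => (√2)⁻¹ ^ n * 2⁻¹ * tent (2 ^ n * t - k)
    fun_prop

/-- The sum of the Schauder functions of level `n` with coefficients `x`. -/
noncomputable def schauderLevel (x : ℕ × ℕ → ℝ) (n : ℕ) (t : ℝ) : ℝ :=
  ∑ k ∈ Finset.range ⌈2 ^ n * t⌉₊, x (n, k) * schauder (n, k) t

lemma schauderLevel_eq (x : ℕ × ℕ → ℝ) {n M : ℕ} {t : ℝ} (ht : 0 ≤ t) (hM : 2 ^ n * t ≤ M) :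
    schauderLevel x n t = ∑ k ∈ Finset.range M, x (n, k) * schauder (n, k) t := by
  refine Finset.sum_subset (Finset.range_subset_range.2 (Nat.ceil_le.2 hM)) fun k _ hk => ?_
  rw [schauder_eq_zero ht ((Nat.le_ceil _).trans (by exact_mod_cast not_lt.1 (by simpa using hk))),
    mul_zero]

/-- A Parseval identity. Level n + 1 carries the tents of scale n, and the square of its factor
2^{-n/2}/2 is the weight 2^{-n}/4 in `tendsto_schauder_sum`. The index set can be made rectangular
because functions supported beyond s vanish at s. -/
lemma tendsto_sum_schauder_mul {s t : ℝ} (hs : 0 ≤ s) (ht : 0 ≤ t) {N : ℕ} (hsN : s ≤ N) :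
    Tendsto (fun m : ℕ => ∑ p ∈ Finset.range (m + 1) ×ˢ Finset.range (2 ^ m * N),
      schauder p s * schauder p t) atTop (𝓝 (min s t)) := by
  refine (tendsto_schauder_sum hs ht hsN).congr fun m => ?_
  have hcut : ∀ n ≤ m, ∑ k ∈ Finset.range (2 ^ n * N), schauder (n, k) s * schauder (n, k) t
      = ∑ k ∈ Finset.range (2 ^ m * N), schauder (n, k) s * schauder (n, k) t := by
    intro n hn
    refine Finset.sum_subset (Finset.range_subset_range.2
      (Nat.mul_le_mul_right _ (Nat.pow_le_pow_right (by norm_num) hn))) fun k _ hk => ?_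
    rw [schauder_eq_zero hs, zero_mul]
    have h1 : ((2 ^ n * N : ℕ) : ℝ) ≤ k := by exact_mod_cast not_lt.1 (by simpa using hk)
    push_cast at h1
    exact (mul_le_mul_of_nonneg_left hsN (by positivity)).trans h1
  have hcut' : ∀ n < m, ∑ k ∈ Finset.range (2 ^ n * N),
      schauder (n + 1, k) s * schauder (n + 1, k) t
      = ∑ k ∈ Finset.range (2 ^ m * N), schauder (n + 1, k) s * schauder (n + 1, k) t := by
    intro n hn
    refine Finset.sum_subset (Finset.range_subset_range.2
      (Nat.mul_le_mul_right _ (Nat.pow_le_pow_right (by norm_num) hn.le))) fun k _ hk => ?_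
    have h1 : ((2 ^ n * N : ℕ) : ℝ) ≤ k := by exact_mod_cast not_lt.1 (by simpa using hk)
    push_cast at h1
    have h2 := (mul_le_mul_of_nonneg_left hsN (by positivity : (0 : ℝ) ≤ 2 ^ n)).trans h1
    simp only [schauder]
    rw [tent_of_nonpos (by linarith)]
    ring
  rw [Finset.sum_product, Finset.sum_range_succ', add_comm]
  congr 1
  · refine Finset.sum_congr rfl fun n hn => ?_
    rw [← hcut' n (Finset.mem_range.1 hn), Finset.mul_sum]
    refine Finset.sum_congr rfl fun k _ => ?_
    simp only [schauder]
    have : (√2)⁻¹ ^ n * (√2)⁻¹ ^ n = (2⁻¹ : ℝ) ^ n := by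
      rw [← mul_pow, ← mul_inv, Real.mul_self_sqrt (by norm_num)]
    rw [← this]
    ring
  · rw [← hcut 0 (Nat.zero_le m)]
    simp [schauder]

/-- A bound for the Schauder levels. -/
lemma abs_schauderLevel_le (x : ℕ × ℕ → ℝ) (n T : ℕ) {t : ℝ} (ht : 0 ≤ t) (htT : t ≤ T) :
    |schauderLevel x (n + 1) t| ≤ (√2)⁻¹ ^ n * ((5 / 4) ^ n
      + (64 / 125) ^ n * ∑ k ∈ Finset.range (2 ^ (n + 1) * T), x (n + 1, k) ^ 4) := by
  have hM : 2 ^ (n + 1) * t ≤ ((2 ^ (n + 1) * T : ℕ) : ℝ) := by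
    push_cast
    exact mul_le_mul_of_nonneg_left htT (by positivity)
  rw [schauderLevel_eq x ht hM]
  have hS : ∀ k, 0 ≤ (64 / 125 : ℝ) ^ n * x (n + 1, k) ^ 4 := fun k => by positivity
  have hS' : 0 ≤ (64 / 125 : ℝ) ^ n * ∑ k ∈ Finset.range (2 ^ (n + 1) * T), x (n + 1, k) ^ 4 := by
    positivity
  simp only [schauder]
  by_cases h0 : ∃ k ∈ Finset.range (2 ^ (n + 1) * T), tent (2 ^ n * t - k) ≠ 0
  · obtain ⟨k, hk, hk0⟩ := h0
    rw [Finset.sum_eq_single_of_mem k hk fun j _ hjk => by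
      have : tent (2 ^ n * t - j) = 0 := by
        by_contra hj0
        exact hjk (eq_of_mem_unit_interval (unit_interval_of_tent_ne_zero hj0)
          (unit_interval_of_tent_ne_zero hk0))
      rw [this]; ring]
    -- If |x| exceeds (5/4)^n, then (4/5)^{3n} |x|³ ≥ 1, and 64/125 = (4/5)³. The base 5/4 is chosen
    -- so that 5/4 < √2 and 2 · 64/125 < √2, which makes both parts of the bound summable (the
    -- second one almost surely).
    have h1 : |x (n + 1, k)| ≤ (5 / 4) ^ n + (64 / 125) ^ n * x (n + 1, k) ^ 4 := by
      rcases le_total |x (n + 1, k)| ((5 / 4) ^ n) with h | h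
      · linarith [hS k]
      · have h3 : ((5 / 4 : ℝ) ^ n) ^ 3 ≤ |x (n + 1, k)| ^ 3 := by gcongr
        have h4 : (64 / 125 : ℝ) ^ n * ((5 / 4 : ℝ) ^ n) ^ 3 = 1 := by
          rw [← pow_mul, mul_comm n 3, pow_mul, ← mul_pow]; norm_num
        have h5 : x (n + 1, k) ^ 4 = |x (n + 1, k)| ^ 3 * |x (n + 1, k)| := by
          rw [← pow_succ, Even.pow_abs (by decide)]
        have h6 : 1 ≤ (64 / 125 : ℝ) ^ n * |x (n + 1, k)| ^ 3 := by
          rw [← h4]; gcongr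
        rw [h5, ← mul_assoc]
        have := le_mul_of_one_le_left (abs_nonneg (x (n + 1, k))) h6
        have : (0 : ℝ) ≤ (5 / 4) ^ n := by positivity
        linarith
    have h2 : x (n + 1, k) ^ 4 ≤ ∑ k ∈ Finset.range (2 ^ (n + 1) * T), x (n + 1, k) ^ 4 :=
      Finset.single_le_sum (f := fun k => x (n + 1, k) ^ 4) (fun j _ => by positivity) hk
    have h3 : |x (n + 1, k)| ≤ (5 / 4) ^ n + (64 / 125) ^ n *
        ∑ k ∈ Finset.range (2 ^ (n + 1) * T), x (n + 1, k) ^ 4 :=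
      h1.trans (by gcongr)
    rw [abs_mul, abs_mul, abs_of_nonneg (tent_nonneg _),
      abs_of_nonneg (by positivity : 0 ≤ (√2)⁻¹ ^ n * 2⁻¹), mul_comm, mul_assoc, mul_assoc]
    refine mul_le_mul_of_nonneg_left ?_ (by positivity)
    have h4 := mul_le_mul (tent_le_one (2 ^ n * t - k)) h3 (abs_nonneg _) zero_le_one
    have h5 := mul_nonneg (tent_nonneg (2 ^ n * t - k)) (abs_nonneg (x (n + 1, k)))
    linarith
  · push Not at h0
    rw [Finset.sum_eq_zero fun k hk => by rw [h0 k hk]; ring, abs_zero]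
    positivity

lemma inv_sqrt_two_lt : (√2)⁻¹ < 4 / 5 := by
  rw [inv_lt_comm₀ (by positivity) (by norm_num)]
  exact Real.lt_sqrt_of_sq_lt (by norm_num)

/-- The law of a family of independent standard Gaussian coefficients. -/
noncomputable def schauderLaw : Measure (ℕ × ℕ → ℝ) :=
  Measure.infinitePi fun _ => gaussianReal 0 1

instance : IsProbabilityMeasure schauderLaw := by
  unfold schauderLaw; infer_instance

/-- The families of coefficients for which the Schauder series converges locally uniformly. -/
def schauderGood : Set (ℕ × ℕ → ℝ) :=
  {x | ∀ T : ℕ, ∑' n : ℕ, ENNReal.ofReal ((√2)⁻¹ ^ n * (64 / 125) ^ n *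
    ∑ k ∈ Finset.range (2 ^ (n + 1) * T), x (n + 1, k) ^ 4) ≠ ⊤}

lemma measurableSet_schauderGood : MeasurableSet schauderGood := by
  have : schauderGood = ⋂ T : ℕ, {x | ∑' n : ℕ, ENNReal.ofReal ((√2)⁻¹ ^ n * (64 / 125) ^ n *
    ∑ k ∈ Finset.range (2 ^ (n + 1) * T), x (n + 1, k) ^ 4) ≠ ⊤} := by
    ext x; simp [schauderGood]
  rw [this]
  refine MeasurableSet.iInter fun T => ?_
  refine (measurableSet_eq_fun (Measurable.tsum fun n => ?_) measurable_const).compl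
  fun_prop

/-- Level n + 1 has 2^{n+1} T coefficients on [0, T], all with the same fourth moment, so the
expected terms form a geometric series of ratio (128/125)/√2 < 1. -/
lemma ae_mem_schauderGood : ∀ᵐ x ∂schauderLaw, x ∈ schauderGood := by
  refine ae_all_iff.2 fun T => ?_
  have hI : Integrable (fun y : ℝ => y ^ 4) (gaussianReal 0 1) := by
    have := (memLp_id_gaussianReal (μ := 0) (v := 1) 4).integrable_norm_pow (by norm_num)
    refine this.congr (ae_of_all _ fun y => ?_)
    simp [Even.pow_abs (show Even 4 by decide)]
  set C : ℝ := ∫ y, y ^ 4 ∂(gaussianReal 0 1) with hC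
  have hC0 : 0 ≤ C := integral_nonneg fun y => by positivity
  have hIk : ∀ p : ℕ × ℕ, Integrable (fun x => x p ^ 4) schauderLaw := fun p =>
    (measurePreserving_eval_infinitePi (fun _ : ℕ × ℕ => gaussianReal 0 1)
      p).integrable_comp_of_integrable hI
  have hIv : ∀ p : ℕ × ℕ, ∫ x, x p ^ 4 ∂schauderLaw = C := fun p => by
    have h := integral_map (μ := schauderLaw) (φ := fun x => x p) (f := fun y => y ^ 4)
      (measurable_pi_apply p).aemeasurable (by fun_prop)
    rw [schauderLaw, Measure.infinitePi_map_eval] at h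
    exact h.symm
  have hterm : ∀ n : ℕ, ∫⁻ x, ENNReal.ofReal ((√2)⁻¹ ^ n * (64 / 125) ^ n *
      ∑ k ∈ Finset.range (2 ^ (n + 1) * T), x (n + 1, k) ^ 4) ∂schauderLaw
      = ENNReal.ofReal (2 * T * C * ((√2)⁻¹ * (128 / 125)) ^ n) := by
    intro n
    rw [← ofReal_integral_eq_lintegral_ofReal]
    · rw [integral_const_mul, integral_finsetSum _ fun k _ => hIk _]
      simp only [hIv, Finset.sum_const, Finset.card_range, nsmul_eq_mul]
      congr 1
      rw [mul_pow, show (128 / 125 : ℝ) = 64 / 125 * 2 by norm_num, mul_pow]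
      push_cast
      ring
    · exact (integrable_finsetSum _ fun k _ => hIk _).const_mul _
    · exact ae_of_all _ fun x => by positivity
  have hfin : ∫⁻ x, ∑' n : ℕ, ENNReal.ofReal ((√2)⁻¹ ^ n * (64 / 125) ^ n *
      ∑ k ∈ Finset.range (2 ^ (n + 1) * T), x (n + 1, k) ^ 4) ∂schauderLaw ≠ ⊤ := by
    rw [lintegral_tsum fun n => Measurable.aemeasurable (by fun_prop)]
    simp_rw [hterm]
    have hr : (√2)⁻¹ * (128 / 125) < 1 := by
      have := inv_sqrt_two_lt
      linarith
    have hs : Summable fun n : ℕ => 2 * T * C * ((√2)⁻¹ * (128 / 125)) ^ n :=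
      (summable_geometric_of_lt_one (by positivity) hr).mul_left _
    rw [← ENNReal.ofReal_tsum_of_nonneg (fun n => by positivity) hs]
    exact ENNReal.ofReal_ne_top
  refine (ae_lt_top (Measurable.tsum fun n => by fun_prop) hfin).mono fun x hx => hx.ne

lemma summable_schauder_bound {x : ℕ × ℕ → ℝ} (hx : x ∈ schauderGood) (T : ℕ) :
    Summable fun n : ℕ => (√2)⁻¹ ^ n * ((5 / 4) ^ n
      + (64 / 125) ^ n * ∑ k ∈ Finset.range (2 ^ (n + 1) * T), x (n + 1, k) ^ 4) := by
  have h1 : Summable fun n : ℕ => ((√2)⁻¹ * (5 / 4)) ^ n :=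
    summable_geometric_of_lt_one (by positivity) (by linarith [inv_sqrt_two_lt])
  have h2 := ENNReal.summable_toReal (hx T)
  refine (h1.add h2).congr fun n => ?_
  rw [ENNReal.toReal_ofReal (by positivity), mul_pow]
  ring

lemma summable_schauderLevel {x : ℕ × ℕ → ℝ} (hx : x ∈ schauderGood) {t : ℝ} (ht : 0 ≤ t) :
    Summable fun n => schauderLevel x n t := by
  rw [← summable_nat_add_iff 1]
  refine Summable.of_norm_bounded (summable_schauder_bound hx ⌈t⌉₊) fun n => ?_
  exact abs_schauderLevel_le x n _ ht (Nat.le_ceil t)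

lemma continuousOn_schauderLevel (x : ℕ × ℕ → ℝ) (n T : ℕ) :
    ContinuousOn (fun t : ℝ≥0 => schauderLevel x n t) (Set.Iic T) := by
  refine ContinuousOn.congr (f := fun t : ℝ≥0 => ∑ k ∈ Finset.range (2 ^ n * T),
    x (n, k) * schauder (n, k) t) (by fun_prop) fun t ht => ?_
  refine schauderLevel_eq x t.2 ?_
  push_cast
  exact mul_le_mul_of_nonneg_left (by exact_mod_cast ht) (by positivity)

open Classical in
/-- A Brownian motion on the space of coefficients of the Schauder functions. -/
noncomputable def wiener (t : ℝ≥0) (x : ℕ × ℕ → ℝ) : ℝ :=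
  if x ∈ schauderGood then ∑' n, schauderLevel x n t else 0

/-- The Weierstrass test on each [0, T]; level 0 is split off because the bound covers levels n + 1
only. Setting the path to 0 off the good set makes every path continuous, not only almost every one.
-/
lemma continuous_wiener (x : ℕ × ℕ → ℝ) : Continuous fun t => wiener t x := by
  by_cases hx : x ∈ schauderGood
  swap
  · simp only [wiener, hx, if_false]; exact continuous_const
  simp only [wiener, hx, if_true]
  have e : (fun t : ℝ≥0 => ∑' n, schauderLevel x n t)
      = fun t : ℝ≥0 => schauderLevel x 0 t + ∑' n, schauderLevel x (n + 1) t :=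
    funext fun t => (summable_schauderLevel hx t.2).tsum_eq_zero_add
  rw [e, continuous_iff_continuousAt]
  intro t
  obtain ⟨T, hT⟩ := exists_nat_gt t
  have hc : ContinuousOn (fun t : ℝ≥0 => schauderLevel x 0 t + ∑' n, schauderLevel x (n + 1) t)
      (Set.Iic T) := by
    refine (continuousOn_schauderLevel x 0 T).add (continuousOn_tsum
      (fun n => continuousOn_schauderLevel x (n + 1) T) (summable_schauder_bound hx T)
      fun n t ht => ?_)
    exact abs_schauderLevel_le x n T t.2 (by exact_mod_cast ht)
  exact hc.continuousAt (Iic_mem_nhds hT)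

lemma measurable_schauderLevel (n : ℕ) (t : ℝ) : Measurable fun x => schauderLevel x n t := by
  unfold schauderLevel; fun_prop

lemma measurable_wiener (t : ℝ≥0) : Measurable (wiener t) := by
  unfold wiener
  refine Measurable.ite measurableSet_schauderGood ?_ measurable_const
  have := fun n => measurable_schauderLevel n t
  exact Measurable.tsum this

lemma integral_cexp_schauder (F : Finset (ℕ × ℕ)) (a : ℕ × ℕ → ℝ) :
    ∫ x, Complex.exp (((∑ p ∈ F, x p * a p : ℝ) : ℂ) * Complex.I) ∂schauderLaw
      = Complex.exp (-(((∑ p ∈ F, a p ^ 2 : ℝ) : ℂ) / 2)) := by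
  have h := integral_prod_infinitePi (fun _ : ℕ × ℕ => gaussianReal 0 1) F
    (f := fun p y => Complex.exp (((y * a p : ℝ) : ℂ) * Complex.I)) (fun p => by fun_prop)
  have e : ∀ x : ℕ × ℕ → ℝ, Complex.exp (((∑ p ∈ F, x p * a p : ℝ) : ℂ) * Complex.I)
      = ∏ p ∈ F, Complex.exp (((x p * a p : ℝ) : ℂ) * Complex.I) := fun x => by
    rw [← Complex.exp_sum, Complex.ofReal_sum, Finset.sum_mul]
  simp_rw [e]
  rw [schauderLaw, h]
  have e2 : ∀ p, ∫ y, Complex.exp (((y * a p : ℝ) : ℂ) * Complex.I) ∂(gaussianReal 0 1)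
      = Complex.exp (-((a p : ℂ) ^ 2 / 2)) := fun p => by
    have := charFun_gaussianReal (μ := 0) (v := 1) (a p)
    rw [charFun_apply_real] at this
    have e3 : ∀ y : ℝ, ((y * a p : ℝ) : ℂ) * Complex.I = (a p : ℂ) * y * Complex.I := fun y => by
      push_cast; ring
    simp_rw [e3]
    rw [this]
    congr 1
    push_cast
    ring
  simp_rw [e2]
  rw [← Complex.exp_sum, Finset.sum_neg_distrib]
  push_cast
  rw [Finset.sum_div]

/-- The characteristic function of the finite-dimensional laws of `wiener`. -/
lemma integral_cexp_wiener (I : Finset ℝ≥0) (u : I → ℝ) :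
    ∫ x, Complex.exp (((∑ i, u i * wiener i x : ℝ) : ℂ) * Complex.I) ∂schauderLaw
      = Complex.exp (-(((∑ i, ∑ j, u i * u j * min (i : ℝ) (j : ℝ) : ℝ) : ℂ) / 2)) := by
  obtain ⟨N, hN⟩ : ∃ N : ℕ, ∀ i : I, ((i : ℝ≥0) : ℝ) ≤ N := by
    obtain ⟨b, hb⟩ := I.bddAbove
    obtain ⟨N, hN⟩ := exists_nat_ge b
    exact ⟨N, fun i => by exact_mod_cast (hb i.2).trans hN⟩
  -- Since N bounds all the times in I, `F m` contains every index of level at most m that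
  -- contributes.
  set F : ℕ → Finset (ℕ × ℕ) := fun m => Finset.range (m + 1) ×ˢ Finset.range (2 ^ m * N) with hF
  set a : ℕ × ℕ → ℝ := fun p => ∑ i, u i * schauder p (i : ℝ≥0) with ha
  have hpart : ∀ m x, ∑ p ∈ F m, x p * a p
      = ∑ i, u i * ∑ n ∈ Finset.range (m + 1), schauderLevel x n (i : ℝ≥0) := by
    intro m x
    have h1 : ∀ i : I, ∑ n ∈ Finset.range (m + 1), schauderLevel x n (i : ℝ≥0)
        = ∑ p ∈ F m, x p * schauder p (i : ℝ≥0) := by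
      intro i
      rw [hF, Finset.sum_product]
      refine Finset.sum_congr rfl fun n hn => schauderLevel_eq x i.1.2 ?_
      push_cast
      have : (2 : ℝ) ^ n ≤ 2 ^ m :=
        pow_le_pow_right₀ (by norm_num) (Nat.lt_succ_iff.1 (Finset.mem_range.1 hn))
      exact mul_le_mul this (hN i) i.1.2 (by positivity)
    simp_rw [h1, ha, Finset.mul_sum]
    rw [Finset.sum_comm]
    refine Finset.sum_congr rfl fun i _ => Finset.sum_congr rfl fun p _ => by ring
  have hlim1 : Tendsto (fun m => ∫ x, Complex.exp (((∑ p ∈ F m, x p * a p : ℝ) : ℂ) * Complex.I)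
      ∂schauderLaw) atTop
      (𝓝 (∫ x, Complex.exp (((∑ i, u i * wiener i x : ℝ) : ℂ) * Complex.I) ∂schauderLaw)) := by
    refine tendsto_integral_of_dominated_convergence (fun _ => 1)
      (fun m => Measurable.aestronglyMeasurable (by fun_prop)) (integrable_const _)
      (fun m => ae_of_all _ fun x => by rw [Complex.norm_exp_ofReal_mul_I]) ?_
    filter_upwards [ae_mem_schauderGood] with x hx
    have h1 : Tendsto (fun m => ∑ p ∈ F m, x p * a p) atTop (𝓝 (∑ i, u i * wiener i x)) := by
      simp_rw [hpart]
      refine tendsto_finsetSum _ fun i _ => Tendsto.const_mul _ ?_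
      simp only [wiener, hx, if_true]
      exact (tendsto_add_atTop_iff_nat 1).2
        (summable_schauderLevel hx i.1.2).hasSum.tendsto_sum_nat
    have h2 : Continuous fun y : ℝ => Complex.exp ((y : ℂ) * Complex.I) := by fun_prop
    exact (h2.tendsto _).comp h1
  simp_rw [integral_cexp_schauder] at hlim1
  have hsq : ∀ m, ∑ p ∈ F m, a p ^ 2
      = ∑ i, ∑ j, u i * u j * ∑ p ∈ F m, schauder p (i : ℝ≥0) * schauder p (j : ℝ≥0) := by
    intro m
    simp_rw [ha, sq, Finset.sum_mul_sum, Finset.mul_sum]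
    rw [Finset.sum_comm]
    refine Finset.sum_congr rfl fun i _ => ?_
    rw [Finset.sum_comm]
    refine Finset.sum_congr rfl fun j _ => Finset.sum_congr rfl fun p _ => by ring
  have hlim2 : Tendsto (fun m => ∑ p ∈ F m, a p ^ 2) atTop
      (𝓝 (∑ i, ∑ j, u i * u j * min ((i : ℝ≥0) : ℝ) (j : ℝ≥0))) := by
    simp_rw [hsq]
    exact tendsto_finsetSum _ fun i _ => tendsto_finsetSum _ fun j _ =>
      (tendsto_sum_schauder_mul i.1.2 j.1.2 (hN i)).const_mul _
  have hc : Continuous fun y : ℝ => Complex.exp (-((y : ℂ) / 2)) := by fun_prop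
  exact tendsto_nhds_unique hlim1 ((hc.tendsto _).comp hlim2)

/-- The Schauder series is a Brownian motion. -/
theorem isBrownianReal_wiener : IsBrownianReal wiener schauderLaw where
  cont := ae_of_all _ continuous_wiener
  hasLaw I := by
    have hm : Measurable fun x => I.restrict (fun t => wiener t x) :=
      measurable_pi_lambda _ fun i => measurable_wiener _
    refine ⟨hm.aemeasurable, ?_⟩
    have hprob : IsProbabilityMeasure (schauderLaw.map fun x => I.restrict (fun t => wiener t x)) :=
      Measure.isProbabilityMeasure_map hm.aemeasurable
    -- The laws are compared on Euclidean space, where the target is a multivariate Gaussian and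
    -- characteristic functions determine measures.
    apply (MeasurableEquiv.toLp 2 (I → ℝ)).map_measurableEquiv_injective
    have e : (BrownianReal.projectiveFamily I).map (MeasurableEquiv.toLp 2 (I → ℝ))
        = multivariateGaussian 0 (BrownianReal.covMatrix I) :=
      (BrownianReal.measurePreserving_toLp_projectiveFamily I).map_eq
    rw [e]
    apply Measure.ext_of_charFun
    ext u
    rw [charFun_multivariateGaussian (BrownianReal.posSemidef_covMatrix I), charFun_apply,
      integral_map (by fun_prop) (by fun_prop), integral_map hm.aemeasurable (by fun_prop)]
    have h := integral_cexp_wiener I u.ofLp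
    convert h using 2
    · ext x
      congr 2
    · simp [dotProduct, Matrix.mulVec, Finset.mul_sum]
      exact Finset.sum_congr rfl fun i _ => Finset.sum_congr rfl fun j _ => by ring

end BrownianMotion

/-! ### Brownian motion evaluated at independent random times -/

section RandomTime

/-- The largest multiple of `1 / (m + 1)` which is at most `t`. -/
noncomputable def floorTime (m : ℕ) (t : ℝ≥0) : ℝ≥0 := ⌊(t : ℝ) * (m + 1)⌋₊ / (m + 1)

lemma tendsto_floorTime (t : ℝ≥0) : Tendsto (fun m => floorTime m t) atTop (𝓝 t) := by
  rw [← NNReal.tendsto_coe]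
  have h := (tendsto_nat_floor_mul_div_atTop t.2).comp
    (tendsto_natCast_atTop_atTop (R := ℝ)|>.atTop_add (tendsto_const_nhds (x := (1 : ℝ))))
  refine h.congr fun m => ?_
  simp [floorTime]

variable {Ω ι : Type*} [MeasurableSpace Ω] {P : Measure Ω} [IsProbabilityMeasure P] [Fintype ι]
  {W : ℝ≥0 → Ω → ℝ}

/-- Evaluation (x, t) ↦ x(t) is not measurable for the product σ-algebra on all paths. Floored times
take countably many values, which restores measurability. -/
lemma measurable_eval_floorTime (m : ℕ) :
    Measurable fun x : (ℝ≥0 → ℝ) × (ι → ℝ≥0) => fun j => x.1 (floorTime m (x.2 j)) := by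
  have h1 : Measurable fun x : (ℝ≥0 → ℝ) × (ι → ℕ) => fun j => x.1 ((x.2 j : ℝ≥0) / (m + 1)) :=
    measurable_from_prod_countable_left fun k => measurable_pi_lambda _ fun j =>
      measurable_pi_apply ((k j : ℝ≥0) / (m + 1))
  have h2 : Measurable fun x : (ℝ≥0 → ℝ) × (ι → ℝ≥0) =>
      (x.1, fun j => ⌊(x.2 j : ℝ) * (m + 1)⌋₊) := by
    refine measurable_fst.prodMk (measurable_pi_lambda _ fun j => Nat.measurable_floor.comp ?_)
    fun_prop
  exact h1.comp h2

/-- Conditionally on an independent family of times, a continuous process at these times has the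
law of the process at deterministic times. -/
theorem integral_randomTime (hW : ∀ t, Measurable (W t)) (hc : ∀ᵐ ω ∂P, Continuous fun t => W t ω)
    {τ : Ω → ι → ℝ≥0} (hτ : Measurable τ) (h : IndepFun (fun ω t => W t ω) τ P)
    {F : (ι → ℝ) → ℂ} (hF : Continuous F) (hF1 : ∀ x, ‖F x‖ ≤ 1)
    {G : (ι → ℝ≥0) → ℂ} (hG : Measurable G) (hG1 : ∀ t, ‖G t‖ ≤ 1) :
    ∫ ω, F (fun j => W (τ ω j) ω) * G (τ ω) ∂P
      = ∫ ω, (∫ ω', F (fun j => W (τ ω j) ω') ∂P) * G (τ ω) ∂P := by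
  have hp : Measurable fun ω t => W t ω := measurable_pi_lambda _ hW
  set Ψ : (ι → ℝ≥0) → ℂ := fun t => ∫ ω', F (fun j => W (t j) ω') ∂P with hΨ
  have hFm : ∀ t : ι → ℝ≥0, Measurable fun ω' => F (fun j => W (t j) ω') := fun t =>
    hF.measurable.comp (measurable_pi_lambda _ fun j => hW _)
  have hΨ1 : ∀ t, ‖Ψ t‖ ≤ 1 := fun t => by
    simpa using norm_integral_le_of_norm_le_const (μ := P) (ae_of_all _ fun ω' => hF1 _)
  have hΨc : Continuous Ψ := by
    refine continuous_of_dominated (bound := fun _ => 1) (fun t => (hFm t).aestronglyMeasurable)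
      (fun t => ae_of_all _ fun ω' => hF1 _) (integrable_const _) ?_
    filter_upwards [hc] with ω hω
    exact hF.comp (continuous_pi fun j => hω.comp (continuous_apply j))
  have hmul : ∀ {a b : ℂ}, ‖a‖ ≤ 1 → ‖b‖ ≤ 1 → ‖a * b‖ ≤ 1 := fun {a b} ha hb => by
    rw [norm_mul]; exact mul_le_one₀ ha (norm_nonneg _) hb
  -- For floored times independence and Fubini apply; continuity of paths then removes the flooring
  -- in the limit, on both sides.
  have step : ∀ m, ∫ ω, F (fun j => W (floorTime m (τ ω j)) ω) * G (τ ω) ∂P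
      = ∫ ω, Ψ (fun j => floorTime m (τ ω j)) * G (τ ω) ∂P := by
    intro m
    set H : (ℝ≥0 → ℝ) × (ι → ℝ≥0) → ℂ :=
      fun x => F (fun j => x.1 (floorTime m (x.2 j))) * G x.2 with hH
    have hHm : Measurable H :=
      (hF.measurable.comp (measurable_eval_floorTime m)).mul (hG.comp measurable_snd)
    have e1 : ∫ ω, F (fun j => W (floorTime m (τ ω j)) ω) * G (τ ω) ∂P
        = ∫ x, H x ∂(P.map fun ω => (fun t => W t ω, τ ω)) := by
      rw [integral_map (hp.prodMk hτ).aemeasurable hHm.aestronglyMeasurable]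
    have i1 := Measure.isProbabilityMeasure_map (μ := P) hp.aemeasurable
    have i2 := Measure.isProbabilityMeasure_map (μ := P) hτ.aemeasurable
    rw [e1, (indepFun_iff_map_prod_eq_prod_map_map hp.aemeasurable hτ.aemeasurable).1 h,
      integral_prod_symm _ (Integrable.of_bound hHm.aestronglyMeasurable 1
        (ae_of_all _ fun x => hmul (hF1 _) (hG1 _))),
      integral_map hτ.aemeasurable hHm.stronglyMeasurable.integral_prod_left.aestronglyMeasurable]
    refine integral_congr_ae (ae_of_all _ fun ω => ?_)
    have hs : Measurable fun x => H (x, τ ω) := hHm.comp (measurable_id.prodMk measurable_const)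
    simp only
    rw [integral_map hp.aemeasurable hs.aestronglyMeasurable, hΨ]
    simp only [hH]
    rw [integral_mul_const]
  have hfl : ∀ ω, Tendsto (fun m j => floorTime m (τ ω j)) atTop (𝓝 (τ ω)) := fun ω =>
    tendsto_pi_nhds.2 fun j => tendsto_floorTime _
  have hm1 : ∀ m, Measurable fun ω => F (fun j => W (floorTime m (τ ω j)) ω) * G (τ ω) := fun m =>
    (hF.measurable.comp ((measurable_eval_floorTime m).comp (hp.prodMk hτ))).mul (hG.comp hτ)
  have hm2 : ∀ m, Measurable fun ω => Ψ (fun j => floorTime m (τ ω j)) * G (τ ω) := fun m => by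
    refine (hΨc.measurable.comp (measurable_pi_lambda _ fun j => ?_)).mul (hG.comp hτ)
    have : Measurable fun ω => ⌊(τ ω j : ℝ) * (m + 1)⌋₊ := Nat.measurable_floor.comp (by fun_prop)
    unfold floorTime
    fun_prop
  have l1 := tendsto_integral_of_dominated_convergence (μ := P) (fun _ => (1 : ℝ))
    (f := fun ω => F (fun j => W (τ ω j) ω) * G (τ ω))
    (fun m => (hm1 m).aestronglyMeasurable) (integrable_const _)
    (fun m => ae_of_all _ fun ω => hmul (hF1 _) (hG1 _)) (by
      filter_upwards [hc] with ω hω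
      refine Tendsto.mul_const _ ((hF.tendsto _).comp (tendsto_pi_nhds.2 fun j => ?_))
      exact (hω.tendsto _).comp (tendsto_floorTime _))
  have l2 := tendsto_integral_of_dominated_convergence (μ := P) (fun _ => (1 : ℝ))
    (f := fun ω => Ψ (τ ω) * G (τ ω))
    (fun m => (hm2 m).aestronglyMeasurable) (integrable_const _)
    (fun m => ae_of_all _ fun ω => hmul (hΨ1 _) (hG1 _)) (ae_of_all _ fun ω =>
      ((hΨc.tendsto _).comp (hfl ω)).mul_const _)
  simp_rw [step] at l1
  exact tendsto_nhds_unique l1 l2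

lemma norm_cexp_real_mul_I (x : ℝ) : ‖Complex.exp ((x : ℂ) * Complex.I)‖ ≤ 1 :=
  (Complex.norm_exp_ofReal_mul_I x).le

/-- The characteristic function of a Brownian motion with drift at an independent time. -/
theorem integral_cexp_brownian_randomTime (hW : ∀ t, Measurable (W t)) (hB : IsBrownianReal W P)
    {τ : Ω → ℝ≥0} (hτ : Measurable τ) (h : IndepFun (fun ω t => W t ω) τ P) (u b : ℝ) :
    ∫ ω, Complex.exp (((u * (W (τ ω) ω + b * τ ω) : ℝ) : ℂ) * Complex.I) ∂P
      = ∫ ω, Complex.exp (-((u ^ 2 / 2 - Complex.I * u * b) * (τ ω : ℝ))) ∂P := by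
  have hτ' : Measurable fun ω (_ : Fin 1) => τ ω := measurable_pi_lambda _ fun _ => hτ
  have key := integral_randomTime (P := P) hW hB.cont hτ'
    (h.comp measurable_id (measurable_pi_lambda (fun (x : ℝ≥0) (_ : Fin 1) => x) fun _ =>
      measurable_id))
    (F := fun x => Complex.exp (((u * x 0 : ℝ) : ℂ) * Complex.I)) (by fun_prop)
    (fun x => norm_cexp_real_mul_I _)
    (G := fun t => Complex.exp (((u * (b * t 0) : ℝ) : ℂ) * Complex.I)) (by fun_prop)
    (fun x => norm_cexp_real_mul_I _)
  have hch : ∀ t, ∫ ω', Complex.exp (((u * W t ω' : ℝ) : ℂ) * Complex.I) ∂P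
      = Complex.exp (-((t : ℝ) * u ^ 2 / 2)) := by
    intro t
    have := charFun_gaussianReal (μ := 0) (v := t) u
    rw [← (hB.hasLaw_eval t).map_eq, charFun_apply_real,
      integral_map (hW t).aemeasurable (by fun_prop)] at this
    push_cast
    rw [this]
    simp
  simp only [hch] at key
  convert key using 3 with ω ω
  · rw [← Complex.exp_add]
    congr 1
    push_cast
    ring
  · rw [← Complex.exp_add]
    congr 1
    push_cast
    ring

/-- The joint characteristic function of the increments of a Brownian motion with drift between
independent times. -/
theorem integral_cexp_brownian_increments (hW : ∀ t, Measurable (W t)) (hB : IsBrownianReal W P)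
    {n : ℕ} {τ : Ω → Fin (n + 1) → ℝ≥0} (hτ : Measurable τ) (hmono : ∀ᵐ ω ∂P, Monotone (τ ω))
    (h : IndepFun (fun ω t => W t ω) τ P) (u : Fin n → ℝ) (b : ℝ) :
    ∫ ω, Complex.exp (∑ j, ((u j * (W (τ ω j.succ) ω - W (τ ω j.castSucc) ω
        + b * ((τ ω j.succ : ℝ) - τ ω j.castSucc)) : ℝ) : ℂ) * Complex.I) ∂P
      = ∫ ω, Complex.exp (-∑ j, ((u j) ^ 2 / 2 - Complex.I * u j * b) *
        ((τ ω j.succ : ℝ) - (τ ω j.castSucc : ℝ))) ∂P := by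
  have hn : ∀ x : Fin n → ℝ, ‖Complex.exp (∑ j, ((x j : ℝ) : ℂ) * Complex.I)‖ ≤ 1 := fun x => by
    rw [← Finset.sum_mul, ← Complex.ofReal_sum]
    exact norm_cexp_real_mul_I _
  have key := integral_randomTime (P := P) hW hB.cont hτ h
    (F := fun x => Complex.exp (∑ j : Fin n, ((u j * (x j.succ - x j.castSucc) : ℝ) : ℂ)
      * Complex.I)) (by fun_prop) (fun x => hn _)
    (G := fun t => Complex.exp (∑ j : Fin n, ((u j * (b * ((t j.succ : ℝ) - t j.castSucc)) : ℝ)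
      : ℂ) * Complex.I)) (by fun_prop) (fun x => hn _)
  have hch : ∀ t : Fin (n + 1) → ℝ≥0, Monotone t →
      ∫ ω', Complex.exp (∑ j : Fin n, ((u j * (W (t j.succ) ω' - W (t j.castSucc) ω') : ℝ) : ℂ)
        * Complex.I) ∂P
      = Complex.exp (-∑ j : Fin n, ((u j) ^ 2 / 2 : ℂ) *
        ((t j.succ : ℝ) - (t j.castSucc : ℝ))) := by
    intro t ht
    have hind := hB.hasIndepIncrements n t ht
    have hmm : ∀ j : Fin n, Measurable fun ω' => W (t j.succ) ω' - W (t j.castSucc) ω' :=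
      fun j => (hW _).sub (hW _)
    simp_rw [Complex.exp_sum]
    have hprod := (hind.comp (fun j x => Complex.exp (((u j * x : ℝ) : ℂ) * Complex.I))
      (fun j => by fun_prop)).integral_fun_prod_eq_prod_integral (fun j =>
        (Measurable.comp (g := fun x : ℝ => Complex.exp (((u j * x : ℝ) : ℂ) * Complex.I))
          (by fun_prop) (hmm j)).aestronglyMeasurable)
    simp only [Function.comp_def] at hprod
    rw [hprod, ← Finset.sum_neg_distrib, Complex.exp_sum]
    refine Finset.prod_congr rfl fun j _ => ?_
    have := charFun_gaussianReal (μ := 0) (v := nndist (t j.succ).1 (t j.castSucc).1) (u j)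
    have hsub := (hB.hasLaw_sub (t j.succ) (t j.castSucc)).map_eq
    rw [← hsub, charFun_apply_real, integral_map
      ((hW _).sub (hW _)).aemeasurable (by fun_prop)] at this
    push_cast
    simp only [Pi.sub_apply, Complex.ofReal_sub] at this
    rw [this]
    have hle : (t j.castSucc : ℝ) ≤ t j.succ := ht (Fin.castSucc_lt_succ (i := j)).le
    have hd : ((nndist (t j.succ).1 (t j.castSucc).1 : ℝ≥0) : ℝ)
        = (t j.succ : ℝ) - (t j.castSucc : ℝ) := by
      rw [coe_nndist, Real.dist_eq, NNReal.val_eq_coe, NNReal.val_eq_coe,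
        abs_of_nonneg (by linarith)]
    rw [hd]
    congr 1
    push_cast
    ring
  have e2 : ∫ ω, (∫ ω', Complex.exp (∑ j : Fin n, ((u j * (W (τ ω j.succ) ω' - W (τ ω j.castSucc)
      ω') : ℝ) : ℂ) * Complex.I) ∂P) * Complex.exp (∑ j : Fin n,
        ((u j * (b * ((τ ω j.succ : ℝ) - τ ω j.castSucc)) : ℝ) : ℂ) * Complex.I) ∂P
      = ∫ ω, Complex.exp (-∑ j, ((u j) ^ 2 / 2 - Complex.I * u j * b) *
        ((τ ω j.succ : ℝ) - (τ ω j.castSucc : ℝ))) ∂P := by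
    refine integral_congr_ae ?_
    filter_upwards [hmono] with ω hω
    rw [hch _ hω, ← Complex.exp_add, ← Finset.sum_neg_distrib, ← Finset.sum_neg_distrib,
      ← Finset.sum_add_distrib]
    congr 1
    refine Finset.sum_congr rfl fun j _ => ?_
    push_cast
    ring
  rw [← e2, ← key]
  refine integral_congr_ae (ae_of_all _ fun ω => ?_)
  simp only
  rw [← Complex.exp_add, ← Finset.sum_add_distrib]
  congr 1
  refine Finset.sum_congr rfl fun j _ => ?_
  push_cast
  ring

end RandomTime

/-! ### Subordination produces additive processes; transfer to other spaces -/

section Subordinated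

variable {Ω Ω' : Type*} [MeasurableSpace Ω] [MeasurableSpace Ω'] {P : Measure Ω} {P' : Measure Ω'}
  [IsProbabilityMeasure P] [IsProbabilityMeasure P']

/-- Every sequence of times tending to t has a subsequence along which Z converges a.e., and there
the hypothesis passes the convergence to X. By the subsequence criterion this is convergence in
measure. -/
lemma tendstoInMeasure_of_continuous_in_prob {X Z : ℝ≥0 → Ω → ℝ} {t : ℝ≥0}
    (hX : ∀ s, Measurable (X s)) (hZ : TendstoInMeasure P Z (𝓝 t) (Z t))
    (h : ∀ᵐ ω ∂P, ∀ s : ℕ → ℝ≥0, Tendsto s atTop (𝓝 t) →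
      Tendsto (fun i => Z (s i) ω) atTop (𝓝 (Z t ω)) →
      Tendsto (fun i => X (s i) ω) atTop (𝓝 (X t ω))) :
    TendstoInMeasure P X (𝓝 t) (X t) := by
  intro ε hε
  rw [tendsto_iff_seq_tendsto]
  intro s hs
  suffices hX' : TendstoInMeasure P (fun i => X (s i)) atTop (X t) from hX' ε hε
  rw [exists_seq_tendstoInMeasure_atTop_iff fun n => (hX _).aestronglyMeasurable]
  intro ns hns
  have hsn : Tendsto (fun i => s (ns i)) atTop (𝓝 t) := hs.comp hns.tendsto_atTop
  have hZs : TendstoInMeasure P (fun i => Z (s (ns i))) atTop (Z t) := fun δ hδ =>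
    (hZ δ hδ).comp hsn
  obtain ⟨ms, hms, hlim⟩ := hZs.exists_seq_tendsto_ae
  refine ⟨ms, hms, ?_⟩
  filter_upwards [hlim, h] with ω h1 h2
  exact h2 _ (hsn.comp hms.tendsto_atTop) h1

/-- A continuous Brownian motion with drift, subordinated by an independent additive subordinator
and shifted by a continuous deterministic function, is an additive process. -/
theorem isAdditiveProcess_subordinated {W : ℝ≥0 → Ω → ℝ} {Z : ℝ≥0 → Ω → ℝ≥0} {c : ℝ≥0 → ℝ}
    (hW : ∀ t, Measurable (W t)) (hB : IsBrownianReal W P)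
    (hWc : ∀ ω, Continuous fun t => W t ω) (hZm : ∀ t, Measurable (Z t))
    (hZ : IsAdditiveSubordinator P Z)
    (h : IndepFun (fun ω t => W t ω) (fun ω t => Z t ω) P) (b : ℝ) (hc : Continuous c)
    (hc0 : c 0 = 0) :
    IsAdditiveProcess P fun t ω => W (Z t ω) ω + b * (Z t ω : ℝ) + c t := by
  -- Continuity of every path gives joint measurability, so that W at the random time is a random
  -- variable.
  have hWu : Measurable (Function.uncurry W) :=
    measurable_uncurry_of_continuous_of_measurable hWc hW
  have hm : ∀ t, Measurable fun ω => W (Z t ω) ω + b * (Z t ω : ℝ) + c t := fun t => by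
    have h1 : Measurable fun ω => W (Z t ω) ω := hWu.comp ((hZm t).prodMk measurable_id)
    have h2 : Measurable fun ω => (Z t ω : ℝ) := (hZm t).coe_nnreal_real
    exact (h1.add (h2.const_mul b)).add_const _
  refine ⟨hm, ?_, ?_, fun t => ?_, ?_⟩
  · filter_upwards [hZ.additive.zero_ae, hB.eval_zero_ae_eq_zero] with ω h1 h2
    have h3 : Z 0 ω = 0 := by exact_mod_cast h1
    simp [h3, h2, hc0]
  · intro n t ht
    refine iIndepFun_of_integral_cexp (fun j => (hm _).sub (hm _)) fun u => ?_
    -- Averaging over W leaves exponentials of the increments of Z, which are independent. The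
    -- number of increments is left free so that the case m = 1 identifies each factor of the
    -- product.
    have hpair : ∀ {m : ℕ} (s : Fin (m + 1) → ℝ≥0), Monotone s → ∀ v : Fin m → ℝ,
        ∫ ω, Complex.exp (∑ j, ((v j * ((W (Z (s j.succ) ω) ω + b * (Z (s j.succ) ω : ℝ)
          + c (s j.succ)) - (W (Z (s j.castSucc) ω) ω + b * (Z (s j.castSucc) ω : ℝ)
          + c (s j.castSucc))) : ℝ) : ℂ) * Complex.I) ∂P
        = Complex.exp (∑ j, ((v j * (c (s j.succ) - c (s j.castSucc)) : ℝ) : ℂ) * Complex.I) *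
          ∏ j, ∫ ω, Complex.exp (-(((v j) ^ 2 / 2 - Complex.I * v j * b) *
            (((Z (s j.succ) ω : ℝ) - (Z (s j.castSucc) ω : ℝ) : ℝ) : ℂ))) ∂P := by
      intro m s hs v
      have hτ : Measurable fun ω j => Z (s j) ω := measurable_pi_lambda _ fun j => hZm _
      have hind : IndepFun (fun ω t => W t ω) (fun ω j => Z (s j) ω) P :=
        h.comp measurable_id (measurable_pi_lambda (fun (z : ℝ≥0 → ℝ≥0) j => z (s j))
          fun j => measurable_pi_apply _)
      have hmo : ∀ᵐ ω ∂P, Monotone fun j => Z (s j) ω := by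
        filter_upwards [hZ.monotone] with ω hω using hω.comp hs
      have key := integral_cexp_brownian_increments hW hB hτ hmo hind v b
      have hprod := ((hZ.additive.indep m s hs).comp
        (fun j x => Complex.exp (-(((v j) ^ 2 / 2 - Complex.I * v j * b) * ((x : ℝ) : ℂ))))
        (fun j => by fun_prop)).integral_fun_prod_eq_prod_integral (fun j =>
          (Measurable.comp (g := fun x : ℝ =>
            Complex.exp (-(((v j) ^ 2 / 2 - Complex.I * v j * b) * ((x : ℝ) : ℂ))))
          (by fun_prop) ((hZm _).coe_nnreal_real.sub (hZm _).coe_nnreal_real)).aestronglyMeasurable)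
      simp only [Function.comp_def] at hprod
      rw [← hprod]
      simp_rw [← Complex.exp_sum, Finset.sum_neg_distrib, Complex.ofReal_sub]
      rw [← key, ← integral_const_mul]
      refine integral_congr_ae (ae_of_all _ fun ω => ?_)
      simp only
      rw [← Complex.exp_add, ← Finset.sum_add_distrib]
      congr 1
      refine Finset.sum_congr rfl fun j _ => ?_
      push_cast
      ring
    rw [hpair t ht u, Complex.exp_sum, ← Finset.prod_mul_distrib]
    refine Finset.prod_congr rfl fun j _ => ?_
    have h1 := hpair (m := 1) ![t j.castSucc, t j.succ] (by
      have := ht (Fin.castSucc_lt_succ (i := j)).le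
      intro i i' hii
      fin_cases i <;> fin_cases i' <;> simp_all) fun _ => u j
    simpa using h1.symm
  · refine tendstoInMeasure_of_continuous_in_prob hm (hZ.additive.continuous_in_prob t) ?_
    refine ae_of_all _ fun ω s hs hZs => ?_
    have hZs' : Tendsto (fun i => Z (s i) ω) atTop (𝓝 (Z t ω)) := NNReal.tendsto_coe.1 hZs
    exact ((((hWc ω).tendsto _).comp hZs').add (hZs.const_mul b)).add ((hc.tendsto t).comp hs)
  · filter_upwards [hZ.additive.cadlag] with ω hω t
    obtain ⟨h1, l, hl⟩ := hω t
    refine ⟨?_, W l.toNNReal ω + b * l + c t, ?_⟩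
    · have h1' : ContinuousWithinAt (fun s => Z s ω) (Set.Ici t) t := NNReal.tendsto_coe.1 h1
      exact (((hWc ω).continuousAt.comp_continuousWithinAt h1').add
        (h1.const_mul b)).add hc.continuousWithinAt
    · have hl' : Tendsto (fun s => Z s ω) (𝓝[<] t) (𝓝 l.toNNReal) := by
        have := (continuous_real_toNNReal.tendsto l).comp hl
        simpa [Function.comp_def] using this
      exact ((((hWc ω).tendsto _).comp hl').add (hl.const_mul b)).add
        (hc.continuousWithinAt.tendsto)

lemma hasIndepIncrements_comp_measurePreserving {X : ℝ≥0 → Ω → ℝ} {f : Ω' → Ω}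
    (hf : MeasurePreserving f P' P) (hm : ∀ t, Measurable (X t)) (hX : HasIndepIncrements X P) :
    HasIndepIncrements (fun t ω => X t (f ω)) P' := by
  intro n t ht
  have h := hX n t ht
  have h1 : ∀ j : Fin n, Measurable fun ω => X (t j.succ) ω - X (t j.castSucc) ω :=
    fun j => (hm _).sub (hm _)
  rw [iIndepFun_iff_map_fun_eq_pi_map fun j => (h1 j).aemeasurable] at h
  refine (iIndepFun_iff_map_fun_eq_pi_map fun j =>
    ((h1 j).comp hf.measurable).aemeasurable).2 ?_
  rw [← hf.map_eq, Measure.map_map (measurable_pi_lambda _ h1) hf.measurable] at h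
  simp_rw [Measure.map_map (h1 _) hf.measurable] at h
  exact h

lemma IsAdditiveProcess.comp_measurePreserving {X : ℝ≥0 → Ω → ℝ} {f : Ω' → Ω}
    (hX : IsAdditiveProcess P X) (hf : MeasurePreserving f P' P) :
    IsAdditiveProcess P' fun t ω => X t (f ω) where
  measurable t := (hX.measurable t).comp hf.measurable
  zero_ae := hf.quasiMeasurePreserving.ae hX.zero_ae
  indep := hasIndepIncrements_comp_measurePreserving hf hX.measurable hX.indep
  continuous_in_prob t := by
    intro ε hε
    refine (hX.continuous_in_prob t ε hε).congr fun s => ?_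
    have hms : MeasurableSet {ω | ε ≤ edist (X s ω) (X t ω)} :=
      measurableSet_le measurable_const ((hX.measurable s).edist (hX.measurable t))
    exact (hf.measure_preimage hms.nullMeasurableSet).symm
  cadlag := hf.quasiMeasurePreserving.ae hX.cadlag

lemma IsAdditiveSubordinator.comp_measurePreserving {Z : ℝ≥0 → Ω → ℝ≥0} {f : Ω' → Ω}
    (hZ : IsAdditiveSubordinator P Z) (hf : MeasurePreserving f P' P) :
    IsAdditiveSubordinator P' fun t ω => Z t (f ω) where
  additive := hZ.additive.comp_measurePreserving hf
  monotone := hf.quasiMeasurePreserving.ae hZ.monotone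

end Subordinated

lemma isBrownianReal_comp_measurePreserving {Ω Ω' : Type*} [MeasurableSpace Ω]
    [MeasurableSpace Ω'] {P : Measure Ω} {P' : Measure Ω'} {W : ℝ≥0 → Ω → ℝ} {f : Ω' → Ω}
    (hW : IsBrownianReal W P) (hm : ∀ t, Measurable (W t)) (hf : MeasurePreserving f P' P) :
    IsBrownianReal (fun t ω => W t (f ω)) P' where
  hasLaw I := by
    have h1 : Measurable fun ω => I.restrict (fun t => W t ω) :=
      measurable_pi_lambda _ fun i => hm _
    refine ⟨(h1.comp hf.measurable).aemeasurable, ?_⟩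
    rw [← (hW.hasLaw I).map_eq, ← hf.map_eq, Measure.map_map h1 hf.measurable]
    rfl
  cont := hf.quasiMeasurePreserving.ae hW.cont

/-! ### Tempered stable laws and their exponential moments -/

section TemperedStableLaw

lemma rpow_mul_exp_neg_le_one {s x : ℝ} (hs0 : 0 ≤ s) (hs1 : s ≤ 1) (hx : 0 ≤ x) :
    x ^ s * Real.exp (-x) ≤ 1 := by
  have h1 : x ^ s ≤ Real.exp x := by
    rcases le_or_gt x 1 with h | h
    · exact (Real.rpow_le_one hx h hs0).trans (Real.one_le_exp hx)
    · calc x ^ s ≤ x ^ (1 : ℝ) := Real.rpow_le_rpow_of_exponent_le h.le hs1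
        _ = x := Real.rpow_one x
        _ ≤ Real.exp x := by linarith [Real.add_one_le_exp x]
  calc x ^ s * Real.exp (-x) ≤ Real.exp x * Real.exp (-x) := by gcongr
    _ = 1 := by rw [← Real.exp_add]; simp

/-- Tempered stable levels with nondecreasing activity `γ`, nonincreasing tempering `l` and
continuous mean `m`. -/
theorem isJumpLevel_tempered {α : ℝ} (hα0 : 0 ≤ α) (hα : α < 1) {γ l m : ℝ≥0 → ℝ}
    (hγ0 : γ 0 = 0) (hγ : ∀ t, 0 < t → 0 ≤ γ t) (hl : ∀ t, 0 < t → 0 < l t)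
    (hγm : MonotoneOn γ (Set.Ioi 0)) (hlm : AntitoneOn l (Set.Ioi 0))
    (hγc : ContinuousOn γ (Set.Ioi 0)) (hlc : ContinuousOn l (Set.Ioi 0))
    (hmc : Continuous m) (hm0 : m 0 = 0)
    (hm : ∀ t, 0 < t → γ t * (l t ^ (α - 1) * Real.Gamma (1 - α)) = m t) :
    IsJumpLevel (fun z => z ^ (-1 - α)) fun t z => γ t * Real.exp (-l t * z) := by
  have hG : 0 < Real.Gamma (1 - α) := Real.Gamma_pos_of_pos (by linarith)
  have hγn : ∀ t, 0 ≤ γ t := fun t => by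
    rcases eq_zero_or_pos t with rfl | ht
    · exact hγ0.ge
    · exact hγ t ht
  have hden : ∀ t z, z * (z ^ (-1 - α) * (γ t * Real.exp (-l t * z)))
      = γ t * (z * tsDensity α (l t) z) := fun t z => by unfold tsDensity; ring
  refine ⟨by fun_prop, fun z hz => by positivity, fun t => by fun_prop, fun z _ => by simp [hγ0],
    fun z hz s t hst => ?_, fun z hz => ?_, fun t => ?_, ?_⟩
  · rcases eq_zero_or_pos s with rfl | hs
    · simpa [hγ0] using mul_nonneg (hγn t) (Real.exp_pos _).le
    · have ht : 0 < t := hs.trans_le hst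
      have h1 := hγm hs ht hst
      have h2 := hlm hs ht hst
      have := hγn t
      simp only
      gcongr
  · rw [continuous_iff_continuousAt]
    intro t
    rcases eq_zero_or_pos t with rfl | ht
    -- Nothing is assumed about l at 0, where it may blow up. The inequality x^{1-α} e^{-x} ≤ 1 at x
    -- = l_t z bounds the level by a multiple of the mean, which tends to 0.
    · have hb : ∀ t, γ t * Real.exp (-l t * z) ≤ m t * (z ^ (α - 1) / Real.Gamma (1 - α)) := by
        intro t
        rcases eq_zero_or_pos t with rfl | ht
        · simp [hγ0, hm0]
        · have hlt := hl t ht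
          have h1 := rpow_mul_exp_neg_le_one (s := 1 - α) (x := l t * z) (by linarith)
            (by linarith) (by positivity)
          rw [Real.mul_rpow hlt.le hz.le] at h1
          have h2 : l t ^ (α - 1) * l t ^ (1 - α) = 1 := by
            rw [← Real.rpow_add hlt]; simp
          have h3 : z ^ (α - 1) * z ^ (1 - α) = 1 := by
            rw [← Real.rpow_add hz]; simp
          rw [← hm t ht]
          have e : γ t * Real.exp (-l t * z) = γ t * (l t ^ (α - 1) * Real.Gamma (1 - α))
              * (z ^ (α - 1) / Real.Gamma (1 - α))
              * (l t ^ (1 - α) * z ^ (1 - α) * Real.exp (-(l t * z))) := by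
            rw [neg_mul]
            field_simp
            linear_combination (-γ t) * (h2 * z ^ (α - 1) * z ^ (1 - α) + h3)
          rw [e]
          refine mul_le_of_le_one_right ?_ h1
          have := hγn t
          positivity
      have hlim : Tendsto (fun t => m t * (z ^ (α - 1) / Real.Gamma (1 - α))) (𝓝 0) (𝓝 0) := by
        simpa [hm0] using (hmc.tendsto 0).mul_const (z ^ (α - 1) / Real.Gamma (1 - α))
      have := squeeze_zero (f := fun t => γ t * Real.exp (-l t * z))
        (fun t => mul_nonneg (hγn t) (Real.exp_pos _).le) hb hlim
      simpa [ContinuousAt, hγ0] using this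
    · have h1 := hγc.continuousAt (Ioi_mem_nhds ht)
      have h2 := hlc.continuousAt (Ioi_mem_nhds ht)
      fun_prop
  · simp_rw [hden]
    rcases eq_zero_or_pos t with rfl | ht
    · simp [hγ0]
    · exact (integrableOn_mul_tsDensity hα (hl t ht)).const_mul _
  · have : (fun t => ∫ z in Set.Ioi (0 : ℝ), z * (z ^ (-1 - α) * (γ t * Real.exp (-l t * z))))
        = m := by
      ext t
      simp_rw [hden, integral_const_mul]
      rcases eq_zero_or_pos t with rfl | ht
      · simp [hγ0, hm0]
      · rw [integral_mul_tsDensity hα (hl t ht), hm t ht]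
    rw [this]
    exact hmc

/-- The Laplace transform of the sum of jumps with tempered stable levels. -/
lemma integral_exp_neg_jumpSum_tempered {α : ℝ} {γ l : ℝ≥0 → ℝ}
    (h : IsJumpLevel (fun z => z ^ (-1 - α)) fun t z => γ t * Real.exp (-l t * z))
    {c : ℕ → ℝ≥0} {q : ℕ → Measure (ℝ × ℝ)} [∀ n, IsProbabilityMeasure (q n)]
    (hcq : pointIntensity c q = jumpIntensity fun z => z ^ (-1 - α)) (t : ℝ≥0) {w : ℂ}
    (hw : 0 ≤ w.re) :
    ∫ ω, Complex.exp (-(w * (jumpSum (fun t z => γ t * Real.exp (-l t * z)) t ω : ℝ)))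
      ∂(pointLaw c q) = Complex.exp (-(γ t * tsExponent α (l t) w)) := by
  rw [h.integral_exp_neg_jumpSum hcq t hw, tsExponent, ← integral_const_mul]
  congr 2
  refine integral_congr_ae (ae_of_all _ fun z => ?_)
  simp only [tsDensity]
  push_cast
  ring

/-- Past the tempering, e^{(κ-l)z} z^{-1-α} tends to infinity. Once it is at least 2, the term from
the subtracted 1 costs at most 1, and the integrand stays above γ on a half-line. -/
lemma setLIntegral_exp_sub_one_eq_top {α γ l κ : ℝ} (hα0 : 0 ≤ α) (hγ : 0 < γ) (hl : 0 < l)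
    (hκ : l < κ) :
    ∫⁻ z in Set.Ioi (0 : ℝ), ENNReal.ofReal (z ^ (-1 - α) * (γ * Real.exp (-l * z))) *
      ENNReal.ofReal (Real.exp (κ * z) - 1) = ⊤ := by
  have h1 := (tendsto_exp_mul_div_rpow_atTop (1 + α) (κ - l) (by linarith)).eventually_ge_atTop 2
  obtain ⟨N, hN⟩ := eventually_atTop.1 h1
  set M : ℝ := max N 1 with hM
  have hle : ∫⁻ _ in Set.Ioi M, ENNReal.ofReal γ ≤
      ∫⁻ z in Set.Ioi (0 : ℝ), ENNReal.ofReal (z ^ (-1 - α) * (γ * Real.exp (-l * z))) *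
      ENNReal.ofReal (Real.exp (κ * z) - 1) := by
    refine le_trans ?_ (lintegral_mono_set (Set.Ioi_subset_Ioi (by positivity : (0 : ℝ) ≤ M)))
    refine setLIntegral_mono' measurableSet_Ioi fun z (hz : M < z) => ?_
    have hz1 : 1 < z := (le_max_right _ _).trans_lt hz
    have hz0 : 0 < z := by linarith
    rw [← ENNReal.ofReal_mul (by positivity)]
    refine ENNReal.ofReal_le_ofReal ?_
    have h2 := hN z ((le_max_left _ _).trans hz.le)
    have e1 : Real.exp ((κ - l) * z) / z ^ (1 + α)
        = z ^ (-1 - α) * (Real.exp (-l * z) * Real.exp (κ * z)) := by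
      rw [div_eq_mul_inv, ← Real.rpow_neg hz0.le, ← Real.exp_add, mul_comm]
      ring_nf
    rw [e1] at h2
    have h3 : z ^ (-1 - α) * Real.exp (-l * z) ≤ 1 * 1 := by
      have a1 : z ^ (-1 - α) ≤ 1 := Real.rpow_le_one_of_one_le_of_nonpos hz1.le (by linarith)
      have a2 : Real.exp (-l * z) ≤ 1 := Real.exp_le_one_iff.2 (by nlinarith)
      gcongr
    nlinarith
  refine top_le_iff.1 (le_trans ?_ hle)
  simp [hγ]

/-- The tempered stable law with activity `γ` and tempering `l`. -/
theorem exists_temperedStableLaw {α γ l : ℝ} (hα0 : 0 ≤ α) (hα : α < 1) (hγ : 0 ≤ γ)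
    (hl : 0 < l) :
    ∃ μ : Measure ℝ≥0, IsProbabilityMeasure μ ∧
      (∀ w : ℂ, 0 ≤ w.re → ∫ z, Complex.exp (-(w * (z : ℝ))) ∂μ
        = Complex.exp (-(γ * tsExponent α l w))) ∧
      (0 < γ → ∀ κ, l < κ → ∫⁻ z, ENNReal.ofReal (Real.exp (κ * z)) ∂μ = ⊤) := by
  have hg := isJumpLevel_tempered (α := α) hα0 hα (γ := fun t => t * γ) (l := fun _ => l)
    (m := fun t => t * γ * (l ^ (α - 1) * Real.Gamma (1 - α))) (by simp)
    (fun t _ => mul_nonneg t.2 hγ) (fun _ _ => hl)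
    (fun s _ t _ hst => mul_le_mul_of_nonneg_right hst hγ) antitoneOn_const
    (by fun_prop) continuousOn_const (by fun_prop) (by simp) (fun t _ => rfl)
  obtain ⟨c, q, hq, hcq⟩ := exists_pointIntensity_eq (jumpIntensity fun z => z ^ (-1 - α))
  have hm := hg.measurable_jumpSum (1 : ℝ≥0)
  refine ⟨(pointLaw c q).map (jumpSum (fun t z => t * γ * Real.exp (-l * z)) 1),
    Measure.isProbabilityMeasure_map hm.aemeasurable, fun w hw => ?_, fun hγ0 κ hκ => ?_⟩
  · rw [integral_map hm.aemeasurable (by fun_prop)]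
    have := integral_exp_neg_jumpSum_tempered hg hcq 1 hw
    simpa using this
  · rw [lintegral_map (by fun_prop) hm]
    have := hg.lintegral_exp_sub_one_le_jumpSum hcq 1 (κ := κ) (by linarith)
    simp only [NNReal.coe_one, one_mul] at this
    rw [setLIntegral_exp_sub_one_eq_top hα0 hγ0 hl hκ] at this
    exact top_le_iff.1 this

/-- On the imaginary axis the Laplace transform is the characteristic function, which determines the
law. -/
lemma lintegral_eq_of_laplace_eq {μ ν : Measure ℝ≥0} [IsProbabilityMeasure μ]
    [IsProbabilityMeasure ν] (h : ∀ w : ℂ, 0 ≤ w.re → ∫ z, Complex.exp (-(w * (z : ℝ))) ∂μ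
      = ∫ z, Complex.exp (-(w * (z : ℝ))) ∂ν) {F : ℝ → ENNReal} (hF : Measurable F) :
    ∫⁻ z, F z ∂μ = ∫⁻ z, F z ∂ν := by
  have hc : Measurable fun z : ℝ≥0 => (z : ℝ) := measurable_coe_nnreal_real
  have i1 := Measure.isProbabilityMeasure_map (μ := μ) hc.aemeasurable
  have i2 := Measure.isProbabilityMeasure_map (μ := ν) hc.aemeasurable
  have e : μ.map (fun z : ℝ≥0 => (z : ℝ)) = ν.map (fun z : ℝ≥0 => (z : ℝ)) := by
    refine Measure.ext_of_charFun (funext fun u => ?_)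
    rw [charFun_apply_real, charFun_apply_real, integral_map hc.aemeasurable (by fun_prop),
      integral_map hc.aemeasurable (by fun_prop)]
    have := h (-(u * Complex.I)) (by simp)
    convert this using 4 <;> ring
  rw [← lintegral_map hF hc, e, lintegral_map hF hc]

/-- Exponential tilting, pointwise under the integral: e^{-(l-κ)z}(e^{-κz} - e^{-(w+κ)z}) =
e^{-lz}(1 - e^{-wz}). -/
lemma tsExponent_add_sub {α l κ : ℝ} (hα : α < 1) (hκ : 0 ≤ κ) (hκl : κ < l) {w : ℂ}
    (hw : 0 ≤ w.re) :
    tsExponent α (l - κ) (w + κ) - tsExponent α (l - κ) κ = tsExponent α l w := by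
  have hlκ : 0 < l - κ := by linarith
  unfold tsExponent
  rw [← integral_sub (integrableOn_tsExponent hα hlκ (by simpa using add_nonneg hw hκ))
    (integrableOn_tsExponent hα hlκ (by simpa using hκ))]
  refine integral_congr_ae (ae_of_all _ fun z => ?_)
  simp only [tsDensity]
  have e1 : Complex.exp (-((w + κ) * z)) = Complex.exp (-(w * z)) * Complex.exp (-(κ * z)) := by
    rw [← Complex.exp_add]; ring_nf
  have e2 : Complex.exp (-(l - κ : ℝ) * z)
      = Complex.exp (-l * z) * Complex.exp (κ * z) := by
    rw [← Complex.exp_add]; push_cast; ring_nf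
  have e3 : Complex.exp (-(κ * z)) * Complex.exp (κ * z) = 1 := by
    rw [← Complex.exp_add]; simp
  push_cast at e2 ⊢
  rw [e1, e2]
  linear_combination ((1 - Complex.exp (-(w * z))) * ((z ^ (-1 - α) : ℝ) : ℂ)
    * Complex.exp (-l * z)) * e3

/-- A tempered stable law with tempering `l` has exponential moments up to `l`. -/
theorem lintegral_exp_lt_top {α γ l κ : ℝ} (hα0 : 0 ≤ α) (hα : α < 1) (hγ : 0 ≤ γ)
    (hκ : 0 ≤ κ) (hκl : κ < l) {μ : Measure ℝ≥0} [IsProbabilityMeasure μ]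
    (hμ : ∀ w : ℂ, 0 ≤ w.re → ∫ z, Complex.exp (-(w * (z : ℝ))) ∂μ
      = Complex.exp (-(γ * tsExponent α l w))) :
    ∫⁻ z, ENNReal.ofReal (Real.exp (κ * z)) ∂μ < ⊤ := by
  -- The law with tempering l - κ, tilted by e^{-κz}, has the Laplace transform of μ. Under the
  -- tilted law the weight cancels e^{κz}, so the moment is the inverse of the normalising constant.
  obtain ⟨μ', hprob, hL, -⟩ := exists_temperedStableLaw hα0 hα hγ (l := l - κ) (by linarith)
  set f : ℝ≥0 → ℝ := fun z => -(κ * z) with hf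
  have hfm : Measurable f := by fun_prop
  have hInt : Integrable (fun z => Real.exp (f z)) μ' := by
    refine Integrable.of_bound (by fun_prop) 1 (ae_of_all _ fun z => ?_)
    rw [Real.norm_eq_abs, Real.abs_exp]
    exact Real.exp_le_one_iff.2 (neg_nonpos.2 (mul_nonneg hκ z.2))
  have hprob' := isProbabilityMeasure_tilted hInt
  have hE : ((∫ z, Real.exp (f z) ∂μ' : ℝ) : ℂ)
      = Complex.exp (-(γ * tsExponent α (l - κ) κ)) := by
    rw [← hL κ (by simpa using hκ), ← integral_complex_ofReal]
    congr 1
    ext z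
    simp [hf]
  have hE0 : 0 < ∫ z, Real.exp (f z) ∂μ' := integral_exp_pos hInt
  have key : ∫⁻ z, ENNReal.ofReal (Real.exp (κ * z)) ∂μ
      = ∫⁻ z, ENNReal.ofReal (Real.exp (κ * z)) ∂(μ'.tilted f) := by
    refine lintegral_eq_of_laplace_eq (F := fun x => ENNReal.ofReal (Real.exp (κ * x)))
      (fun w hw => ?_) (by fun_prop)
    rw [hμ w hw, integral_tilted]
    have e : ∀ z : ℝ≥0, (Real.exp (f z) / ∫ x, Real.exp (f x) ∂μ') • Complex.exp (-(w * (z : ℝ)))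
        = Complex.exp (-((w + κ) * (z : ℝ))) * ((∫ x, Real.exp (f x) ∂μ' : ℝ) : ℂ)⁻¹ := by
      intro z
      rw [Complex.real_smul, Complex.ofReal_div, Complex.ofReal_exp, hf, div_mul_eq_mul_div,
        ← Complex.exp_add, div_eq_mul_inv]
      congr 2
      push_cast
      ring
    simp_rw [e]
    rw [integral_mul_const, hL _ (by simpa using add_nonneg hw hκ), hE, ← Complex.exp_neg,
      ← Complex.exp_add, ← tsExponent_add_sub hα hκ hκl hw]
    congr 1
    ring
  rw [key, lintegral_tilted]
  have e : ∀ z : ℝ≥0, ENNReal.ofReal (Real.exp (f z) / ∫ x, Real.exp (f x) ∂μ') *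
      ENNReal.ofReal (Real.exp (κ * z)) = ENNReal.ofReal (∫ x, Real.exp (f x) ∂μ')⁻¹ := by
    intro z
    rw [← ENNReal.ofReal_mul (by positivity), div_mul_eq_mul_div, ← Real.exp_add, hf]
    simp
  simp_rw [e]
  simp

end TemperedStableLaw

/-! ### Monotone tempering and activity from admissibility -/

section Monotonicity

lemma lintegral_exp_gaussianReal (y : ℝ) :
    ∫⁻ x, ENNReal.ofReal (Real.exp (y * x)) ∂(gaussianReal 0 1)
      = ENNReal.ofReal (Real.exp (y ^ 2 / 2)) := by
  have h := mgf_gaussianReal (p := gaussianReal 0 1) (X := id) (by rw [Measure.map_id]) y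
  rw [← ofReal_integral_eq_lintegral_ofReal (integrable_exp_mul_gaussianReal y)
    (ae_of_all _ fun x => (Real.exp_pos _).le)]
  simp only [mgf, id] at h
  rw [h]
  simp

/-- The exponential moments of a normal mean-variance mixture. -/
theorem lintegral_exp_normal_mixture {ν : Measure ℝ} [IsProbabilityMeasure ν] {μ : Measure ℝ≥0}
    [IsProbabilityMeasure μ] {θ c : ℝ}
    (h : ∀ u : ℝ, charFun ν u
      = (∫ z, Complex.exp (-((u ^ 2 / 2 + Complex.I * u * θ) * (z : ℝ))) ∂μ)
        * Complex.exp (Complex.I * u * c)) (y : ℝ) :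
    ∫⁻ x, ENNReal.ofReal (Real.exp (y * x)) ∂ν
      = ENNReal.ofReal (Real.exp (y * c)) *
        ∫⁻ z, ENNReal.ofReal (Real.exp ((y ^ 2 / 2 - θ * y) * z)) ∂μ := by
  -- The mixture is realised on a product space: given z, this is Gaussian with variance z and mean
  -- c - θz.
  set X : ℝ × ℝ≥0 → ℝ := fun p => √(p.2 : ℝ) * p.1 - θ * p.2 + c with hX
  have hXm : Measurable X := by fun_prop
  have hν : ν = ((gaussianReal 0 1).prod μ).map X := by
    have := Measure.isProbabilityMeasure_map (μ := (gaussianReal 0 1).prod μ) hXm.aemeasurable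
    refine Measure.ext_of_charFun (funext fun u => ?_)
    rw [h u, charFun_apply_real, integral_map hXm.aemeasurable (by fun_prop),
      integral_prod_symm _ (Integrable.of_bound (by fun_prop) 1 (ae_of_all _ fun p => by
        have := norm_cexp_real_mul_I (u * X p)
        simpa using this)), ← integral_mul_const]
    refine integral_congr_ae (ae_of_all _ fun z => ?_)
    have e : ∀ x : ℝ, Complex.exp (u * (X (x, z) : ℝ) * Complex.I)
        = Complex.exp ((u * √(z : ℝ) : ℝ) * x * Complex.I)
          * Complex.exp (-(Complex.I * u * θ * (z : ℝ)) + Complex.I * u * c) := by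
      intro x
      rw [← Complex.exp_add]
      congr 1
      simp only [hX]
      push_cast
      ring
    have hg := charFun_gaussianReal (μ := 0) (v := 1) (u * √(z : ℝ))
    rw [charFun_apply_real] at hg
    simp only [e]
    rw [integral_mul_const, hg, ← Complex.exp_add, ← Complex.exp_add]
    congr 1
    have hs : ((√(z : ℝ) : ℝ) : ℂ) ^ 2 = ((z : ℝ) : ℂ) := by
      exact_mod_cast Real.sq_sqrt z.2
    push_cast
    linear_combination ((u : ℂ) ^ 2 / 2) * hs
  rw [hν, lintegral_map (by fun_prop) hXm, lintegral_prod_symm _ (by fun_prop),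
    ← lintegral_const_mul _ (by fun_prop)]
  refine lintegral_congr fun z => ?_
  have e : ∀ x : ℝ, ENNReal.ofReal (Real.exp (y * X (x, z)))
      = ENNReal.ofReal (Real.exp (y * c - θ * y * z)) *
        ENNReal.ofReal (Real.exp ((y * √(z : ℝ)) * x)) := by
    intro x
    rw [← ENNReal.ofReal_mul (Real.exp_pos _).le, ← Real.exp_add]
    congr 2
    simp only [hX]
    ring
  simp only [e]
  rw [lintegral_const_mul _ (by fun_prop), lintegral_exp_gaussianReal,
    ← ENNReal.ofReal_mul (Real.exp_pos _).le, ← ENNReal.ofReal_mul (Real.exp_pos _).le,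
    ← Real.exp_add, ← Real.exp_add, mul_pow, Real.sq_sqrt z.coe_nonneg]
  congr 2
  ring

lemma re_one_sub_exp_neg_ge {w : ℂ} {z : ℝ} :
    1 - Real.exp (-(w.re * z)) ≤ (1 - Complex.exp (-(w * z))).re := by
  have := Complex.re_le_norm (Complex.exp (-(w * z)))
  rw [Complex.norm_exp] at this
  simp only [Complex.sub_re, Complex.one_re]
  simp only [Complex.neg_re, Complex.re_mul_ofReal] at this
  linarith

/-- Since |e^{-wz}| = e^{-z Re w}, replacing w by its real part can only lower the real part of the
integrand. -/
lemma re_tsExponent_mono {α l : ℝ} (hα : α < 1) (hl : 0 < l) {w : ℂ} (hw : 0 ≤ w.re) :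
    (tsExponent α l w.re).re ≤ (tsExponent α l w).re := by
  have i1 := integrableOn_tsExponent hα hl (w := (w.re : ℂ)) (by simpa using hw)
  have i2 := integrableOn_tsExponent hα hl hw
  unfold tsExponent
  have e1 := integral_re i1
  have e2 := integral_re i2
  simp only [RCLike.re_to_complex] at e1 e2
  rw [← e1, ← e2]
  refine setIntegral_mono_on i1.re i2.re measurableSet_Ioi fun z hz => ?_
  simp only [Complex.re_mul_ofReal]
  refine mul_le_mul_of_nonneg_right ?_ (tsDensity_nonneg α l hz)
  refine le_trans (le_of_eq ?_) re_one_sub_exp_neg_ge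
  have : Complex.exp (-(w.re * z)) = (Real.exp (-(w.re * z)) : ℝ) := by push_cast; rfl
  rw [this, Complex.sub_re, Complex.ofReal_re, Complex.one_re]

lemma tendsto_re_tsExponent {α l : ℝ} (hα0 : 0 ≤ α) (hα : α < 1) (hl : 0 < l) :
    Tendsto (fun x : ℝ => (tsExponent α l x).re) atTop atTop := by
  have hlx : Tendsto (fun x : ℝ => l + x) atTop atTop := tendsto_atTop_add_const_left _ _ tendsto_id
  rcases hα0.eq_or_lt with rfl | hα0
  · have h : Tendsto (fun x : ℝ => Real.log (l + x) - Real.log l) atTop atTop :=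
      tendsto_atTop_add_const_right _ _ (Real.tendsto_log_atTop.comp hlx)
    refine h.congr' ?_
    filter_upwards [eventually_ge_atTop 0] with x hx
    rw [tsExponent_zero_eq hl (by simpa using hx), ← Complex.ofReal_add,
      ← Complex.ofReal_log (by linarith), ← Complex.ofReal_log hl.le, ← Complex.ofReal_sub,
      Complex.ofReal_re]
  · have hG : 0 < Real.Gamma (1 - α) / α :=
      div_pos (Real.Gamma_pos_of_pos (by linarith)) hα0
    have h : Tendsto (fun x : ℝ => Real.Gamma (1 - α) / α * ((l + x) ^ α - l ^ α)) atTop atTop :=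
      (tendsto_atTop_add_const_right _ _ ((tendsto_rpow_atTop hα0).comp hlx)).const_mul_atTop hG
    refine h.congr' ?_
    filter_upwards [eventually_ge_atTop 0] with x hx
    rw [tsExponent_eq hα0 hα hl (by simpa using hx), ← Complex.ofReal_add,
      ← Complex.ofReal_cpow (by linarith), ← Complex.ofReal_cpow hl.le, ← Complex.ofReal_sub,
      ← Complex.ofReal_div, ← Complex.ofReal_mul, Complex.ofReal_re]

/-- Laplace exponents with different temperings differ by a bounded function. -/
lemma exists_norm_tsExponent_sub_le {α l l' : ℝ} (hα : α < 1) (hl : 0 < l) (hll : l ≤ l') :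
    ∃ C : ℝ, ∀ w : ℂ, 0 ≤ w.re → ‖tsExponent α l w - tsExponent α l' w‖ ≤ C := by
  -- The densities differ by at most (l' - l)z times the larger one, because 1 - e^{-x} ≤ x; the
  -- factor 2 bounds |1 - e^{-wz}| uniformly in w.
  refine ⟨∫ z in Set.Ioi (0 : ℝ), 2 * (l' - l) * (z * tsDensity α l z), fun w hw => ?_⟩
  unfold tsExponent
  rw [← integral_sub (integrableOn_tsExponent hα hl hw)
    (integrableOn_tsExponent hα (hl.trans_le hll) hw)]
  refine norm_integral_le_of_norm_le ((integrableOn_mul_tsDensity hα hl).const_mul _) ?_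
  refine (ae_restrict_mem measurableSet_Ioi).mono fun z (hz : 0 < z) => ?_
  rw [← mul_sub, ← Complex.ofReal_sub, norm_mul, Complex.norm_real]
  have h1 : ‖1 - Complex.exp (-(w * z))‖ ≤ 2 := by
    refine (norm_sub_le _ _).trans ?_
    rw [norm_one, Complex.norm_exp]
    have : Real.exp (-(w * z)).re ≤ 1 := Real.exp_le_one_iff.2 (by simpa using mul_nonneg hw hz.le)
    linarith
  have h2 : tsDensity α l' z = tsDensity α l z * Real.exp (-((l' - l) * z)) := by
    unfold tsDensity
    rw [mul_assoc, ← Real.exp_add]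
    ring_nf
  have h3 := Real.add_one_le_exp (-((l' - l) * z))
  have h4 : Real.exp (-((l' - l) * z)) ≤ 1 :=
    Real.exp_le_one_iff.2 (by nlinarith)
  have h5 := tsDensity_nonneg α l hz
  rw [h2, Real.norm_eq_abs, abs_of_nonneg (by nlinarith)]
  calc ‖1 - Complex.exp (-(w * z))‖ * (tsDensity α l z - tsDensity α l z *
        Real.exp (-((l' - l) * z)))
      ≤ 2 * (tsDensity α l z * ((l' - l) * z)) := by
        refine mul_le_mul h1 (by nlinarith) (by nlinarith) (by norm_num)
    _ = 2 * (l' - l) * (z * tsDensity α l z) := by ring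

lemma re_normal_exponent (u θ : ℝ) : ((u : ℂ) ^ 2 / 2 + Complex.I * u * θ).re = u ^ 2 / 2 := by
  have : (u : ℂ) ^ 2 / 2 + Complex.I * u * θ
      = ((u ^ 2 / 2 : ℝ) : ℂ) + ((u * θ : ℝ) : ℂ) * Complex.I := by
    push_cast; ring
  rw [this, Complex.add_re, Complex.ofReal_re, Complex.re_ofReal_mul]
  simp

variable {Ω : Type*} [MeasurableSpace Ω] {P : Measure Ω} {α : ℝ}
  {σ k η φ : ℝ≥0 → ℝ} {f : ℝ≥0 → Ω → ℝ}

lemma atsCharFun_eq (hparam : IsATSParameters α σ k η φ) {t : ℝ≥0} (ht : 0 < t) (u : ℝ) :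
    atsCharFun α σ k η φ t u
      = Complex.exp (-(atsActivity α t (σ t) (k t) * tsExponent α (atsTempering α (σ t) (k t))
          (u ^ 2 / 2 + Complex.I * u * (1 / 2 + η t : ℝ))))
        * Complex.exp (Complex.I * u * (φ t * (t : ℝ) : ℝ)) := by
  have hre : 0 ≤ ((u : ℂ) ^ 2 / 2 + Complex.I * u * (1 / 2 + η t : ℝ)).re := by
    rw [re_normal_exponent]
    positivity
  rw [atsCharFun, ← logLaplaceTS_eq hparam.alpha_nonneg hparam.alpha_lt_one (hparam.sigma_pos t)
    (hparam.k_pos t ht) hre]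
  congr 3
  push_cast
  ring

/-- The characteristic function alone yields the mixing law, so exponential moments of f_t at y
become moments of that law at y²/2 - (1/2 + η_t)y, with critical value l_t. -/
lemma IsATS.exists_mixture [IsProbabilityMeasure P] (hparam : IsATSParameters α σ k η φ)
    (hf : IsATS P α σ k η φ f) {t : ℝ≥0} (ht : 0 < t) :
    ∃ μ : Measure ℝ≥0, IsProbabilityMeasure μ ∧
      (∀ w : ℂ, 0 ≤ w.re → ∫ z, Complex.exp (-(w * (z : ℝ))) ∂μ
        = Complex.exp (-(atsActivity α t (σ t) (k t)
          * tsExponent α (atsTempering α (σ t) (k t)) w))) ∧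
      (∀ κ, atsTempering α (σ t) (k t) < κ → ∫⁻ z, ENNReal.ofReal (Real.exp (κ * z)) ∂μ = ⊤) ∧
      ∀ y : ℝ, ∫⁻ ω, ENNReal.ofReal (Real.exp (y * f t ω)) ∂P
        = ENNReal.ofReal (Real.exp (y * (φ t * t))) *
          ∫⁻ z, ENNReal.ofReal (Real.exp ((y ^ 2 / 2 - (1 / 2 + η t) * y) * z)) ∂μ := by
  have hα := hparam.alpha_lt_one
  have hl := atsTempering_pos hα (hparam.sigma_pos t) (hparam.k_pos t ht)
  have hγ := atsActivity_pos hα (t := t) ht (hparam.sigma_pos t) (hparam.k_pos t ht)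
  obtain ⟨μ, hμ, hL, htop⟩ := exists_temperedStableLaw hparam.alpha_nonneg hα hγ.le hl
  refine ⟨μ, hμ, hL, htop hγ, fun y => ?_⟩
  have hm := hf.additive.measurable t
  have := Measure.isProbabilityMeasure_map (μ := P) hm.aemeasurable
  rw [← lintegral_exp_normal_mixture (ν := P.map (f t)) (fun u => ?_) y,
    lintegral_map (by fun_prop) hm]
  rw [hf.charFun_eq t ht, atsCharFun_eq hparam ht, hL]
  rw [re_normal_exponent]
  positivity

lemma IsATS.indepFun (hf : IsATS P α σ k η φ f) {s t : ℝ≥0} (hst : s ≤ t) :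
    IndepFun (f s) (fun ω => f t ω - f s ω) P :=
  hf.additive.indep.indepFun_eval_sub bot_le hst hf.additive.zero_ae

/-- For constant `η`, the tempering of an admissible ATS is nonincreasing. -/
theorem IsATS.antitoneOn_tempering [IsProbabilityMeasure P] (hparam : IsATSParameters α σ k η φ)
    (hf : IsATS P α σ k η φ f) {c : ℝ} (hη : ∀ t, 0 < t → η t = c) :
    AntitoneOn (fun t => atsTempering α (σ t) (k t)) (Set.Ioi 0) := by
  intro s hs t ht hst
  simp only [Set.mem_Ioi] at hs ht
  by_contra! hlt
  have hα := hparam.alpha_lt_one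
  have hls := atsTempering_pos hα (hparam.sigma_pos s) (hparam.k_pos s hs)
  -- With l_s < κ < l_t, the moment at s is infinite and the one at t is finite.
  obtain ⟨κ, h1, h2⟩ := exists_between hlt
  obtain ⟨μ, hμ, -, htop, hexp⟩ := hf.exists_mixture hparam hs
  obtain ⟨μ', hμ', hL', -, hexp'⟩ := hf.exists_mixture hparam ht
  have hfin := lintegral_exp_lt_top hparam.alpha_nonneg hα
    (atsActivity_pos hα (t := t) ht (hparam.sigma_pos t) (hparam.k_pos t ht)).le (by linarith)
    h2 hL'
  set θ : ℝ := 1 / 2 + c with hθ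
  -- The larger root of y²/2 - θy = κ. It serves both times because η takes the same value at s and
  -- t.
  set y : ℝ := θ + √(θ ^ 2 + 2 * κ) with hy
  have hyκ : y ^ 2 / 2 - θ * y = κ := by
    have := Real.sq_sqrt (show 0 ≤ θ ^ 2 + 2 * κ by nlinarith [sq_nonneg θ])
    rw [hy]
    linear_combination this / 2
  have e1 := hexp y
  have e2 := hexp' y
  rw [hη s hs, ← hθ, hyκ, htop κ h1, ENNReal.mul_top (by simp [Real.exp_pos])] at e1
  rw [hη t ht, ← hθ, hyκ] at e2
  have hms := hf.additive.measurable s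
  have hmt := hf.additive.measurable t
  have hind : IndepFun (fun ω => ENNReal.ofReal (Real.exp (y * f s ω)))
      (fun ω => ENNReal.ofReal (Real.exp (y * (f t ω - f s ω)))) P :=
    (hf.indepFun hst).comp (φ := fun x => ENNReal.ofReal (Real.exp (y * x)))
      (ψ := fun x => ENNReal.ofReal (Real.exp (y * x))) (by fun_prop) (by fun_prop)
  have hprod := lintegral_mul_eq_lintegral_mul_lintegral_of_indepFun''
    (Measurable.aemeasurable (by fun_prop)) (Measurable.aemeasurable (by fun_prop)) hind
  have e3 : ∀ ω, ENNReal.ofReal (Real.exp (y * f s ω)) *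
      ENNReal.ofReal (Real.exp (y * (f t ω - f s ω))) = ENNReal.ofReal (Real.exp (y * f t ω)) := by
    intro ω
    rw [← ENNReal.ofReal_mul (Real.exp_pos _).le, ← Real.exp_add]
    ring_nf
  simp_rw [e3] at hprod
  -- The moment of the increment may be infinite; only 0 · ∞ has to be excluded.
  have hpos : ∫⁻ ω, ENNReal.ofReal (Real.exp (y * (f t ω - f s ω))) ∂P ≠ 0 := by
    intro h0
    rw [lintegral_eq_zero_iff (by fun_prop)] at h0
    obtain ⟨ω, hω⟩ := h0.exists
    simp only [Pi.zero_apply, ENNReal.ofReal_eq_zero] at hω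
    exact absurd (Real.exp_pos _) (not_lt.2 hω)
  rw [e1, ENNReal.top_mul hpos, e2] at hprod
  exact (ENNReal.mul_lt_top ENNReal.ofReal_lt_top hfin).ne hprod

/-- For constant `η`, the activity of an admissible ATS is nondecreasing. -/
theorem IsATS.monotoneOn_activity [IsProbabilityMeasure P] (hparam : IsATSParameters α σ k η φ)
    (hf : IsATS P α σ k η φ f) {c : ℝ} (hη : ∀ t, 0 < t → η t = c) :
    MonotoneOn (fun t : ℝ≥0 => atsActivity α t (σ t) (k t)) (Set.Ioi 0) := by
  intro s hs t ht hst
  have hla := hf.antitoneOn_tempering hparam hη hs ht hst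
  simp only [Set.mem_Ioi] at hs ht hla
  have hα := hparam.alpha_lt_one
  have hls := atsTempering_pos hα (hparam.sigma_pos s) (hparam.k_pos s hs)
  have hlt := atsTempering_pos hα (hparam.sigma_pos t) (hparam.k_pos t ht)
  have hγt := (atsActivity_pos hα (t := t) ht (hparam.sigma_pos t) (hparam.k_pos t ht)).le
  obtain ⟨C, hC⟩ := exists_norm_tsExponent_sub_le hα hlt hla
  set ls := atsTempering α (σ s) (k s)
  set lt := atsTempering α (σ t) (k t)
  set γs := atsActivity α s (σ s) (k s)
  set γt := atsActivity α t (σ t) (k t)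
  set θ : ℝ := 1 / 2 + c with hθ
  have hms := hf.additive.measurable s
  have hmt := hf.additive.measurable t
  set w : ℝ → ℂ := fun u => u ^ 2 / 2 + Complex.I * u * θ with hw
  have hre : ∀ u : ℝ, (w u).re = u ^ 2 / 2 := fun u => re_normal_exponent u θ
  have hre0 : ∀ u : ℝ, 0 ≤ (w u).re := fun u => by rw [hre]; positivity
  have hnorm : ∀ r : ℝ≥0, 0 < r → ∀ u : ℝ, ‖charFun (P.map (f r)) u‖
      = Real.exp (-(atsActivity α r (σ r) (k r) *
        (tsExponent α (atsTempering α (σ r) (k r)) (w u)).re)) := by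
    intro r hr u
    rw [hf.charFun_eq r hr, atsCharFun_eq hparam hr, hη r hr, norm_mul, Complex.norm_exp,
      Complex.norm_exp]
    simp [hw, hθ]
  have hle : ∀ u : ℝ, γs * (tsExponent α ls (w u)).re ≤ γt * (tsExponent α lt (w u)).re := by
    intro u
    have hch := (hf.indepFun hst).charFun_map_fun_add_eq_mul hms.aemeasurable
      (hmt.sub hms).aemeasurable
    have e : (fun ω => f s ω + (f t - f s) ω) = f t := by ext ω; simp
    rw [e] at hch
    have h1 : ‖charFun (P.map (f t)) u‖ ≤ ‖charFun (P.map (f s)) u‖ := by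
      have := Measure.isProbabilityMeasure_map (μ := P) (hmt.sub hms).aemeasurable
      rw [hch, Pi.mul_apply, norm_mul]
      exact mul_le_of_le_one_right (norm_nonneg _) (norm_charFun_le_one _)
    rw [hnorm s hs, hnorm t ht, Real.exp_le_exp] at h1
    linarith
  -- Replacing the exponent at t by the one at s costs at most C. As Re Ψ_{l_s} is unbounded along
  -- w(u), this contradicts γ_s > γ_t.
  have hbound : ∀ u : ℝ, (γs - γt) * (tsExponent α ls (w u)).re ≤ γt * C := by
    intro u
    have h1 := (Complex.re_le_norm _).trans (hC (w u) (hre0 u))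
    rw [Complex.sub_re] at h1
    have h2 := mul_le_mul_of_nonneg_left h1 hγt
    have h3 := hle u
    linarith
  simp only
  by_contra! hgt
  have hR : Tendsto (fun u : ℝ => (tsExponent α ls (w u)).re) atTop atTop := by
    have h1 : Tendsto (fun u : ℝ => u ^ 2 / 2) atTop atTop :=
      (tendsto_pow_atTop two_ne_zero).atTop_div_const two_pos
    refine tendsto_atTop_mono (fun u => ?_)
      ((tendsto_re_tsExponent hparam.alpha_nonneg hα hls).comp h1)
    have := re_tsExponent_mono hα hls (hre0 u)
    rw [hre] at this
    exact this
  obtain ⟨u, hu⟩ := ((hR.const_mul_atTop (sub_pos.2 hgt)).eventually_gt_atTop (γt * C)).exists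
  exact absurd (hbound u) (not_le.2 hu)

end Monotonicity

/-! ### The drift is determined by one marginal -/

section Drift

/-- The primitive of `w ^ (α - 1)` on the slit plane. -/
noncomputable def powPrimitive (α : ℝ) (w : ℂ) : ℂ :=
  if α = 0 then Complex.log w else w ^ (α : ℂ) / α

lemma hasDerivAt_powPrimitive (α : ℝ) {w : ℂ} (hw : w ∈ Complex.slitPlane) :
    HasDerivAt (powPrimitive α) (w ^ ((α : ℂ) - 1)) w := by
  unfold powPrimitive
  split_ifs with h
  · simpa [h, Complex.cpow_neg_one] using Complex.hasDerivAt_log hw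
  · have hα : (α : ℂ) ≠ 0 := by exact_mod_cast h
    have := ((hasDerivAt_id w).cpow_const (c := (α : ℂ)) hw).div_const (α : ℂ)
    simpa [hα] using this

lemma tsExponent_eq_powPrimitive {α l : ℝ} (hα0 : 0 ≤ α) (hα : α < 1) (hl : 0 < l) {w : ℂ}
    (hw : 0 ≤ w.re) :
    tsExponent α l w = Real.Gamma (1 - α) * (powPrimitive α (l + w) - powPrimitive α l) := by
  rcases hα0.eq_or_lt with rfl | hα0
  · rw [tsExponent_zero_eq hl hw]
    simp [powPrimitive]
  · rw [tsExponent_eq hα0 hα hl hw]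
    simp only [powPrimitive, hα0.ne', if_false]
    ring

/-- The imaginary part vanishes near x, hence so does its derivative. Used twice, to pass from exp E
to E' and then to E''. -/
lemma im_eq_zero_of_hasDerivAt {f : ℝ → ℂ} {f' : ℂ} {x : ℝ} (hf : HasDerivAt f f' x)
    (h : ∀ᶠ y in 𝓝 x, (f y).im = 0) : f'.im = 0 := by
  have h1 : HasDerivAt (fun y => (f y).im) f'.im x := by
    have := Complex.imCLM.hasFDerivAt.comp_hasDerivAt x hf
    simpa [Function.comp_def] using this
  have h2 : HasDerivAt (fun y => (f y).im) 0 x :=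
    (hasDerivAt_const x (0 : ℝ)).congr_of_eventuallyEq h
  exact h1.unique h2

lemma im_eq_zero_of_mul {a b : ℂ} (ha : a.im = 0) (ha0 : a ≠ 0) (h : (a * b).im = 0) :
    b.im = 0 := by
  rw [Complex.mul_im, ha, zero_mul, add_zero] at h
  refine (mul_eq_zero.1 h).resolve_left fun h0 => ha0 ?_
  exact Complex.ext h0 ha

/-- For α ≥ 1/2 the first term is nonnegative and the second positive. For α < 1/2 the first is
negative and wins for large N: the addition formula and the concavity bound (1-α) sin ϑ ≤
sin((1-α)ϑ) keep the second below 2R sin((1-α)ϑ). -/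
lemma sin_combination_ne_zero {α R N ϑ : ℝ} (hα0 : 0 ≤ α) (hα : α < 1) (hR : 0 < R) (hN : 0 < N)
    (hNR : 2 * R < |1 - 2 * α| * N ∨ 1 ≤ 2 * α) (h0 : 0 < ϑ) (h1 : ϑ < Real.pi / 2) :
    (2 * α - 1) * N * Real.sin ((1 - α) * ϑ) + (1 - α) * R * Real.sin ((2 - α) * ϑ) ≠ 0 := by
  have hα1 : 0 < 1 - α := by linarith
  have hS1 : 0 < Real.sin ((1 - α) * ϑ) :=
    Real.sin_pos_of_pos_of_lt_pi (by positivity) (by nlinarith)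
  have hS2 : 0 < Real.sin ((2 - α) * ϑ) :=
    Real.sin_pos_of_pos_of_lt_pi (by nlinarith) (by nlinarith)
  by_cases h : 1 ≤ 2 * α
  · have : 0 ≤ (2 * α - 1) * N * Real.sin ((1 - α) * ϑ) :=
      mul_nonneg (mul_nonneg (by linarith) hN.le) hS1.le
    positivity
  · replace hNR := hNR.resolve_right h
    rw [abs_of_nonneg (by linarith)] at hNR
    have hS : 0 ≤ Real.sin ϑ := Real.sin_nonneg_of_nonneg_of_le_pi h0.le (by linarith)
    have hconc : (1 - α) * Real.sin ϑ ≤ Real.sin ((1 - α) * ϑ) := by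
      have := strictConcaveOn_sin_Icc.concaveOn.2 (x := 0) (y := ϑ) (by simp [Real.pi_pos.le])
        ⟨h0.le, by linarith⟩ hα0 hα1.le (by ring)
      simpa using this
    have hadd : Real.sin ((2 - α) * ϑ) ≤ Real.sin ((1 - α) * ϑ) + Real.sin ϑ := by
      have e : (2 - α) * ϑ = (1 - α) * ϑ + ϑ := by ring
      rw [e, Real.sin_add]
      have c1 := Real.cos_le_one ϑ
      have c2 := Real.cos_le_one ((1 - α) * ϑ)
      nlinarith
    have h2 : (1 - α) * R * Real.sin ((2 - α) * ϑ) ≤ 2 * R * Real.sin ((1 - α) * ϑ) := by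
      calc (1 - α) * R * Real.sin ((2 - α) * ϑ)
          ≤ (1 - α) * R * (Real.sin ((1 - α) * ϑ) + Real.sin ϑ) := by gcongr
        _ = R * ((1 - α) * Real.sin ((1 - α) * ϑ) + (1 - α) * Real.sin ϑ) := by ring
        _ ≤ R * (1 * Real.sin ((1 - α) * ϑ) + Real.sin ((1 - α) * ϑ)) := by
            gcongr
            linarith
        _ = 2 * R * Real.sin ((1 - α) * ϑ) := by ring
    have h3 := mul_lt_mul_of_pos_right hNR hS1
    intro h4
    linarith

/-- If the second derivative of a primitive power of a complex quadratic polynomial is real for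
large real arguments, then the polynomial is real. -/
lemma eq_zero_of_im_eq_zero {α R B v₀ : ℝ} (hα0 : 0 ≤ α) (hα : α < 1) (hR : 0 < R)
    (h : ∀ v : ℝ, v₀ < v → ((((v + B * Complex.I) ^ 2 + R) / 2) ^ ((α : ℂ) - 2) *
      (((α : ℂ) - 1) * (v + B * Complex.I) ^ 2 + ((v + B * Complex.I) ^ 2 + R) / 2)).im = 0) :
    B = 0 := by
  by_contra hB
  have htend : Tendsto (fun v : ℝ => |1 - 2 * α| * ((v ^ 2 - B ^ 2 + R) / 2)) atTop atTop ∨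
      1 ≤ 2 * α := by
    by_cases h1 : 1 ≤ 2 * α
    · exact Or.inr h1
    · refine Or.inl (Tendsto.const_mul_atTop (abs_pos.2 (by linarith)) ?_)
      have : Tendsto (fun v : ℝ => v ^ 2 + (R - B ^ 2)) atTop atTop :=
        tendsto_atTop_add_const_right _ _ (tendsto_pow_atTop two_ne_zero)
      refine (this.atTop_div_const two_pos).congr fun v => by ring
  have hev : ∀ᶠ v : ℝ in atTop,
      2 * R < |1 - 2 * α| * ((v ^ 2 - B ^ 2 + R) / 2) ∨ 1 ≤ 2 * α := by
    rcases htend with h1 | h1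
    · filter_upwards [h1.eventually_gt_atTop (2 * R)] with v hv using Or.inl hv
    · exact Eventually.of_forall fun _ => Or.inr h1
  -- v > |B| puts ρ in the right half-plane, so |arg ρ| < π/2; for α < 1/2, v is also so large that
  -- |ρ| dominates R.
  obtain ⟨v, hv1, hv2, hv3⟩ :=
    (hev.and ((eventually_gt_atTop v₀).and (eventually_gt_atTop |B|))).exists
  have hvB : B ^ 2 < v ^ 2 := by
    rw [← sq_abs B]
    have := abs_nonneg B
    nlinarith
  have hv0 : 0 < v := (abs_nonneg B).trans_lt hv3
  set ρ : ℂ := ((v + B * Complex.I) ^ 2 + R) / 2 with hρ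
  have hρ' : ρ = ((v ^ 2 - B ^ 2 + R) / 2 : ℝ) + (v * B : ℝ) * Complex.I := by
    rw [hρ]
    push_cast
    linear_combination (B : ℂ) ^ 2 / 2 * Complex.I_sq
  have hre : ρ.re = (v ^ 2 - B ^ 2 + R) / 2 := by
    rw [hρ', Complex.add_re, Complex.ofReal_re, Complex.re_ofReal_mul]; simp
  have him : ρ.im = v * B := by
    rw [hρ', Complex.add_im, Complex.ofReal_im, Complex.im_ofReal_mul]; simp
  have hrepos : 0 < ρ.re := by rw [hre]; linarith
  have hρ0 : ρ ≠ 0 := fun h0 => by simp [h0] at hrepos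
  have hN : 0 < ‖ρ‖ := norm_pos_iff.2 hρ0
  have hNre : ρ.re ≤ ‖ρ‖ := Complex.re_le_norm ρ
  have hNR : 2 * R < |1 - 2 * α| * ‖ρ‖ ∨ 1 ≤ 2 * α := by
    refine hv1.imp_left fun h1 => h1.trans_le ?_
    rw [← hre]
    gcongr
  -- Substituting (v+iB)² = 2ρ - R leaves real multiples of two real powers of ρ, whose imaginary
  -- parts are sines of multiples of arg ρ.
  have e : ρ ^ ((α : ℂ) - 2) * (((α : ℂ) - 1) * (v + B * Complex.I) ^ 2 + ρ)
      = (2 * α - 1 : ℝ) * ρ ^ ((α - 1 : ℝ) : ℂ) + ((1 - α) * R : ℝ) * ρ ^ ((α - 2 : ℝ) : ℂ) := by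
    have e1 : ρ ^ ((α - 1 : ℝ) : ℂ) = ρ ^ ((α : ℂ) - 2) * ρ := by
      rw [show ((α - 1 : ℝ) : ℂ) = (α : ℂ) - 2 + 1 by push_cast; ring,
        Complex.cpow_add _ _ hρ0, Complex.cpow_one]
    have e2 : ((α - 2 : ℝ) : ℂ) = (α : ℂ) - 2 := by push_cast; ring
    rw [e1, e2]
    have e3 : ((v : ℂ) + B * Complex.I) ^ 2 = 2 * ρ - R := by rw [hρ]; ring
    rw [e3]
    push_cast
    ring
  have key := h v hv2
  rw [e, Complex.add_im, Complex.im_ofReal_mul, Complex.im_ofReal_mul, Complex.cpow_ofReal_im,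
    Complex.cpow_ofReal_im] at key
  have hN1 : ‖ρ‖ ^ (α - 1) = ‖ρ‖ ^ (α - 2) * ‖ρ‖ := by
    rw [← Real.rpow_add_one hN.ne']; ring_nf
  have hNpos : 0 < ‖ρ‖ ^ (α - 2) := Real.rpow_pos_of_pos hN _
  have key' : (2 * α - 1) * ‖ρ‖ * Real.sin ((1 - α) * ρ.arg)
      + (1 - α) * R * Real.sin ((2 - α) * ρ.arg) = 0 := by
    have s1 : Real.sin (ρ.arg * (α - 1)) = -Real.sin ((1 - α) * ρ.arg) := by
      rw [← Real.sin_neg]; ring_nf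
    have s2 : Real.sin (ρ.arg * (α - 2)) = -Real.sin ((2 - α) * ρ.arg) := by
      rw [← Real.sin_neg]; ring_nf
    rw [hN1, s1, s2] at key
    have : ‖ρ‖ ^ (α - 2) * ((2 * α - 1) * ‖ρ‖ * Real.sin ((1 - α) * ρ.arg)
      + (1 - α) * R * Real.sin ((2 - α) * ρ.arg)) = 0 := by linear_combination -key
    exact (mul_eq_zero.1 this).resolve_left hNpos.ne'
  have harg := (Complex.abs_arg_lt_pi_div_two_iff).2 (Or.inl hrepos)
  rw [abs_lt] at harg
  have harg0 : ρ.arg ≠ 0 := by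
    intro h0
    have := (Complex.arg_eq_zero_iff.1 h0).2
    rw [him] at this
    exact (mul_ne_zero hv0.ne' hB) this
  rcases lt_or_gt_of_ne harg0 with hneg | hpos
  · refine sin_combination_ne_zero hα0 hα hR hN hNR (ϑ := -ρ.arg) (by linarith) (by linarith) ?_
    rw [mul_neg, mul_neg, Real.sin_neg, Real.sin_neg]
    linarith
  · exact sin_combination_ne_zero hα0 hα hR hN hNR hpos harg.2 key'

variable {Ω : Type*} [MeasurableSpace Ω] {P : Measure Ω} [IsProbabilityMeasure P]

/-- As Z ≥ 0, all exponential moments of nonpositive order are finite, so the complex moment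
generating function is analytic on the open left half-plane. -/
lemma differentiableAt_laplace {Z : Ω → ℝ≥0} (hZ : Measurable Z) {s : ℂ} (hs : 0 < s.re) :
    DifferentiableAt ℂ (fun s => ∫ ω, Complex.exp (-(s * (Z ω : ℝ))) ∂P) s := by
  have hset : Set.Iic (0 : ℝ) ⊆ integrableExpSet (fun ω => (Z ω : ℝ)) P := by
    intro x (hx : x ≤ 0)
    refine Integrable.of_bound (by fun_prop) 1 (ae_of_all _ fun ω => ?_)
    rw [Real.norm_eq_abs, Real.abs_exp]
    exact Real.exp_le_one_iff.2 (mul_nonpos_of_nonpos_of_nonneg hx (Z ω).coe_nonneg)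
  have hmem : (-s).re ∈ interior (integrableExpSet (fun ω => (Z ω : ℝ)) P) := by
    refine interior_mono hset ?_
    rw [interior_Iic]
    simpa using hs
  have h := (hasDerivAt_complexMGF hmem).differentiableAt.comp s (differentiableAt_id.neg)
  refine h.congr_of_eventuallyEq (Eventually.of_forall fun z => ?_)
  simp [complexMGF]

/-- The drift of a tempered stable normal mixture is determined by its characteristic function:
no other random time change of a Brownian motion with drift has the same law. -/
theorem drift_eq_of_charFun_eq {Z : Ω → ℝ≥0} (hZ : Measurable Z) {α γ l θ β δ : ℝ}
    (hα0 : 0 ≤ α) (hα : α < 1) (hγ : 0 < γ) (hl : 0 < l)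
    (h : ∀ u : ℝ, ∫ ω, Complex.exp (-((u ^ 2 / 2 - Complex.I * u * β) * (Z ω : ℝ))) ∂P
      = Complex.exp (-(γ * tsExponent α l (u ^ 2 / 2 + Complex.I * u * θ)))
        * Complex.exp (Complex.I * u * δ)) :
    β + θ = 0 := by
  set B : ℝ := β + θ with hB
  set R : ℝ := θ ^ 2 + 2 * l with hR
  have hR0 : 0 < R := by positivity
  have hG : 0 < Real.Gamma (1 - α) := Real.Gamma_pos_of_pos (by linarith)
  -- This is l + u²/2 + iuθ at u = v + iβ, with the square completed.
  set ρ : ℂ → ℂ := fun v => ((v + B * Complex.I) ^ 2 + R) / 2 with hρ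
  set K : ℂ := γ * Real.Gamma (1 - α) with hK
  set E : ℂ → ℂ := fun v => -(K * (powPrimitive α (ρ v) - powPrimitive α l))
    + Complex.I * (v + β * Complex.I) * δ with hE
  -- At u = v + iβ the argument u²/2 - iuβ equals (v² + β²)/2.
  set A : ℂ → ℂ := fun v => ∫ ω, Complex.exp (-((v ^ 2 + β ^ 2) / 2 * (Z ω : ℝ))) ∂P with hA
  -- The half-strip contains the far part of the line Im v = -β, where u is real and the hypothesis
  -- applies, and of the real axis, where the conclusion is drawn. Re v > N + |B| keeps ρ and (v² +
  -- β²)/2 in the right half-plane.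
  set N : ℝ := |β| + 1 with hN
  set V : ℝ := N + |B| with hV
  set U : Set ℂ := {v | V < v.re ∧ |v.im| < N} with hU
  have hN0 : 0 < N := by positivity
  have hU_open : IsOpen U :=
    (isOpen_lt continuous_const Complex.continuous_re).inter
      (isOpen_lt Complex.continuous_im.abs continuous_const)
  have hU_convex : Convex ℝ U := by
    have h1 : Convex ℝ {v : ℂ | V < v.re} := convex_halfSpace_re_gt V
    have h2 : Convex ℝ {v : ℂ | v.im < N} := convex_halfSpace_im_lt N
    have h3 : Convex ℝ {v : ℂ | -N < v.im} := convex_halfSpace_im_gt (-N)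
    have : U = {v | V < v.re} ∩ ({v | -N < v.im} ∩ {v | v.im < N}) := by
      ext v
      simp only [hU, Set.mem_ofPred_eq, Set.mem_inter_iff, abs_lt]
    rw [this]
    exact h1.inter (h3.inter h2)
  have hsq : ∀ v ∈ U, ∀ b : ℝ, |b| ≤ |B| → 0 < ((v + b * Complex.I) ^ 2).re := by
    rintro v ⟨h1, h2⟩ b hb
    have e : ((v + b * Complex.I) ^ 2).re = v.re ^ 2 - (v.im + b) ^ 2 := by
      rw [sq, Complex.mul_re]
      simp
      ring
    have h3 : |v.im + b| < v.re := by
      have := abs_add_le v.im b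
      linarith
    have h4 := sq_lt_sq' (by linarith [abs_lt.1 h3 |>.1]) (abs_lt.1 h3).2
    rw [e]
    linarith
  have hρU : ∀ v ∈ U, ρ v ∈ Complex.slitPlane := by
    intro v hv
    left
    have := hsq v hv B le_rfl
    have e : (ρ v).re = (((v + B * Complex.I) ^ 2).re + R) / 2 := by
      simp only [hρ]
      rw [Complex.div_ofNat_re, Complex.add_re, Complex.ofReal_re]
    rw [e]
    positivity
  have hρd : ∀ v, HasDerivAt ρ (v + B * Complex.I) v := by
    intro v
    have := ((((hasDerivAt_id v).add_const (B * Complex.I)).pow 2).add_const (R : ℂ)).div_const 2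
    refine this.congr_deriv ?_
    simp
  have hEd : ∀ v ∈ U, HasDerivAt E (-(K * (ρ v ^ ((α : ℂ) - 1) * (v + B * Complex.I)))
      + Complex.I * δ) v := by
    intro v hv
    have h1 := ((hasDerivAt_powPrimitive α (hρU v hv)).comp v (hρd v)).sub_const (powPrimitive α l)
    have h2 := (((hasDerivAt_id v).add_const (β * Complex.I)).const_mul Complex.I).mul_const (δ : ℂ)
    refine ((h1.const_mul K).neg.add h2).congr_deriv ?_
    simp
  have hAd : ∀ v ∈ U, DifferentiableAt ℂ A v := by
    intro v hv
    have hre : 0 < ((v ^ 2 + β ^ 2) / 2).re := by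
      have := hsq v hv 0 (by simp)
      rw [Complex.div_ofNat_re, Complex.add_re, ← Complex.ofReal_pow, Complex.ofReal_re]
      simp only [Complex.ofReal_zero, zero_mul, add_zero] at this
      positivity
    exact (differentiableAt_laplace (P := P) hZ hre).comp v
      (f := fun v : ℂ => (v ^ 2 + (β : ℂ) ^ 2) / 2)
      (by fun_prop)
  have hAE : Set.EqOn A (fun v => Complex.exp (E v)) U := by
    refine eqOn_of_eventually_eq_segment (z := (V + 1 : ℝ) - β * Complex.I) (d := 1)
      (DifferentiableOn.analyticOnNhd (fun v hv => (hAd v hv).differentiableWithinAt) hU_open)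
      (DifferentiableOn.analyticOnNhd (fun v hv =>
        (hEd v hv).differentiableAt.cexp.differentiableWithinAt) hU_open)
      hU_convex.isPreconnected ⟨?_, ?_⟩ one_ne_zero ?_
    · simp
    · simp [hN]
    · refine Eventually.of_forall fun x => ?_
      have hu := h (V + 1 + x)
      simp only [hA, hE]
      rw [tsExponent_eq_powPrimitive hα0 hα hl (by rw [re_normal_exponent]; positivity),
        ← Complex.exp_add] at hu
      have e1 : ((((V + 1 : ℝ) : ℂ) - β * Complex.I + x * 1) ^ 2 + β ^ 2) / 2
          = ((V + 1 + x : ℝ) : ℂ) ^ 2 / 2 - Complex.I * (V + 1 + x : ℝ) * β := by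
        push_cast
        linear_combination (β : ℂ) ^ 2 / 2 * Complex.I_sq
      have e2 : ρ (((V + 1 : ℝ) : ℂ) - β * Complex.I + x * 1)
          = l + (((V + 1 + x : ℝ) : ℂ) ^ 2 / 2 + Complex.I * (V + 1 + x : ℝ) * θ) := by
        simp only [hρ, hB, hR]
        push_cast
        linear_combination (θ : ℂ) ^ 2 / 2 * Complex.I_sq
      rw [e1, hu, e2]
      congr 1
      simp only [hK]
      push_cast
      ring
  have hreal : ∀ v : ℝ, V < v → (v : ℂ) ∈ U := fun v hv => ⟨by simpa using hv, by simpa using hN0⟩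
  have him : ∀ v : ℝ, V < v → (Complex.exp (E v)).im = 0 := by
    intro v hv
    rw [show Complex.exp (E v) = A v from (hAE (hreal v hv)).symm]
    have : A v = ((∫ ω, Real.exp (-((v ^ 2 + β ^ 2) / 2 * (Z ω : ℝ))) ∂P : ℝ) : ℂ) := by
      rw [← integral_complex_ofReal]
      simp only [hA]
      push_cast
      rfl
    rw [this, Complex.ofReal_im]
  have hnear : ∀ v : ℝ, V < v → ∀ᶠ y : ℝ in 𝓝 v, V < y := fun v hv => Ioi_mem_nhds hv
  have him1 : ∀ v : ℝ, V < v → (-(K * (ρ v ^ ((α : ℂ) - 1) * (v + B * Complex.I)))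
      + Complex.I * δ).im = 0 := by
    intro v hv
    -- The derivative of exp E is exp E times E'; the real nonzero factor exp E is divided out.
    refine im_eq_zero_of_mul (him v hv) (Complex.exp_ne_zero _) ?_
    exact im_eq_zero_of_hasDerivAt (hEd v (hreal v hv)).cexp.comp_ofReal
      ((hnear v hv).mono fun y hy => him y hy)
  -- One more derivative removes the unknown shift δ.
  refine eq_zero_of_im_eq_zero hα0 hα hR0 (v₀ := V) fun v hv => ?_
  have hd2 : HasDerivAt (fun v => -(K * (ρ v ^ ((α : ℂ) - 1) * (v + B * Complex.I)))
      + Complex.I * δ) (((-(γ * Real.Gamma (1 - α)) : ℝ) : ℂ) * (ρ v ^ ((α : ℂ) - 2) *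
        (((α : ℂ) - 1) * (v + B * Complex.I) ^ 2 + ρ v))) (v : ℂ) := by
    have h1 := (((hρd v).cpow_const (c := (α : ℂ) - 1) (hρU v (hreal v hv))).mul
      ((hasDerivAt_id (v : ℂ)).add_const (B * Complex.I)))
    refine ((h1.const_mul K).neg.add_const _).congr_deriv ?_
    have hρ0 : ρ v ≠ 0 := Complex.slitPlane_ne_zero (hρU v (hreal v hv))
    have e1 : ρ v ^ ((α : ℂ) - 1) = ρ v ^ ((α : ℂ) - 2) * ρ v := by
      rw [show (α : ℂ) - 1 = (α : ℂ) - 2 + 1 by ring, Complex.cpow_add _ _ hρ0, Complex.cpow_one]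
    have e2 : (α : ℂ) - 1 - 1 = α - 2 := by ring
    rw [e1, e2, hK]
    push_cast
    simp only [id]
    ring
  have := im_eq_zero_of_hasDerivAt hd2.comp_ofReal ((hnear v hv).mono fun y hy => him1 y hy)
  refine im_eq_zero_of_mul (Complex.ofReal_im _) ?_ this
  have : -(γ * Real.Gamma (1 - α)) ≠ 0 := by
    have := mul_pos hγ hG
    linarith
  exact_mod_cast this

end Drift

/-! ### The two implications for an ATS -/

section Characterization

variable {Ω : Type*} [MeasurableSpace Ω] {P : Measure Ω} {α : ℝ} {σ k η φ : ℝ≥0 → ℝ}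

/-- The function `η` of an ATS obtained by additive subordination is constant. -/
theorem eta_eq_const_of_isAdditivelySubordinatedBM [IsProbabilityMeasure P]
    (hparam : IsATSParameters α σ k η φ) {X : ℝ≥0 → Ω → ℝ}
    (hX : IsAdditivelySubordinatedBM P X) (hATS : IsATS P α σ k η φ X) :
    ∃ c : ℝ, ∀ t : ℝ≥0, 0 < t → η t = c := by
  obtain ⟨W, Z, a, b, c, hB, hW, hZ, hind, ha, hXeq⟩ := hX
  -- In the Brownian clock aZ_t the drift is b/a, and it must equal -(1/2 + η_t).
  refine ⟨-(b / a) - 1 / 2, fun t ht => ?_⟩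
  have ha0 : (a : ℝ) ≠ 0 := by exact_mod_cast ha.ne'
  have hZt : Measurable (Z t) := measurable_coe_nnreal_real_iff.1 (hZ.additive.measurable t)
  have hτ : Measurable fun ω => a * Z t ω := hZt.const_mul a
  have hi : IndepFun (fun ω t => W t ω) (fun ω => a * Z t ω) P :=
    hind.comp (φ := id) (ψ := fun z : ℝ≥0 → ℝ≥0 => a * z t) measurable_id
      (by fun_prop)
  have hα := hparam.alpha_lt_one
  have hσ := hparam.sigma_pos t
  have hk := hparam.k_pos t ht
  have key := drift_eq_of_charFun_eq (P := P) hτ (θ := 1 / 2 + η t) (β := b / a)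
    (δ := φ t * t - c t) hparam.alpha_nonneg hα (atsActivity_pos hα (t := t) ht hσ hk)
    (atsTempering_pos hα hσ hk) fun u => ?_
  · linarith
  have h1 := integral_cexp_brownian_randomTime hW hB hτ hi u (b / a)
  have h2 := hATS.charFun_eq t ht u
  rw [atsCharFun_eq hparam ht, charFun_apply_real,
    integral_map (hATS.additive.measurable t).aemeasurable (by fun_prop)] at h2
  have e : ∀ ω, Complex.exp (u * (X t ω : ℝ) * Complex.I)
      = Complex.exp (((u * (W (a * Z t ω) ω + b / a * (a * Z t ω : ℝ≥0)) : ℝ) : ℂ) * Complex.I)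
        * Complex.exp (Complex.I * u * c t) := by
    intro ω
    rw [← Complex.exp_add, hXeq]
    congr 1
    have : b / a * ((a * Z t ω : ℝ≥0) : ℝ) = b * Z t ω := by
      push_cast
      field_simp
    rw [this]
    push_cast
    ring
  simp_rw [e] at h2
  rw [integral_mul_const, h1] at h2
  have e3 : Complex.exp (Complex.I * u * ((φ t * t - c t : ℝ) : ℂ))
      = Complex.exp (Complex.I * u * (φ t * (t : ℝ) : ℝ))
        * (Complex.exp (Complex.I * u * c t))⁻¹ := by
    rw [← Complex.exp_neg, ← Complex.exp_add]
    congr 1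
    push_cast
    ring
  rw [e3, ← mul_assoc, ← h2, mul_inv_cancel_right₀ (Complex.exp_ne_zero _)]

/-- At 0 the factor t makes the value 0 whatever φ is there, and the limit assumption matches it. -/
lemma IsATSParameters.continuous_phi_mul (hparam : IsATSParameters α σ k η φ) :
    Continuous fun t : ℝ≥0 => φ t * (t : ℝ) := by
  rw [continuous_iff_continuousAt]
  intro t
  rcases eq_zero_or_pos t with rfl | ht
  · have h1 : insert (0 : ℝ≥0) (Set.Ioi 0) = Set.univ := by
      ext s
      simp
    have h2 : ContinuousWithinAt (fun t : ℝ≥0 => φ t * (t : ℝ)) (Set.Ioi 0) 0 := by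
      simpa [ContinuousWithinAt] using hparam.phi_tendsto
    rw [← continuousWithinAt_univ, ← h1, continuousWithinAt_insert_self]
    exact h2
  · have := hparam.phi_continuousOn.continuousAt (Ioi_mem_nhds ht)
    fun_prop

/-- The levels of the jumps of the subordinator of an admissible ATS with constant `η`. -/
theorem IsATS.isJumpLevel [IsProbabilityMeasure P] (hparam : IsATSParameters α σ k η φ)
    {f : ℝ≥0 → Ω → ℝ} (hf : IsATS P α σ k η φ f) {c : ℝ} (hη : ∀ t, 0 < t → η t = c) :
    IsJumpLevel (fun z => z ^ (-1 - α)) fun t z =>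
      atsActivity α t (σ t) (k t) * Real.exp (-atsTempering α (σ t) (k t) * z) := by
  have hα := hparam.alpha_lt_one
  have hG : Real.Gamma (1 - α) ≠ 0 := (Real.Gamma_pos_of_pos (by linarith)).ne'
  have hl : ∀ t, 0 < t → 0 < atsTempering α (σ t) (k t) := fun t ht =>
    atsTempering_pos hα (hparam.sigma_pos t) (hparam.k_pos t ht)
  have hσc := hparam.sigma_continuous
  have hkc := hparam.k_continuous
  have hlc : ContinuousOn (fun t => atsTempering α (σ t) (k t)) (Set.Ioi 0) := by
    unfold atsTempering
    refine ContinuousOn.div (by fun_prop) (by fun_prop) fun t ht => ?_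
    have := hparam.sigma_pos t
    have := hparam.k_pos t ht
    positivity
  refine isJumpLevel_tempered hparam.alpha_nonneg hα (γ := fun t => atsActivity α t (σ t) (k t))
    (l := fun t => atsTempering α (σ t) (k t)) (m := fun t => t * σ t ^ 2)
    (by simp [atsActivity])
    (fun t ht => (atsActivity_pos hα ht (hparam.sigma_pos t) (hparam.k_pos t ht)).le) hl
    (hf.monotoneOn_activity hparam hη) (hf.antitoneOn_tempering hparam hη) ?_ hlc
    (by fun_prop) (by simp) fun t ht => ?_
  · unfold atsActivity
    refine ContinuousOn.div_const (ContinuousOn.mul (by fun_prop)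
      (hlc.rpow_const fun t ht => Or.inl (hl t ht).ne')) _
  · have := hl t ht
    have e : atsTempering α (σ t) (k t) ^ (1 - α) * atsTempering α (σ t) (k t) ^ (α - 1) = 1 := by
      rw [← Real.rpow_add this]; simp
    unfold atsActivity
    field_simp
    linear_combination (σ t ^ 2 : ℝ) * e

/-- A continuous Brownian motion with drift, subordinated by an independent subordinator with
tempered stable marginals, is an ATS. -/
theorem isATS_subordinated {Ω₁ Ω₂ : Type*} [MeasurableSpace Ω₁] [MeasurableSpace Ω₂]
    {P₁ : Measure Ω₁} {P₂ : Measure Ω₂} [IsProbabilityMeasure P₁] [IsProbabilityMeasure P₂]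
    {W : ℝ≥0 → Ω₁ → ℝ} {Z : ℝ≥0 → Ω₂ → ℝ≥0} (hparam : IsATSParameters α σ k η φ) {c : ℝ}
    (hη : ∀ t, 0 < t → η t = c) (hW : ∀ t, Measurable (W t)) (hB : IsBrownianReal W P₁)
    (hWc : ∀ ω, Continuous fun t => W t ω) (hZm : ∀ t, Measurable (Z t))
    (hZ : IsAdditiveSubordinator P₂ Z)
    (hL : ∀ t, 0 < t → ∀ w : ℂ, 0 ≤ w.re → ∫ ω, Complex.exp (-(w * (Z t ω : ℝ))) ∂P₂
      = Complex.exp (-(atsActivity α t (σ t) (k t)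
        * tsExponent α (atsTempering α (σ t) (k t)) w))) :
    ∃ X, IsAdditivelySubordinatedBM (P₁.prod P₂) X ∧ IsATS (P₁.prod P₂) α σ k η φ X := by
  have h1 : MeasurePreserving Prod.fst (P₁.prod P₂) P₁ := measurePreserving_fst
  have h2 : MeasurePreserving Prod.snd (P₁.prod P₂) P₂ := measurePreserving_snd
  have hWm : ∀ t, Measurable fun ω : Ω₁ × Ω₂ => W t ω.1 := fun t => (hW t).comp measurable_fst
  have hZm' : ∀ t, Measurable fun ω : Ω₁ × Ω₂ => Z t ω.2 := fun t => (hZm t).comp measurable_snd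
  have hB' := isBrownianReal_comp_measurePreserving hB hW h1
  have hZ' := hZ.comp_measurePreserving h2
  have hind : IndepFun (fun (ω : Ω₁ × Ω₂) t => W t ω.1) (fun ω t => Z t ω.2) (P₁.prod P₂) :=
    indepFun_prod (X := fun x t => W t x) (Y := fun y t => Z t y)
      (measurable_pi_lambda _ hW) (measurable_pi_lambda _ hZm)
  set θ : ℝ := 1 / 2 + c with hθ
  have hadd := isAdditiveProcess_subordinated hWm hB' (fun ω => hWc ω.1) hZm' hZ' hind (-θ)
    hparam.continuous_phi_mul (by simp)
  refine ⟨_, ⟨fun t ω => W t ω.1, fun t ω => Z t ω.2, 1, -θ, fun t => φ t * t, hB', hWm, hZ', hind,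
    one_pos, fun t ω => ?_⟩, hadd, fun t ht u => ?_⟩
  · simp only [one_mul]
  have hi : IndepFun (fun (ω : Ω₁ × Ω₂) t => W t ω.1) (fun ω => Z t ω.2) (P₁.prod P₂) :=
    hind.comp (φ := id) (ψ := fun z : ℝ≥0 → ℝ≥0 => z t) measurable_id (measurable_pi_apply t)
  have key := integral_cexp_brownian_randomTime hWm hB' (hZm' t) hi u (-θ)
  have hLt := hL t ht (u ^ 2 / 2 + Complex.I * u * θ) (by rw [re_normal_exponent]; positivity)
  rw [← h2.map_eq, integral_map h2.measurable.aemeasurable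
    (Measurable.aestronglyMeasurable (by have := hZm t; fun_prop))] at hLt
  rw [atsCharFun_eq hparam ht, hη t ht, ← hθ, ← hLt, charFun_apply_real,
    integral_map (hadd.measurable t).aemeasurable (by fun_prop)]
  have e : ∀ ω : Ω₁ × Ω₂, -(((u : ℂ) ^ 2 / 2 - Complex.I * u * (-θ : ℝ)) * (Z t ω.2 : ℝ))
      = -(((u : ℂ) ^ 2 / 2 + Complex.I * u * θ) * (Z t ω.2 : ℝ)) := fun ω => by
    push_cast; ring
  simp_rw [e] at key
  rw [← key, ← integral_mul_const]
  refine integral_congr_ae (ae_of_all _ fun ω => ?_)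
  simp only
  rw [← Complex.exp_add]
  congr 1
  push_cast
  ring

end Characterization

/-! ### Assembly of the equivalence -/

theorem mainTheorem3 (α : ℝ) (σ k η φ : ℝ≥0 → ℝ) (hparam : IsATSParameters α σ k η φ)
    (hexists : ∃ (Ω : Type u) (_ : MeasurableSpace Ω) (P : Measure Ω) (_ : IsProbabilityMeasure P)
      (f : ℝ≥0 → Ω → ℝ), IsATS P α σ k η φ f) :
    (∃ (Ω : Type v) (_ : MeasurableSpace Ω) (P : Measure Ω) (_ : IsProbabilityMeasure P)
      (X : ℝ≥0 → Ω → ℝ), IsAdditivelySubordinatedBM P X ∧ IsATS P α σ k η φ X) ↔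
    ∃ c : ℝ, ∀ t : ℝ≥0, 0 < t → η t = c := by
  constructor
  · rintro ⟨Ω, _, P, _, X, hX, hATS⟩
    exact eta_eq_const_of_isAdditivelySubordinatedBM hparam hX hATS
  · rintro ⟨c, hη⟩
    obtain ⟨Ω₀, _, P₀, _, f, hf⟩ := hexists
    have hg := hf.isJumpLevel hparam hη
    obtain ⟨r, q, hq, hrq⟩ := exists_pointIntensity_eq (jumpIntensity fun z => z ^ (-1 - α))
    -- The constructed space must lie in `Type v`; lifting one factor of the product is enough.
    set Q : Measure (ULift.{v} (ℕ → ℕ × (ℕ → ℝ × ℝ))) := (pointLaw r q).map ULift.up with hQ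
    have hprob : IsProbabilityMeasure Q :=
      Measure.isProbabilityMeasure_map measurable_up.aemeasurable
    have hdown : MeasurePreserving ULift.down Q (pointLaw r q) := by
      refine ⟨measurable_down, ?_⟩
      rw [hQ, Measure.map_map measurable_down measurable_up]
      exact Measure.map_id
    have hZm := fun t => hg.measurable_jumpSum t
    obtain ⟨X, hX⟩ := isATS_subordinated hparam hη measurable_wiener isBrownianReal_wiener
      continuous_wiener (fun t => (hZm t).comp measurable_down)
      ((hg.isAdditiveSubordinator_jumpSum hrq).comp_measurePreserving hdown) fun t ht w hw => by
        rw [← integral_exp_neg_jumpSum_tempered hg hrq t hw, ← hdown.map_eq,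
          integral_map measurable_down.aemeasurable (Measurable.aestronglyMeasurable (by
            have := hZm t
            fun_prop))]
        rfl
    exact ⟨_, _, _, inferInstance, X, hX⟩
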